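/- **Conventions.** For a prime $N$ identify $\mathbb Z_N=\mathbb Z/N\mathbb Z$ with $\{0,1,\dots,N-1\}$, and write $\mathbb E(g(x)\mid x\in A)$ for the arithmetic mean of $g$ over a finite set $A$. Let $m_0,t,L,q_0$ be non-negative integers. A *pseudorandom weight* (with parameters $m_0,t,L,q_0$) is a family of functions $\nu=\nu_N\colon\mathbb Z_N\to[0,\infty)$, $N$ prime, such that: (i) (linear forms condition) For every $\varepsilon>0$ there is $N_0$ such that for every prime $N\ge N_0$, every $m\le m_0$, and all maps $\psi_i(\mathbf x)=c_i+\sum_{j=1}^{t}A_{ij}x_j$ ($1\le i\le m$) from $\mathbb Z_N^t$ to $\mathbb Z_N$ with $c_i,A_{ij}\in\mathbb Z$, $|A_{ij}|\le L$, and with the vectors $(A_{ij})_{1\le j\le t}$ nonzero and pairwise non-collinear, one has $$\Bigl|\mathbb E\bigl(\nu(\psi_1(\mathbf x))\cdots\nu(\psi_m(\mathbf x))\mid \mathbf x\in\mathbb Z_N^t\bigr)-1\Bigr|\le\varepsilon .$$ (ii) (correlation condition) There are functions $\tau=\tau_N\colon\mathbb Z_N\to[0,\infty)$ such that for every real $p\ge1$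 the means $\mathbb E(\tau_N(x)^p\mid x\in\mathbb Z_N)$ are bounded uniformly in $N$, and such that for every prime $N$, every $1\le q\le q_0$ and all $h_1,\dots,h_q\in\mathbb Z_N$, distinct or not, $$\mathbb E\bigl(\nu(x+h_1)\cdots\nu(x+h_q)\mid x\in\mathbb Z_N\bigr)\le\sum_{1\le i\le j\le q}\tau(h_i-h_j).$$ **Theorem.** For all non-negative integers $m_0,t,L,q_0$ there exist - a $C^\infty$ function $\chi\colon\mathbb R\to[0,\infty)$ supported in $[-1,1]$, with $\chi(0)>0$ and $\int_0^\infty\chi'(x)^2\,dx=1$; - an integer-valued function $w(N)$ tending to infinity with $w(N)=O(\log\log N)$ as $N\to\infty$; write $W=W(N)=\prod_{p\le w(N),\ p\text{ prime}}p$; - integers $b=b(N)$ which, for every prime $N$, satisfy $1\le b<W$ and $\gcd(b,W)=1$; - constants $\alpha\in(0,1)$, $\delta>0$ and $C$, independent of $N$; write $R=N^\alpha$; - families of functions $\nu=\nu_N\colon\mathbb Z_N\to[0,\infty)$ and $f=f_N\colon\mathbb Z_N\to\mathbb R$, $N$ prime; such that $\nu$ is a pseudorandom weight with parameters $m_0,t,L,q_0$,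 and such that for every prime $N$: 1. for all $n\in\{0,\dots,N-1\}$, $$\nu(n)=\frac{\varphi(W)}{W}\,\log R\;\lambda(Wn+b)^2,\qquad \lambda(r)=\sum_{d\mid r}\mu(d)\,\chi\Bigl(\frac{\log d}{\log R}\Bigr),$$ where $\varphi$ is Euler's function and $\mu$ is the Möbius function; 2. $f(n)=0$ for every $n\in\{0,\dots,N-1\}$ such that $Wn+b$ is not prime; 3. $0\le f(x)\le\nu(x)$ for all $x\in\mathbb Z_N$; 4. $\mathbb E(f\mid\mathbb Z_N)\ge\delta$; 5. $|f(x)|\le C\log N$ for all $x\in\mathbb Z_N$. -/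

import Mathlib

open scoped BigOperators ContDiff

noncomputable section

namespace PrimeWeight

/-- The linear forms condition with parameters `m₀`, `t`, `L`, for a family of functions
`ν N : ZMod N → ℝ` indexed by the primes `N`. The error term is uniform in the number `m ≤ m₀` of
forms, in their integer coefficients `A i j` bounded by `L` in absolute value (the coefficient
vectors being nonzero and pairwise non-collinear), and in the arbitrary integer constants `c i`. -/
def LinearFormsCondition (m₀ t L : ℕ) (ν : ∀ N : ℕ, ZMod N → ℝ) : Prop :=
  ∀ ε : ℝ, 0 < ε → ∃ N₀ : ℕ, ∀ (N : ℕ) [Fact N.Prime], N₀ ≤ N →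
    ∀ m : ℕ, m ≤ m₀ → ∀ (A : Fin m → Fin t → ℤ) (c : Fin m → ℤ),
      (∀ i j, |A i j| ≤ (L : ℤ)) →
      (∀ i, A i ≠ 0) →
      (∀ i i', i ≠ i' → LinearIndependent ℤ ![A i, A i']) →
      |(𝔼 x : Fin t → ZMod N,
          ∏ i, ν N ((c i : ZMod N) + ∑ j, (A i j : ZMod N) * x j)) - 1| ≤ ε

/-- The correlation condition with parameter `q₀`: there are functions `τ N ≥ 0` on `ZMod N` all of
whose moments are bounded independently of `N`, and which control the correlations of `ν N`
along any `q ≤ q₀` shifts, distinct or not. -/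
def CorrelationCondition (q₀ : ℕ) (ν : ∀ N : ℕ, ZMod N → ℝ) : Prop :=
  ∃ τ : ∀ N : ℕ, ZMod N → ℝ,
    (∀ (N : ℕ) [Fact N.Prime] (x : ZMod N), 0 ≤ τ N x) ∧
    (∀ p : ℝ, 1 ≤ p → ∃ C : ℝ, ∀ (N : ℕ) [Fact N.Prime], (𝔼 x : ZMod N, τ N x ^ p) ≤ C) ∧
    (∀ (N : ℕ) [Fact N.Prime] (q : ℕ), 1 ≤ q → q ≤ q₀ → ∀ h : Fin q → ZMod N,
      (𝔼 x : ZMod N, ∏ i, ν N (x + h i)) ≤ ∑ i, ∑ j ∈ Finset.Ici i, τ N (h i - h j))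

/-- Pseudorandom weights (families indexed by the primes `N`), with parameters
`m₀`, `t`, `L` for the linear forms and `q₀` for the correlations. -/
structure IsPseudorandomWeight (m₀ t L q₀ : ℕ) (ν : ∀ N : ℕ, ZMod N → ℝ) : Prop where
  nonneg : ∀ (N : ℕ) [Fact N.Prime] (x : ZMod N), 0 ≤ ν N x
  linearForms : LinearFormsCondition m₀ t L ν
  correlation : CorrelationCondition q₀ ν

/-- The admissible smooth cutoff functions. -/
structure IsSmoothCutoff (χ : ℝ → ℝ) : Prop where
  smooth : ContDiff ℝ ∞ χ
  nonneg : ∀ x, 0 ≤ χ x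
  support_subset : Function.support χ ⊆ Set.Icc (-1) 1
  pos_zero : 0 < χ 0
  integral_deriv_sq : ∫ x in Set.Ioi (0 : ℝ), (deriv χ x) ^ 2 = 1

/-- The smoothed divisor sum `λ(n) = ∑_{d ∣ n} μ(d) χ(log d / log R)`, for `n ≥ 1`. -/
def smoothedDivisorSum (χ : ℝ → ℝ) (R : ℝ) (n : ℕ) : ℝ :=
  ∑ d ∈ n.divisors, (ArithmeticFunction.moebius d : ℝ) * χ (Real.log d / Real.log R)

/-- The sieve weight `n ↦ (φ(W) / W) (log R) λ(Wn + b)²`, for `n ∈ [0, N)` identified with its class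
modulo `N`. -/
def sieveWeight (χ : ℝ → ℝ) (R : ℝ) (W b N : ℕ) (x : ZMod N) : ℝ :=
  (Nat.totient W : ℝ) / W * Real.log R * smoothedDivisorSum χ R (W * x.val + b) ^ 2

end PrimeWeight

end

/-! The weight is a Selberg-type sieve in one residue class modulo `W`. Its correlations follow the
Goldston–Yıldırım method, with Fourier analysis replacing contour integration.

Every `λ²` is expanded over finite sets of primes. The cutoff keeps each modulus at most `R²`. A
mean of divisibility indicators is computed by averaging `x` further over a box whose side is the
total modulus. Unless a form value lies near `0` or `N`, the forms take honest integer values on the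
box and the Chinese remainder theorem factors the mean into local densities
(`abs_expect_indicator_sub_le`, `abs_expect_prod_sub_le`). When `8mα ≤ 1` the total error is a power
of `log N` times `N^(-1/2)`. The densities depend on `x` through representatives of the form values,
but all estimates are uniform in `x`.

With `Λ = log R`, `cutoff_eq_integral` writes `χ(log d / Λ)` as a superposition of the
multiplicative functions `d^(-s/Λ)` with `Re s = 1`, so the sieve sum is an integral of Euler
products (`sieveSum_eq_integral`). At each prime `p > w` the local factor agrees to first order with
a product of models `(1 - u/p)(1 - u'/p)/(1 - uu'/p)`; the ratio is `1 + O(1/p²)`, or only `1 +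
O(1/p)` at exceptional primes, where two forms may be divisible by `p` together too often
(`exists_localSum_eq`). Up to the primes `p ≤ w`, the model product is `ζ(1 + (s+s')/Λ) / (ζ(1 +
s/Λ) ζ(1 + s'/Λ))`. Multiplied by `(φ(W)/W) Λ` it tends to `ss'/(s+s')`, whose integral against the
densities is `∫₀^∞ χ'² = 1` (`integral_density_kernel`). Hence `exists_sieveSum_asymptotics`: the
normalised sum is `1 + O(1/w)` without exceptional primes, and in general at most a constant times
the product of `1 + C/p` over them.

For linear forms, an exceptional prime would divide a nonzero `2 × 2` minor of size at most `2L² ≤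
w`, so there is none. For correlations, exceptional primes divide differences of representatives,
and the resulting arithmetic factor has bounded moments; it serves as `τ` away from `0`. At `0`, `τ`
is a power of `1 + sup ν`, which is `N^{o(1)}` and affects a single point of mass `1/N`.

Finally `f` is `ν` restricted to the `x` with `Wx + b` a prime exceeding `R`, where `λ = χ(0)`.
Chebyshev's lower bound and the pigeonhole principle over reduced classes supply `b`
(`exists_residue_le_expect`). All estimates are for fixed `w` and large `N`; a diagonal choice lets
`w(N)` grow slowly, and the finitely many small `N` use `W = 2`, `b = 1`. -/

namespace PrimeWeight

open MeasureTheory Filter Topology Complex FourierTransform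
open scoped Real SchwartzMap

/-! ### Existence of a cutoff -/

theorem exists_isSmoothCutoff : ∃ χ : ℝ → ℝ, IsSmoothCutoff χ := by
  let g : ContDiffBump (0 : ℝ) := ⟨1 / 2, 1, by norm_num, by norm_num⟩
  have hg : ContDiff ℝ ∞ (g : ℝ → ℝ) := g.contDiff
  have hgd : Continuous (deriv g) := hg.continuous_deriv (by norm_cast)
  have hcs : HasCompactSupport (fun x => deriv g x ^ 2) := by
    have := g.hasCompactSupport.deriv
    exact this.comp_left (g := fun y : ℝ => y ^ 2) (by norm_num)
  have hint : Integrable (fun x => deriv g x ^ 2) :=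
    (hgd.pow 2).integrable_of_hasCompactSupport hcs
  set I : ℝ := ∫ x in Set.Ioi (0 : ℝ), deriv g x ^ 2 with hI
  have hI0 : 0 ≤ I := integral_nonneg fun x => sq_nonneg _
  have hIne : I ≠ 0 := by
    intro h0
    have h1 := (setIntegral_eq_zero_iff_of_nonneg_ae
      (Eventually.of_forall fun x => sq_nonneg (deriv g x)) hint.integrableOn).1 h0
    have h2 : Set.EqOn (deriv g) 0 (Set.Ioi 0) := by
      have h3 : (deriv g) =ᵐ[volume.restrict (Set.Ioi 0)] 0 := by
        filter_upwards [h1] with x hx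
        simpa using hx
      exact Measure.eqOn_open_of_ae_eq h3 isOpen_Ioi hgd.continuousOn continuousOn_const
    -- The point `2` lies beyond the outer radius `1` and `1/4` within the inner radius `1/2`, so a
    -- bump constant on `(0, ∞)` would have `0 = 1`.
    have h4 : (g : ℝ → ℝ) 2 = g (1 / 4) := by
      have hd : DifferentiableOn ℝ g (Set.Ioi 0) :=
        (hg.differentiable (by simp)).differentiableOn
      exact isOpen_Ioi.is_const_of_deriv_eq_zero isPreconnected_Ioi hd h2
        (by norm_num : (2 : ℝ) ∈ Set.Ioi 0) (by norm_num : (1 / 4 : ℝ) ∈ Set.Ioi 0)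
    have h5 : (g : ℝ → ℝ) 2 = 0 := g.zero_of_le_dist (by
      simp only [Real.dist_eq]; norm_num [g])
    have h6 : (g : ℝ → ℝ) (1 / 4) = 1 := g.one_of_mem_closedBall (by
      simp only [Metric.mem_closedBall, Real.dist_eq]; norm_num [g, abs_of_pos])
    linarith
  have hIpos : 0 < I := lt_of_le_of_ne hI0 (Ne.symm hIne)
  have hc : 0 < (Real.sqrt I)⁻¹ := inv_pos.2 (Real.sqrt_pos.2 hIpos)
  refine ⟨fun x => (Real.sqrt I)⁻¹ * g x, contDiff_const.mul hg,
    fun x => mul_nonneg hc.le g.nonneg, ?_, ?_, ?_⟩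
  · intro x hx
    have hx' : (g : ℝ → ℝ) x ≠ 0 := right_ne_zero_of_mul hx
    have hm : x ∈ Function.support g := hx'
    rw [g.support_eq] at hm
    have : |x| < 1 := by simpa [g] using hm
    exact ⟨(abs_lt.1 this).1.le, (abs_lt.1 this).2.le⟩
  · have : (g : ℝ → ℝ) 0 = 1 := g.one_of_mem_closedBall (by simp [g])
    simp only [this, mul_one]; exact hc
  · have hder : ∀ x, deriv (fun x => (Real.sqrt I)⁻¹ * g x) x = (Real.sqrt I)⁻¹ * deriv g x :=
      fun x => deriv_const_mul _ (hg.differentiable (by simp) x)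
    simp_rw [hder, mul_pow]
    rw [integral_const_mul, inv_pow, Real.sq_sqrt hI0]
    exact inv_mul_cancel₀ hIne

/-! ### Exponential representation of the cutoff -/

/-- The exponents `1 - 2πiξ` appearing in the exponential representation of a cutoff. -/
noncomputable def expo (ξ : ℝ) : ℂ := 1 - 2 * π * ξ * I

/-- The density `ψ` in the representation `χ(x) = ∫ ψ(ξ) e^{-x (1 - 2πiξ)} dξ`. -/
noncomputable def density (χ : ℝ → ℝ) : ℝ → ℂ := 𝓕 (fun x : ℝ => (Real.exp x * χ x : ℂ))

@[simp] theorem expo_re (ξ : ℝ) : (expo ξ).re = 1 := by simp [expo]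

theorem continuous_expo : Continuous expo := by unfold expo; fun_prop

theorem one_le_norm_expo (ξ : ℝ) : 1 ≤ ‖expo ξ‖ := by
  simpa using (abs_re_le_norm (expo ξ))

theorem expo_ne_zero (ξ : ℝ) : expo ξ ≠ 0 := by
  intro h
  have := one_le_norm_expo ξ
  rw [h, norm_zero] at this
  linarith

theorem norm_expo_le (ξ : ℝ) : ‖expo ξ‖ ≤ 7 * (1 + ‖ξ‖) := by
  have h1 : ‖(2 * π * ξ * I : ℂ)‖ = 2 * π * ‖ξ‖ := by
    simp [abs_of_pos Real.pi_pos]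
  have h2 : ‖expo ξ‖ ≤ 1 + 2 * π * ‖ξ‖ := by
    rw [← h1]; simpa [expo] using norm_sub_le (1 : ℂ) (2 * π * ξ * I)
  have := Real.pi_lt_d2
  have h3 := norm_nonneg ξ
  nlinarith

section

variable {χ : ℝ → ℝ} (hχ : IsSmoothCutoff χ)
include hχ

theorem IsSmoothCutoff.hasCompactSupport : HasCompactSupport χ :=
  HasCompactSupport.of_support_subset_isCompact isCompact_Icc hχ.support_subset

theorem IsSmoothCutoff.eq_zero_of_one_lt {x : ℝ} (hx : 1 < x) : χ x = 0 := by
  by_contra h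
  exact absurd (hχ.support_subset h).2 (not_le.2 hx)

theorem IsSmoothCutoff.exists_bound : ∃ C : ℝ, 1 ≤ C ∧ ∀ x, |χ x| ≤ C := by
  obtain ⟨C, hC⟩ := hχ.hasCompactSupport.exists_bound_of_continuous hχ.smooth.continuous
  exact ⟨max C 1, le_max_right _ _, fun x => (hC x).trans (le_max_left _ _)⟩

/-- The function `e^x χ(x)` as a Schwartz function. -/
theorem exists_schwartz_exp_mul : ∃ F : 𝓢(ℝ, ℂ), ∀ x, F x = Real.exp x * χ x := by
  have h1 : HasCompactSupport (fun x : ℝ => (Real.exp x * χ x : ℂ)) := by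
    have : HasCompactSupport (fun x : ℝ => (χ x : ℂ)) :=
      hχ.hasCompactSupport.comp_left (g := fun y : ℝ => (y : ℂ)) (by simp)
    exact this.mul_left
  have h2 : ContDiff ℝ ∞ (fun x : ℝ => (Real.exp x * χ x : ℂ)) := by
    have h := ofRealCLM.contDiff.comp (Real.contDiff_exp.mul hχ.smooth)
    have he : (fun x : ℝ => (Real.exp x * χ x : ℂ)) = ofRealCLM ∘ fun x => Real.exp x * χ x := by
      ext x; simp
    rw [he]; exact h
  exact ⟨h1.toSchwartzMap h2, fun x => rfl⟩

theorem exists_schwartz_density : ∃ G : 𝓢(ℝ, ℂ), ∀ x, G x = density χ x := by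
  obtain ⟨F, hF⟩ := exists_schwartz_exp_mul hχ
  refine ⟨𝓕 F, fun x => ?_⟩
  have : (fun x : ℝ => (Real.exp x * χ x : ℂ)) = F := by ext x; rw [hF]
  rw [density, this]; rfl

theorem continuous_density : Continuous (density χ) := by
  obtain ⟨G, hG⟩ := exists_schwartz_density hχ
  have : density χ = G := by ext x; rw [hG]
  rw [this]; exact G.continuous

/-- The density is a Schwartz function, being the Fourier transform of a smooth compactly supported
one, and `expo` grows linearly. These integrals dominate everything later. -/
theorem integrable_expo_pow_mul_density (k : ℕ) :
    Integrable (fun ξ => ‖expo ξ‖ ^ k * ‖density χ ξ‖) := by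
  obtain ⟨G, hG⟩ := exists_schwartz_density hχ
  have h0 := G.integrable_pow_mul volume 0
  have hk := G.integrable_pow_mul volume k
  refine ((h0.add hk).const_mul (14 ^ k)).mono'
    (((continuous_expo.norm.pow k).mul (continuous_density hχ).norm).aestronglyMeasurable)
    (Eventually.of_forall fun ξ => ?_)
  simp only [Pi.add_apply, hG, pow_zero, one_mul]
  rw [Real.norm_of_nonneg (by positivity), ← one_add_mul (‖ξ‖ ^ k), ← mul_assoc]
  refine mul_le_mul_of_nonneg_right ?_ (norm_nonneg _)
  have h1 : ‖expo ξ‖ ≤ 14 * max 1 ‖ξ‖ := by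
    refine (norm_expo_le ξ).trans ?_
    have := le_max_left 1 ‖ξ‖
    have := le_max_right 1 ‖ξ‖
    linarith
  calc ‖expo ξ‖ ^ k ≤ (14 * max 1 ‖ξ‖) ^ k := by gcongr
    _ = 14 ^ k * (max 1 ‖ξ‖) ^ k := mul_pow _ _ _
    _ ≤ 14 ^ k * (1 + ‖ξ‖ ^ k) := by
        gcongr
        rcases max_cases 1 ‖ξ‖ with h | h <;> rw [h.1]
        · have := pow_nonneg (norm_nonneg ξ) k
          simp
        · linarith

theorem integrable_density : Integrable (density χ) := by
  have := integrable_expo_pow_mul_density hχ 0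
  refine this.mono' (continuous_density hχ).aestronglyMeasurable
    (Eventually.of_forall fun ξ => by simp)

/-- Fourier inversion for `e^x χ(x)`, divided by `e^x`. The twist gives every exponent real part
`1`, which later keeps `1 + s/Λ` in the half-plane of absolute convergence of `ζ`. -/
theorem cutoff_eq_integral (x : ℝ) :
    (χ x : ℂ) = ∫ ξ, density χ ξ * cexp (-x * expo ξ) := by
  obtain ⟨F, hF⟩ := exists_schwartz_exp_mul hχ
  have hF' : (fun x : ℝ => (Real.exp x * χ x : ℂ)) = F := by ext x; rw [hF]
  have h1 : 𝓕⁻ (𝓕 (F : ℝ → ℂ)) x = F x := by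
    rw [F.continuous.fourierInv_fourier_eq F.integrable (𝓕 F).integrable]
  rw [Real.fourierInv_eq', hF, ← hF'] at h1
  have h2 : (χ x : ℂ) = cexp (-x) * (Real.exp x * χ x) := by
    rw [ofReal_exp, ← mul_assoc, ← Complex.exp_add]; simp
  rw [h2, ← h1, ← integral_const_mul]
  congr 1; ext ξ
  simp only [smul_eq_mul, density]
  rw [← mul_assoc, mul_comm, ← Complex.exp_add]
  congr 2
  simp [expo]; ring

/-- Differentiation under the integral sign; on the unit ball about `x` the exponential is at most
`e^(-x+1)`, and one power of `expo` is integrable against the density. -/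
theorem deriv_cutoff_eq_integral (x : ℝ) :
    ((deriv χ x : ℝ) : ℂ) = ∫ ξ, -(expo ξ * density χ ξ * cexp (-x * expo ξ)) := by
  have hint : ∀ y : ℝ, Integrable fun ξ => density χ ξ * cexp (-y * expo ξ) := by
    intro y
    refine ((integrable_density hχ).norm.const_mul (Real.exp (-y))).mono' ?_ ?_
    · exact ((continuous_density hχ).mul (by have := continuous_expo; fun_prop)).aestronglyMeasurable
    · exact Eventually.of_forall fun ξ => by simp [Complex.norm_exp, mul_comm]
  have h1 := (hasDerivAt_integral_of_dominated_loc_of_deriv_le (𝕜 := ℝ) (μ := volume)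
    (F := fun (y : ℝ) ξ => density χ ξ * cexp (-y * expo ξ))
    (F' := fun (y : ℝ) ξ => -(expo ξ * density χ ξ * cexp (-y * expo ξ)))
    (x₀ := x) (bound := fun ξ => Real.exp (-x + 1) * (‖expo ξ‖ ^ 1 * ‖density χ ξ‖))
    (s := Metric.ball x 1) (Metric.ball_mem_nhds x one_pos)
    (Eventually.of_forall fun y => (hint y).aestronglyMeasurable) (hint x) ?_ ?_
    ((integrable_expo_pow_mul_density hχ 1).const_mul _) ?_).2
  · have h2 : HasDerivAt (fun y : ℝ => (χ y : ℂ)) ((deriv χ x : ℝ) : ℂ) x :=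
      ((hχ.smooth.differentiable (by simp)) x).hasDerivAt.ofReal_comp
    have h3 : (fun y : ℝ => (χ y : ℂ)) = fun y : ℝ => ∫ ξ, density χ ξ * cexp (-y * expo ξ) := by
      ext y; exact cutoff_eq_integral hχ y
    rw [h3] at h2
    exact h2.unique h1
  · exact ((continuous_expo.mul (continuous_density hχ)).mul
      (by have := continuous_expo; fun_prop)).neg.aestronglyMeasurable
  · refine Eventually.of_forall fun ξ y hy => ?_
    have hy' : x - 1 < y := by
      have := (abs_lt.1 (Real.dist_eq y x ▸ Metric.mem_ball.1 hy)).1; linarith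
    rw [norm_neg, norm_mul, norm_mul, Complex.norm_exp, mul_comm, pow_one]
    gcongr
    simp; linarith
  · refine Eventually.of_forall fun ξ y _ => ?_
    have h4 : HasDerivAt (fun y : ℝ => (-y * expo ξ : ℂ)) (-1 * expo ξ) y :=
      (ofRealCLM.hasDerivAt (x := y)).neg.mul_const _
    have := (h4.cexp).const_mul (density χ ξ)
    refine this.congr_deriv ?_
    ring

end

end PrimeWeight

/-! ### The singular integral and the normalisation of the cutoff. -/

namespace PrimeWeight

open MeasureTheory Filter Topology Complex FourierTransform
open scoped Real SchwartzMap

theorem expo_add_expo_ne_zero (ξ η : ℝ) : expo ξ + expo η ≠ 0 := by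
  intro h
  have := congrArg Complex.re h
  norm_num at this

theorem integrable_prod_density {χ : ℝ → ℝ} (hχ : IsSmoothCutoff χ) (k l : ℕ) :
    Integrable (fun q : ℝ × ℝ => (‖expo q.1‖ ^ k * ‖density χ q.1‖) *
      (‖expo q.2‖ ^ l * ‖density χ q.2‖)) :=
  (integrable_expo_pow_mul_density hχ k).mul_prod (integrable_expo_pow_mul_density hχ l)

/-- Write `1/(s+s') = ∫₀^∞ e^{-x(s+s')} dx` and apply Fubini: the inner double integral is `χ'(x)²`,
so the value is `∫₀^∞ χ'²`. This is where the normalisation of `χ` enters. -/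
theorem integral_density_kernel {χ : ℝ → ℝ} (hχ : IsSmoothCutoff χ) :
    ∫ q : ℝ × ℝ, density χ q.1 * density χ q.2 * (expo q.1 * expo q.2 / (expo q.1 + expo q.2))
      = 1 := by
  have hc := continuous_expo
  have hd := continuous_density hχ
  let H : ℝ → ℝ × ℝ → ℂ := fun x q => expo q.1 * density χ q.1 * cexp (-x * expo q.1) *
    (expo q.2 * density χ q.2 * cexp (-x * expo q.2))
  have hHc : Continuous (Function.uncurry H) := by
    simp only [H]
    fun_prop
  have hexp : IntegrableOn (fun x : ℝ => Real.exp (-2 * x)) (Set.Ioi 0) :=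
    integrableOn_exp_mul_Ioi (by norm_num) 0
  have hHint : Integrable (Function.uncurry H)
      ((volume.restrict (Set.Ioi (0 : ℝ))).prod (volume : Measure (ℝ × ℝ))) := by
    refine (hexp.mul_prod (integrable_prod_density hχ 1 1)).mono' hHc.aestronglyMeasurable
      (Eventually.of_forall fun z => le_of_eq ?_)
    simp only [Function.uncurry, H, norm_mul, Complex.norm_exp, pow_one]
    have : Real.exp (-2 * z.1) = Real.exp (-z.1) * Real.exp (-z.1) := by
      rw [← Real.exp_add]; ring_nf
    rw [this]
    simp
    ring
  have hswap := integral_integral_swap hHint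
  have h1 : ∀ x : ℝ, ∫ q, H x q = ((deriv χ x ^ 2 : ℝ) : ℂ) := by
    intro x
    have := integral_prod_mul (μ := (volume : Measure ℝ)) (ν := (volume : Measure ℝ))
      (fun ξ => expo ξ * density χ ξ * cexp (-x * expo ξ))
      (fun ξ => expo ξ * density χ ξ * cexp (-x * expo ξ))
    have h2 := deriv_cutoff_eq_integral hχ x
    rw [integral_neg] at h2
    rw [ofReal_pow, h2, neg_sq, sq]
    exact this
  have h2 : ∀ q : ℝ × ℝ, ∫ x in Set.Ioi (0 : ℝ), H x q =
      density χ q.1 * density χ q.2 * (expo q.1 * expo q.2 / (expo q.1 + expo q.2)) := by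
    intro q
    have ha : (-(expo q.1 + expo q.2)).re < 0 := by simp
    have h3 := integral_exp_mul_complex_Ioi ha 0
    have h4 : ∀ x : ℝ, H x q = (expo q.1 * density χ q.1 * (expo q.2 * density χ q.2)) *
        cexp (-(expo q.1 + expo q.2) * x) := by
      intro x
      have : cexp (-(expo q.1 + expo q.2) * x) =
          cexp (-x * expo q.1) * cexp (-x * expo q.2) := by
        rw [← Complex.exp_add]; ring_nf
      simp only [H, this]; ring
    simp_rw [h4]
    rw [integral_const_mul, h3]
    have := expo_add_expo_ne_zero q.1 q.2
    rw [neg_div_neg_eq]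
    simp
    field_simp
  simp_rw [h1, h2] at hswap
  rw [← hswap, integral_complex_ofReal, hχ.integral_deriv_sq]
  simp

end PrimeWeight

namespace PrimeWeight

open MeasureTheory Filter Topology Complex
open scoped Real

/-! ### Euler products over the primes in an interval -/

/-- The primes `p` with `w < p < Y`. -/
def sievePrimes (w Y : ℕ) : Finset ℕ := (Nat.primesBelow Y).filter (w < ·)

theorem mem_sievePrimes {w Y p : ℕ} : p ∈ sievePrimes w Y ↔ p.Prime ∧ w < p ∧ p < Y := by
  simp only [sievePrimes, Finset.mem_filter, Nat.mem_primesBelow]; tauto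

/-- The finite Euler product `∏_{w < p < Y} (1 - p^{-1-z})`. -/
noncomputable def eulerProd (w Y : ℕ) (z : ℂ) : ℂ :=
  ∏ p ∈ sievePrimes w Y, (1 - (p : ℂ) ^ (-(1 + z)))

/-- The finite Euler product `∏_{p ≤ w} (1 - p^{-1-z})`. -/
noncomputable def smallEulerProd (w : ℕ) (z : ℂ) : ℂ :=
  ∏ p ∈ Nat.primesBelow (w + 1), (1 - (p : ℂ) ^ (-(1 + z)))

theorem norm_prime_cpow {p : ℕ} (hp : p.Prime) (z : ℂ) :
    ‖(p : ℂ) ^ (-(1 + z))‖ = (p : ℝ) ^ (-(1 + z.re)) := by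
  rw [Complex.norm_natCast_cpow_of_pos hp.pos]; simp

theorem norm_prime_cpow_le {p : ℕ} (hp : p.Prime) {z : ℂ} (hz : 0 ≤ z.re) :
    ‖(p : ℂ) ^ (-(1 + z))‖ ≤ 1 / 2 := by
  rw [norm_prime_cpow hp]
  have hp2 : (2 : ℝ) ≤ p := by exact_mod_cast hp.two_le
  calc (p : ℝ) ^ (-(1 + z.re)) ≤ (p : ℝ) ^ (-1 : ℝ) :=
        Real.rpow_le_rpow_of_exponent_le (by linarith) (by linarith)
    _ = (p : ℝ)⁻¹ := Real.rpow_neg_one _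
    _ ≤ 1 / 2 := by rw [one_div]; exact inv_anti₀ (by norm_num) hp2

theorem half_le_norm_one_sub {u : ℂ} (hu : ‖u‖ ≤ 1 / 2) : 1 / 2 ≤ ‖1 - u‖ := by
  have := norm_sub_norm_le (1 : ℂ) u
  rw [norm_one] at this
  linarith

theorem norm_one_sub_le_two {u : ℂ} (hu : ‖u‖ ≤ 1 / 2) : ‖1 - u‖ ≤ 2 := by
  have := norm_sub_le (1 : ℂ) u
  rw [norm_one] at this
  linarith

theorem one_sub_prime_cpow_ne_zero {p : ℕ} (hp : p.Prime) {z : ℂ} (hz : 0 ≤ z.re) :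
    1 - (p : ℂ) ^ (-(1 + z)) ≠ 0 := by
  have := half_le_norm_one_sub (norm_prime_cpow_le hp hz)
  intro h
  rw [h, norm_zero] at this
  norm_num at this

theorem eulerProd_ne_zero (w Y : ℕ) {z : ℂ} (hz : 0 ≤ z.re) : eulerProd w Y z ≠ 0 :=
  Finset.prod_ne_zero_iff.2 fun _ hp => one_sub_prime_cpow_ne_zero (mem_sievePrimes.1 hp).1 hz

theorem smallEulerProd_ne_zero (w : ℕ) {z : ℂ} (hz : 0 ≤ z.re) : smallEulerProd w z ≠ 0 :=
  Finset.prod_ne_zero_iff.2 fun _ hp =>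
    one_sub_prime_cpow_ne_zero (Nat.prime_of_mem_primesBelow hp) hz

theorem smallEulerProd_mul_eulerProd {w Y : ℕ} (h : w < Y) (z : ℂ) :
    smallEulerProd w z * eulerProd w Y z =
      ∏ p ∈ Nat.primesBelow Y, (1 - (p : ℂ) ^ (-(1 + z))) := by
  rw [← Finset.prod_filter_mul_prod_filter_not (Nat.primesBelow Y) (w < ·), mul_comm]
  congr 1
  refine Finset.prod_congr ?_ fun _ _ => rfl
  ext p
  simp only [Finset.mem_filter, Nat.mem_primesBelow]
  constructor
  · rintro ⟨h1, h2⟩; exact ⟨⟨by omega, h2⟩, by omega⟩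
  · rintro ⟨⟨h1, h2⟩, h3⟩; exact ⟨by omega, h2⟩

theorem tendsto_eulerProd (w : ℕ) {z : ℂ} (hz : 0 < z.re) :
    Tendsto (fun Y => eulerProd w Y z) atTop
      (𝓝 ((riemannZeta (1 + z))⁻¹ * (smallEulerProd w z)⁻¹)) := by
  have hz1 : 1 < (1 + z).re := by simpa using hz
  have h := ((riemannZeta_eulerProduct hz1).inv₀ (riemannZeta_ne_zero_of_one_lt_re hz1)).mul_const
    (smallEulerProd w z)⁻¹
  refine h.congr' ?_
  filter_upwards [eventually_gt_atTop w] with Y hY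
  rw [Finset.prod_inv_distrib, inv_inv, ← smallEulerProd_mul_eulerProd hY]
  have := smallEulerProd_ne_zero w hz.le
  field_simp

/-- At a real point all Euler factors are at least `1`, so the partial products increase to `ζ`. -/
theorem prod_primesBelow_le_zeta {σ : ℝ} (hσ : 0 < σ) (Y : ℕ) :
    ∏ p ∈ Nat.primesBelow Y, (1 - (p : ℝ) ^ (-(1 + σ)))⁻¹ ≤ ‖riemannZeta (1 + σ)‖ := by
  have h1 : 1 < ((1 + σ : ℂ)).re := by simpa using hσ
  have h2 := (riemannZeta_eulerProduct h1).norm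
  have hfac : ∀ p : ℕ, p.Prime →
      (0 : ℝ) < 1 - (p : ℝ) ^ (-(1 + σ)) ∧ 1 ≤ (1 - (p : ℝ) ^ (-(1 + σ)))⁻¹ := by
    intro p hp
    have h3 : (p : ℝ) ^ (-(1 + σ)) ≤ 1 / 2 := by
      have := norm_prime_cpow_le hp (z := σ) (by simpa using hσ.le)
      rwa [norm_prime_cpow hp] at this
    have h4 : 0 ≤ (p : ℝ) ^ (-(1 + σ)) := Real.rpow_nonneg (Nat.cast_nonneg p) _
    exact ⟨by linarith, (one_le_inv₀ (by linarith)).2 (by linarith)⟩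
  have h5 : ∀ n : ℕ, ‖∏ p ∈ Nat.primesBelow n, (1 - (p : ℂ) ^ (-(1 + σ : ℂ)))⁻¹‖ =
      ∏ p ∈ Nat.primesBelow n, (1 - (p : ℝ) ^ (-(1 + σ)))⁻¹ := by
    intro n
    rw [norm_prod]
    refine Finset.prod_congr rfl fun p hp => ?_
    have hp' := hfac p (Nat.prime_of_mem_primesBelow hp)
    have : (1 - (p : ℂ) ^ (-(1 + σ : ℂ)))⁻¹ = (((1 - (p : ℝ) ^ (-(1 + σ)))⁻¹ : ℝ) : ℂ) := by
      push_cast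
      rw [ofReal_cpow (Nat.cast_nonneg p)]
      push_cast; rfl
    rw [this, norm_real, Real.norm_of_nonneg (by linarith)]
  simp_rw [h5] at h2
  refine Monotone.ge_of_tendsto (fun m n hmn => ?_) h2 Y
  refine Finset.prod_le_prod_of_subset_of_one_le (Nat.primesBelow_mono hmn) ?_ ?_
  · intro p hp; linarith [(hfac p (Nat.prime_of_mem_primesBelow hp)).2]
  · intro p hp _; exact (hfac p (Nat.prime_of_mem_primesBelow hp)).2

/-- Both `|1 - u|` and `|1 - u|⁻¹` are at most `(1 - |u|)⁻¹`, which reduces to the real point `Re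
z`. The bound does not depend on `w`, `Y` or `Im z`. -/
theorem norm_eulerProd_le (w Y : ℕ) {z : ℂ} (hz : 0 < z.re) :
    ‖eulerProd w Y z‖ ≤ ‖riemannZeta (1 + z.re)‖ ∧
      ‖(eulerProd w Y z)⁻¹‖ ≤ ‖riemannZeta (1 + z.re)‖ := by
  have key : ∀ p : ℕ, p.Prime → 1 ≤ (1 - (p : ℝ) ^ (-(1 + z.re)))⁻¹ ∧
      ‖1 - (p : ℂ) ^ (-(1 + z))‖ ≤ (1 - (p : ℝ) ^ (-(1 + z.re)))⁻¹ ∧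
      ‖(1 - (p : ℂ) ^ (-(1 + z)))⁻¹‖ ≤ (1 - (p : ℝ) ^ (-(1 + z.re)))⁻¹ := by
    intro p hp
    have h1 := norm_prime_cpow_le hp hz.le
    have h2 := norm_sub_norm_le (1 : ℂ) ((p : ℂ) ^ (-(1 + z)))
    have h3 := norm_sub_le (1 : ℂ) ((p : ℂ) ^ (-(1 + z)))
    have h4 := norm_nonneg ((p : ℂ) ^ (-(1 + z)))
    rw [norm_one] at h2 h3
    rw [← norm_prime_cpow hp]
    set y := ‖(p : ℂ) ^ (-(1 + z))‖
    have hy : 0 < 1 - y := by linarith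
    refine ⟨(one_le_inv₀ hy).2 (by linarith), h3.trans ?_, ?_⟩
    · rw [← one_div, le_div_iff₀ hy]; nlinarith
    · rw [norm_inv]; exact inv_anti₀ hy h2
  have hsub : sievePrimes w Y ⊆ Nat.primesBelow Y := Finset.filter_subset _ _
  have hle : ∏ p ∈ sievePrimes w Y, (1 - (p : ℝ) ^ (-(1 + z.re)))⁻¹ ≤
      ‖riemannZeta (1 + z.re)‖ := by
    refine le_trans ?_ (prod_primesBelow_le_zeta hz Y)
    refine Finset.prod_le_prod_of_subset_of_one_le hsub ?_ ?_
    · intro p hp; linarith [(key p (mem_sievePrimes.1 hp).1).1]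
    · intro p hp _; exact (key p (Nat.prime_of_mem_primesBelow hp)).1
  constructor
  · refine le_trans ?_ hle
    rw [eulerProd, norm_prod]
    exact Finset.prod_le_prod (fun _ _ => norm_nonneg _)
      fun p hp => (key p (mem_sievePrimes.1 hp).1).2.1
  · refine le_trans ?_ hle
    rw [eulerProd, ← Finset.prod_inv_distrib, norm_prod]
    exact Finset.prod_le_prod (fun _ _ => norm_nonneg _)
      fun p hp => (key p (mem_sievePrimes.1 hp).1).2.2

end PrimeWeight

/-! ### Bounds for zeta near its pole and for the product over small primes. -/

namespace PrimeWeight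

open MeasureTheory Filter Topology Complex
open scoped Real

theorem tendsto_mul_zeta_one_add :
    Tendsto (fun z : ℂ => z * riemannZeta (1 + z)) (𝓝[≠] 0) (𝓝 1) := by
  have h : Tendsto (fun z : ℂ => 1 + z) (𝓝[≠] 0) (𝓝[≠] 1) := by
    refine tendsto_nhdsWithin_iff.2 ⟨?_, ?_⟩
    · have : Tendsto (fun z : ℂ => 1 + z) (𝓝 0) (𝓝 (1 + 0)) :=
        (continuous_const.add continuous_id).tendsto 0
      rw [add_zero] at this
      exact this.mono_left nhdsWithin_le_nhds
    · filter_upwards [self_mem_nhdsWithin] with z hz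
      simpa using hz
  have := riemannZeta_residue_one.comp h
  refine this.congr fun z => ?_
  simp

/-- The residue of `ζ` at `1` is `1`, so `|z ζ(1+z)|` is near `1` for small `z ≠ 0`. -/
theorem exists_zeta_bounds : ∃ r : ℝ, 0 < r ∧ ∀ z : ℂ, z ≠ 0 → ‖z‖ ≤ r →
    ‖z‖ * ‖riemannZeta (1 + z)‖ ≤ 2 ∧ 1 / 2 ≤ ‖z‖ * ‖riemannZeta (1 + z)‖ := by
  have h1 := tendsto_mul_zeta_one_add.norm
  rw [norm_one] at h1
  have h2 := (h1.eventually (ge_mem_nhds (by norm_num : (1 : ℝ) < 2))).and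
    (h1.eventually (le_mem_nhds (by norm_num : (1 / 2 : ℝ) < 1)))
  rw [eventually_nhdsWithin_iff, Metric.eventually_nhds_iff] at h2
  obtain ⟨ε, hε, h3⟩ := h2
  refine ⟨ε / 2, by positivity, fun z hz hzr => ?_⟩
  have := h3 (y := z) (by rw [dist_zero_right]; linarith) hz
  simpa only [norm_mul] using this

/-- Uniform control of `1/ζ` along `1 + s/Λ` with `Re s = 1`. -/
theorem exists_inv_zeta_bound : ∃ C : ℝ, 0 < C ∧ ∃ Λ₀ : ℝ, 1 ≤ Λ₀ ∧ ∀ Λ : ℝ, Λ₀ ≤ Λ →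
    (∀ ξ, ‖(riemannZeta (1 + expo ξ / Λ))⁻¹‖ ≤ C * ‖expo ξ‖ ^ 2 / Λ) ∧
    ‖riemannZeta (1 + (2 / Λ : ℝ))‖ ≤ Λ := by
  obtain ⟨r, hr, h⟩ := exists_zeta_bounds
  refine ⟨2 + 2 / r ^ 2, by positivity, max 1 (2 / r), le_max_left _ _, fun Λ hΛ => ?_⟩
  have hΛ1 : 1 ≤ Λ := (le_max_left _ _).trans hΛ
  have hΛ0 : 0 < Λ := by linarith
  have hΛr : 2 / Λ ≤ r := by
    rw [div_le_comm₀ hΛ0 hr]; exact (le_max_right _ _).trans hΛ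
  have hreal : ∀ c : ℝ, 0 < c → c ≤ 2 → ‖riemannZeta (1 + (c / Λ : ℝ))‖ ≤ 2 * Λ / c := by
    intro c hc hc2
    have hcL : 0 < c / Λ := by positivity
    have h1 := (h ((c / Λ : ℝ) : ℂ) (by exact_mod_cast hcL.ne') (by
      rw [norm_real, Real.norm_of_nonneg hcL.le]
      exact (div_le_div_of_nonneg_right hc2 hΛ0.le).trans hΛr)).1
    rw [norm_real, Real.norm_of_nonneg hcL.le] at h1
    rw [le_div_iff₀ hc]
    have : c / Λ * ‖riemannZeta (1 + ((c / Λ : ℝ) : ℂ))‖ * Λ ≤ 2 * Λ := by gcongr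
    calc _ = c / Λ * ‖riemannZeta (1 + ((c / Λ : ℝ) : ℂ))‖ * Λ := by field_simp
      _ ≤ _ := this
  constructor
  · intro ξ
    set z : ℂ := expo ξ / Λ with hz
    have hzn : ‖z‖ = ‖expo ξ‖ / Λ := by
      rw [hz, norm_div, norm_real, Real.norm_of_nonneg hΛ0.le]
    have hz0 : z ≠ 0 := div_ne_zero (expo_ne_zero ξ) (by exact_mod_cast hΛ0.ne')
    have h1 := one_le_norm_expo ξ
    rw [norm_inv]
    by_cases hzr : ‖z‖ ≤ r
    · have h2 := (h z hz0 hzr).2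
      have h3 : 0 < ‖riemannZeta (1 + z)‖ := by
        by_contra h0
        have : ‖riemannZeta (1 + z)‖ = 0 := le_antisymm (not_lt.1 h0) (norm_nonneg _)
        rw [this] at h2; norm_num at h2
      calc ‖riemannZeta (1 + z)‖⁻¹ ≤ 2 * ‖z‖ := by
            rw [inv_le_iff_one_le_mul₀ h3]; linarith
        _ = 2 * ‖expo ξ‖ / Λ := by rw [hzn]; ring
        _ ≤ (2 + 2 / r ^ 2) * ‖expo ξ‖ ^ 2 / Λ := by
            gcongr
            · have : 0 ≤ 2 / r ^ 2 := by positivity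
              linarith
            · nlinarith
    -- Away from the pole only `|1/ζ(1+z)| ≤ ζ(1 + 1/Λ) ≤ 2Λ` is available. Here `‖expo ξ‖ > rΛ`, so
    -- `Λ ≤ ‖expo ξ‖² / (r²Λ)`; this explains both the square in the bound and the term `2 / r ^ 2`
    -- in the constant.
    · have hre : z.re = 1 / Λ := by
        rw [hz, div_ofReal_re, expo_re]
      have hrepos : 0 < z.re := by rw [hre]; positivity
      have h4 : ‖(riemannZeta (1 + z))⁻¹‖ ≤ ‖riemannZeta (1 + z.re)‖ := by
        have h5 := (tendsto_eulerProd 0 hrepos).norm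
        have h6 : smallEulerProd 0 z = 1 := by simp [smallEulerProd]
        rw [h6, inv_one, mul_one] at h5
        exact le_of_tendsto' h5 fun Y => (norm_eulerProd_le 0 Y hrepos).1
      rw [norm_inv] at h4
      have h7 := hreal 1 one_pos (by norm_num)
      rw [hre] at h4
      refine (h4.trans h7).trans ?_
      have h8 : r < ‖expo ξ‖ / Λ := by rw [← hzn]; exact not_le.1 hzr
      rw [lt_div_iff₀ hΛ0] at h8
      have h9 : (r * Λ) ^ 2 ≤ ‖expo ξ‖ ^ 2 := by gcongr
      calc 2 * Λ / 1 = 2 / r ^ 2 * (r * Λ) ^ 2 / Λ := by field_simp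
        _ ≤ 2 / r ^ 2 * ‖expo ξ‖ ^ 2 / Λ := by gcongr
        _ ≤ _ := by gcongr; linarith
  · have := hreal 2 two_pos le_rfl
    calc _ ≤ _ := this
      _ = Λ := by ring

theorem smallEulerProd_zero (w : ℕ) :
    smallEulerProd w 0 = ((Nat.totient (primorial w) : ℝ) / primorial w : ℝ) := by
  have h := Nat.totient_eq_mul_prod_factors (primorial w)
  rw [primeFactors_primorial] at h
  have h2 : ((Nat.totient (primorial w) : ℚ) : ℂ) =
      ((primorial w * ∏ p ∈ Nat.primesLE w, (1 - (p : ℚ)⁻¹) : ℚ) : ℂ) := by rw [h]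
  push_cast at h2
  push_cast
  rw [h2]
  have h3 : (primorial w : ℂ) ≠ 0 := by exact_mod_cast primorial_ne_zero w
  rw [mul_div_cancel_left₀ _ h3, smallEulerProd]
  refine Finset.prod_congr rfl fun p _ => ?_
  rw [add_zero, cpow_neg_one]

/-- Each of the at most `w + 1` factors has norm between `1/2` and `2`. The exponential loss in `w`
is harmless, as it only serves for dominated convergence at fixed `w`. -/
theorem norm_smallEulerProd_le (w : ℕ) {z : ℂ} (hz : 0 ≤ z.re) :
    ‖smallEulerProd w z‖ ≤ 2 ^ (w + 1) ∧ ‖(smallEulerProd w z)⁻¹‖ ≤ 2 ^ (w + 1) := by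
  have hcard : (Nat.primesBelow (w + 1)).card ≤ w + 1 :=
    (Finset.card_filter_le _ _).trans (by simp)
  have h : ∀ p ∈ Nat.primesBelow (w + 1), ‖(p : ℂ) ^ (-(1 + z))‖ ≤ 1 / 2 :=
    fun p hp => norm_prime_cpow_le (Nat.prime_of_mem_primesBelow hp) hz
  have hpow : (2 : ℝ) ^ (Nat.primesBelow (w + 1)).card ≤ 2 ^ (w + 1) :=
    pow_le_pow_right₀ (by norm_num) hcard
  constructor
  · refine le_trans ?_ hpow
    rw [smallEulerProd, norm_prod]
    exact (Finset.prod_le_prod (fun _ _ => norm_nonneg _)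
      fun p hp => norm_one_sub_le_two (h p hp)).trans_eq (by rw [Finset.prod_const])
  · refine le_trans ?_ hpow
    rw [smallEulerProd, ← Finset.prod_inv_distrib, norm_prod]
    refine (Finset.prod_le_prod (g := fun _ => (2 : ℝ)) (fun _ _ => norm_nonneg _)
      fun p hp => ?_).trans_eq (by rw [Finset.prod_const])
    rw [norm_inv, inv_le_comm₀ (by linarith [half_le_norm_one_sub (h p hp)]) (by norm_num)]
    linarith [half_le_norm_one_sub (h p hp)]

end PrimeWeight

/-! ### The normalised Euler product of one form and its two limits. -/

namespace PrimeWeight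

open MeasureTheory Filter Topology Complex
open scoped Real

/-- The density `φ(W)/W` for `W = ∏_{p ≤ w} p`. -/
noncomputable def totDensity (w : ℕ) : ℝ := (Nat.totient (primorial w) : ℝ) / primorial w

theorem totDensity_pos (w : ℕ) : 0 < totDensity w :=
  div_pos (by exact_mod_cast Nat.totient_pos.2 (primorial_pos w))
    (by exact_mod_cast primorial_pos w)

theorem totDensity_le_one (w : ℕ) : totDensity w ≤ 1 :=
  div_le_one_of_le₀ (by exact_mod_cast Nat.totient_le _) (Nat.cast_nonneg _)

/-- The normalised Euler product attached to a pair of exponents. -/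
noncomputable def kernel (w Y : ℕ) (Λ : ℝ) (q : ℝ × ℝ) : ℂ :=
  (totDensity w * Λ : ℝ) * (eulerProd w Y (expo q.1 / Λ) * eulerProd w Y (expo q.2 / Λ) *
    (eulerProd w Y ((expo q.1 + expo q.2) / Λ))⁻¹)

/-- The limit of `kernel w Y Λ` as `Y → ∞`. -/
noncomputable def limitKernel (w : ℕ) (Λ : ℝ) (q : ℝ × ℝ) : ℂ :=
  (totDensity w * Λ : ℝ) * (((riemannZeta (1 + expo q.1 / Λ))⁻¹ *
      (smallEulerProd w (expo q.1 / Λ))⁻¹) *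
    ((riemannZeta (1 + expo q.2 / Λ))⁻¹ * (smallEulerProd w (expo q.2 / Λ))⁻¹) *
    ((riemannZeta (1 + (expo q.1 + expo q.2) / Λ))⁻¹ *
      (smallEulerProd w ((expo q.1 + expo q.2) / Λ))⁻¹)⁻¹)

theorem re_expo_div (Λ ξ : ℝ) : (expo ξ / Λ).re = 1 / Λ := by rw [div_ofReal_re, expo_re]

theorem re_expo_add_div (Λ ξ η : ℝ) : ((expo ξ + expo η) / Λ).re = 2 / Λ := by
  rw [div_ofReal_re, add_re, expo_re, expo_re]; norm_num

theorem continuous_kernel (w Y : ℕ) {Λ : ℝ} (hΛ : 0 < Λ) : Continuous (kernel w Y Λ) := by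
  have hE : Continuous (eulerProd w Y) := by
    unfold eulerProd
    refine continuous_finsetProd _ fun p hp => continuous_const.sub ?_
    have : (p : ℂ) ≠ 0 := by exact_mod_cast (mem_sievePrimes.1 hp).1.ne_zero
    exact Continuous.const_cpow (by fun_prop) (Or.inl this)
  have he := continuous_expo
  unfold kernel
  refine continuous_const.mul (((hE.comp (by fun_prop)).mul (hE.comp (by fun_prop))).mul
    (Continuous.inv₀ (hE.comp (by fun_prop)) fun q => ?_))
  exact eulerProd_ne_zero _ _ (by rw [re_expo_add_div]; positivity)

theorem exists_norm_kernel_le (w : ℕ) {Λ : ℝ} (hΛ : 0 < Λ) :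
    ∃ C : ℝ, ∀ Y q, ‖kernel w Y Λ q‖ ≤ C := by
  refine ⟨totDensity w * Λ * (‖riemannZeta (1 + (1 / Λ : ℝ))‖ * ‖riemannZeta (1 + (1 / Λ : ℝ))‖ *
    ‖riemannZeta (1 + (2 / Λ : ℝ))‖), fun Y q => ?_⟩
  have h1 : ∀ ξ, ‖eulerProd w Y (expo ξ / Λ)‖ ≤ ‖riemannZeta (1 + (1 / Λ : ℝ))‖ := by
    intro ξ
    have := (norm_eulerProd_le w Y (z := expo ξ / Λ) (by rw [re_expo_div]; positivity)).1
    rwa [re_expo_div] at this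
  have h2 := (norm_eulerProd_le w Y (z := (expo q.1 + expo q.2) / Λ)
    (by rw [re_expo_add_div]; positivity)).2
  rw [re_expo_add_div] at h2
  have h0 : 0 ≤ totDensity w * Λ := mul_nonneg (totDensity_pos w).le hΛ.le
  rw [kernel, norm_mul, norm_mul, norm_mul, norm_real, Real.norm_of_nonneg h0]
  gcongr
  · exact h1 _
  · exact h1 _

theorem tendsto_kernel (w : ℕ) {Λ : ℝ} (hΛ : 0 < Λ) (q : ℝ × ℝ) :
    Tendsto (fun Y => kernel w Y Λ q) atTop (𝓝 (limitKernel w Λ q)) := by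
  have h1 : ∀ ξ, 0 < (expo ξ / Λ).re := fun ξ => by rw [re_expo_div]; positivity
  have h2 : 0 < ((expo q.1 + expo q.2) / Λ).re := by rw [re_expo_add_div]; positivity
  refine (((tendsto_eulerProd w (h1 _)).mul (tendsto_eulerProd w (h1 _))).mul
    ((tendsto_eulerProd w h2).inv₀ ?_)).const_mul _
  exact mul_ne_zero (inv_ne_zero (riemannZeta_ne_zero_of_one_lt_re (by simpa using h2)))
    (inv_ne_zero (smallEulerProd_ne_zero w h2.le))

/-- The simple pole contributes `s/Λ`, `t/Λ` and `Λ/(s+t)`, so the factor `Λ` balances. The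
small-prime products leave `1/totDensity w`, which the other normalising factor cancels. -/
theorem tendsto_limitKernel (w : ℕ) (q : ℝ × ℝ) :
    Tendsto (fun Λ => limitKernel w Λ q) atTop
      (𝓝 (expo q.1 * expo q.2 / (expo q.1 + expo q.2))) := by
  have hto : ∀ s : ℂ, Tendsto (fun Λ : ℝ => s / Λ) atTop (𝓝 0) := by
    intro s
    have h1 : Tendsto (fun Λ : ℝ => ((Λ⁻¹ : ℝ) : ℂ)) atTop (𝓝 ((0 : ℝ) : ℂ)) :=
      (continuous_ofReal.tendsto 0).comp tendsto_inv_atTop_zero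
    have h2 := h1.const_mul s
    rw [ofReal_zero, mul_zero] at h2
    refine h2.congr fun Λ => ?_
    rw [ofReal_inv, div_eq_mul_inv]
  have htz : ∀ s : ℂ, s ≠ 0 →
      Tendsto (fun Λ : ℝ => s / Λ * riemannZeta (1 + s / Λ)) atTop (𝓝 1) := by
    intro s hs
    refine tendsto_mul_zeta_one_add.comp (tendsto_nhdsWithin_iff.2 ⟨hto s, ?_⟩)
    filter_upwards [eventually_gt_atTop 0] with Λ hΛ
    exact div_ne_zero hs (by exact_mod_cast hΛ.ne')
  have hB : ∀ s : ℂ, Tendsto (fun Λ : ℝ => smallEulerProd w (s / Λ)) atTop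
      (𝓝 (totDensity w : ℂ)) := by
    intro s
    have hc : ContinuousAt (smallEulerProd w) 0 := by
      unfold smallEulerProd
      refine Continuous.continuousAt (continuous_finsetProd _ fun p hp => continuous_const.sub ?_)
      have : (p : ℂ) ≠ 0 := by exact_mod_cast (Nat.prime_of_mem_primesBelow hp).ne_zero
      exact Continuous.const_cpow (by fun_prop) (Or.inl this)
    have := hc.tendsto
    rw [smallEulerProd_zero] at this
    exact this.comp (hto s)
  have hD : (totDensity w : ℂ) ≠ 0 := by exact_mod_cast (totDensity_pos w).ne'
  set s := expo q.1
  set t := expo q.2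
  have hs : s ≠ 0 := expo_ne_zero _
  have ht : t ≠ 0 := expo_ne_zero _
  have hst : s + t ≠ 0 := expo_add_expo_ne_zero _ _
  have hmain := ((((htz s hs).inv₀ one_ne_zero).mul ((htz t ht).inv₀ one_ne_zero)).mul
    (htz (s + t) hst)).mul ((((hB s).inv₀ hD).mul ((hB t).inv₀ hD)).mul (hB (s + t)))
  have hmain2 := (hmain.const_mul (totDensity w : ℂ)).mul_const (s * t / (s + t))
  have hlim : (totDensity w : ℂ) * ((1 : ℂ)⁻¹ * 1⁻¹ * 1 *
      ((totDensity w : ℂ)⁻¹ * (totDensity w : ℂ)⁻¹ * totDensity w)) * (s * t / (s + t)) =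
      s * t / (s + t) := by field_simp
  rw [hlim] at hmain2
  refine hmain2.congr' ?_
  filter_upwards [eventually_gt_atTop 0] with Λ hΛ
  have hΛ' : (Λ : ℂ) ≠ 0 := by exact_mod_cast hΛ.ne'
  simp only [limitKernel, mul_inv, inv_inv]
  push_cast
  change _ = (totDensity w : ℂ) * Λ * ((riemannZeta (1 + s / Λ))⁻¹ * _ *
    ((riemannZeta (1 + t / Λ))⁻¹ * _) * (riemannZeta (1 + (s + t) / Λ) * _))
  generalize (riemannZeta (1 + s / Λ))⁻¹ = Z1
  generalize (riemannZeta (1 + t / Λ))⁻¹ = Z2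
  generalize (riemannZeta (1 + (s + t) / Λ)) = Z3
  generalize (smallEulerProd w (s / Λ))⁻¹ = B1
  generalize (smallEulerProd w (t / Λ))⁻¹ = B2
  generalize (smallEulerProd w ((s + t) / Λ)) = B3
  field_simp

/-- Two inverse zeta values give `Λ⁻²` with quadratic growth in the exponents, and the remaining
zeta value gives `Λ`; this balances the prefactor and provides a dominating function for `Λ → ∞`. -/
theorem exists_limitKernel_bound (w : ℕ) : ∃ C : ℝ, ∀ᶠ Λ : ℝ in atTop, ∀ q : ℝ × ℝ,
    ‖limitKernel w Λ q‖ ≤ C * (‖expo q.1‖ ^ 2 * ‖expo q.2‖ ^ 2) := by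
  obtain ⟨C, hC, Λ₀, hΛ₀, h⟩ := exists_inv_zeta_bound
  refine ⟨C * 2 ^ (w + 1) * (C * 2 ^ (w + 1)) * 2 ^ (w + 1), ?_⟩
  filter_upwards [eventually_ge_atTop Λ₀] with Λ hΛ q
  obtain ⟨h1, h2⟩ := h Λ hΛ
  have hΛ0 : 0 < Λ := by linarith
  have h3 : ‖riemannZeta (1 + (expo q.1 + expo q.2) / Λ)‖ ≤ Λ := by
    have hre : 0 < ((expo q.1 + expo q.2) / Λ).re := by rw [re_expo_add_div]; positivity
    refine le_trans ?_ h2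
    have h5 := (tendsto_eulerProd 0 hre).inv₀ (by
      exact mul_ne_zero (inv_ne_zero (riemannZeta_ne_zero_of_one_lt_re (by simpa using hre)))
        (inv_ne_zero (smallEulerProd_ne_zero 0 hre.le)))
    have h6 : smallEulerProd 0 ((expo q.1 + expo q.2) / Λ) = 1 := by simp [smallEulerProd]
    rw [h6, inv_one, mul_one, inv_inv] at h5
    refine le_of_tendsto' h5.norm fun Y => ?_
    have := (norm_eulerProd_le 0 Y hre).2
    rwa [re_expo_add_div] at this
  have hb1 := fun ξ => (norm_smallEulerProd_le w (z := expo ξ / Λ)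
    (by rw [re_expo_div]; positivity)).2
  have hb2 := (norm_smallEulerProd_le w (z := (expo q.1 + expo q.2) / Λ)
    (by rw [re_expo_add_div]; positivity)).1
  have h0 : 0 ≤ totDensity w * Λ := mul_nonneg (totDensity_pos w).le hΛ0.le
  rw [limitKernel, norm_mul, norm_mul, norm_mul, norm_real, Real.norm_of_nonneg h0, mul_inv,
    inv_inv, inv_inv, norm_mul, norm_mul, norm_mul]
  calc _ ≤ 1 * Λ * (C * ‖expo q.1‖ ^ 2 / Λ * 2 ^ (w + 1) * (C * ‖expo q.2‖ ^ 2 / Λ * 2 ^ (w + 1)) *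
        (Λ * 2 ^ (w + 1))) := by
        gcongr
        · exact totDensity_le_one w
        · exact h1 _
        · exact hb1 _
        · exact h1 _
        · exact hb1 _
    _ = _ := by field_simp

section

variable {χ : ℝ → ℝ} (hχ : IsSmoothCutoff χ)
include hχ

theorem integrable_density_mul_density :
    Integrable (fun q : ℝ × ℝ => density χ q.1 * density χ q.2) :=
  (integrable_density hχ).mul_prod (integrable_density hχ)

theorem continuous_density_mul_density :
    Continuous (fun q : ℝ × ℝ => density χ q.1 * density χ q.2) := by
  have := continuous_density hχ
  fun_prop

theorem integrable_density_kernel (w Y : ℕ) {Λ : ℝ} (hΛ : 0 < Λ) :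
    Integrable (fun q : ℝ × ℝ => density χ q.1 * density χ q.2 * kernel w Y Λ q) := by
  obtain ⟨C, hC⟩ := exists_norm_kernel_le w hΛ
  exact (integrable_density_mul_density hχ).mul_bdd
    (continuous_kernel w Y hΛ).aestronglyMeasurable (Eventually.of_forall fun q => hC Y q)

/-- Dominated convergence with `Λ` fixed, the kernel being bounded uniformly in `Y`. Letting `Y → ∞`
before `Λ` makes exact values of `ζ` appear. -/
theorem tendsto_integral_kernel (w : ℕ) {Λ : ℝ} (hΛ : 0 < Λ) :
    Tendsto (fun Y => ∫ q : ℝ × ℝ, density χ q.1 * density χ q.2 * kernel w Y Λ q) atTop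
      (𝓝 (∫ q : ℝ × ℝ, density χ q.1 * density χ q.2 * limitKernel w Λ q)) ∧
    Tendsto (fun Y => ∫ q : ℝ × ℝ, ‖density χ q.1 * density χ q.2 * kernel w Y Λ q‖) atTop
      (𝓝 (∫ q : ℝ × ℝ, ‖density χ q.1 * density χ q.2 * limitKernel w Λ q‖)) := by
  obtain ⟨C, hC⟩ := exists_norm_kernel_le w hΛ
  have hb : ∀ Y (q : ℝ × ℝ), ‖density χ q.1 * density χ q.2 * kernel w Y Λ q‖ ≤
      ‖density χ q.1 * density χ q.2‖ * C := fun Y q => by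
    rw [norm_mul]; gcongr; exact hC Y q
  have hi := (integrable_density_mul_density hχ).norm.mul_const C
  have hc := fun Y => (continuous_density_mul_density hχ).mul (continuous_kernel w Y hΛ)
  have hl := fun q : ℝ × ℝ =>
    (tendsto_kernel w hΛ q).const_mul (density χ q.1 * density χ q.2)
  constructor
  · exact tendsto_integral_of_dominated_convergence _ (fun Y => (hc Y).aestronglyMeasurable) hi
      (fun Y => Eventually.of_forall (hb Y)) (Eventually.of_forall hl)
  · refine tendsto_integral_of_dominated_convergence _
      (fun Y => (hc Y).norm.aestronglyMeasurable) hi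
      (fun Y => Eventually.of_forall fun q => ?_) (Eventually.of_forall fun q => (hl q).norm)
    rw [norm_norm]; exact hb Y q

theorem tendsto_integral_limitKernel (w : ℕ) :
    Tendsto (fun Λ => ∫ q : ℝ × ℝ, density χ q.1 * density χ q.2 * limitKernel w Λ q) atTop
      (𝓝 1) ∧
    Tendsto (fun Λ => ∫ q : ℝ × ℝ, ‖density χ q.1 * density χ q.2 * limitKernel w Λ q‖) atTop
      (𝓝 (∫ q : ℝ × ℝ, ‖density χ q.1 * density χ q.2 *
        (expo q.1 * expo q.2 / (expo q.1 + expo q.2))‖)) := by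
  obtain ⟨C, hC⟩ := exists_limitKernel_bound w
  have hb : ∀ᶠ Λ : ℝ in atTop, ∀ q : ℝ × ℝ,
      ‖density χ q.1 * density χ q.2 * limitKernel w Λ q‖ ≤
      C * ((‖expo q.1‖ ^ 2 * ‖density χ q.1‖) * (‖expo q.2‖ ^ 2 * ‖density χ q.2‖)) := by
    filter_upwards [hC] with Λ h q
    rw [norm_mul, norm_mul]
    calc _ ≤ ‖density χ q.1‖ * ‖density χ q.2‖ * (C * (‖expo q.1‖ ^ 2 * ‖expo q.2‖ ^ 2)) := by
          gcongr; exact h q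
      _ = _ := by ring
  have hi := (integrable_prod_density hχ 2 2).const_mul C
  have hm : ∀ᶠ Λ : ℝ in atTop, AEStronglyMeasurable
      (fun q : ℝ × ℝ => density χ q.1 * density χ q.2 * limitKernel w Λ q) volume := by
    filter_upwards [eventually_gt_atTop 0] with Λ hΛ
    refine aestronglyMeasurable_of_tendsto_ae atTop
      (f := fun Y (q : ℝ × ℝ) => density χ q.1 * density χ q.2 * kernel w Y Λ q)
      (fun Y => ((continuous_density_mul_density hχ).mul
        (continuous_kernel w Y hΛ)).aestronglyMeasurable)
      (Eventually.of_forall fun q => (tendsto_kernel w hΛ q).const_mul _)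
  have hl := fun q : ℝ × ℝ =>
    (tendsto_limitKernel w q).const_mul (density χ q.1 * density χ q.2)
  constructor
  · rw [← integral_density_kernel hχ]
    exact tendsto_integral_filter_of_dominated_convergence _ hm
      (hb.mono fun Λ h => Eventually.of_forall h) hi (Eventually.of_forall hl)
  · refine tendsto_integral_filter_of_dominated_convergence _ (hm.mono fun Λ h => h.norm)
      (hb.mono fun Λ h => Eventually.of_forall fun q => ?_) hi
      (Eventually.of_forall fun q => (hl q).norm)
    rw [norm_norm]; exact h q

/-- Asymptotics and absolute bounds for the integral of the kernel. -/
theorem exists_kernel_asymptotics : ∃ C : ℝ, 1 ≤ C ∧ ∀ w : ℕ, ∀ ε : ℝ, 0 < ε →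
    ∀ᶠ Λ : ℝ in atTop, ∀ᶠ Y : ℕ in atTop,
      ‖(∫ q : ℝ × ℝ, density χ q.1 * density χ q.2 * kernel w Y Λ q) - 1‖ ≤ ε ∧
      ∫ q : ℝ × ℝ, ‖density χ q.1 * density χ q.2 * kernel w Y Λ q‖ ≤ C := by
  -- The limit `ss'/(s+s')` no longer involves `w`, so the absolute bound `C₀ + 1` is uniform in
  -- `w`, although the dominating functions were not.
  set C₀ := ∫ q : ℝ × ℝ, ‖density χ q.1 * density χ q.2 *
        (expo q.1 * expo q.2 / (expo q.1 + expo q.2))‖ with hC₀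
  have hC0 : 0 ≤ C₀ := integral_nonneg fun _ => norm_nonneg _
  refine ⟨C₀ + 1, by linarith, fun w ε hε => ?_⟩
  obtain ⟨h1, h2⟩ := tendsto_integral_limitKernel hχ w
  filter_upwards [h1.eventually (Metric.ball_mem_nhds 1 hε),
    h2.eventually_lt_const (show C₀ < C₀ + 1 by linarith),
    eventually_gt_atTop 0] with Λ h3 h4 hΛ
  obtain ⟨h5, h6⟩ := tendsto_integral_kernel hχ w hΛ
  filter_upwards [h5.eventually (Metric.isOpen_ball.mem_nhds h3),
    h6.eventually_lt_const h4] with Y h7 h8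
  refine ⟨?_, h8.le⟩
  rw [← dist_eq_norm]
  exact (Metric.mem_ball.1 h7).le

end

end PrimeWeight

namespace PrimeWeight

/-! ### Comparison of local factors -/

theorem norm_sum_finset_sub_le {m : ℕ} (b : Finset (Fin m) → ℂ) {ε : ℝ}
    (h : ∀ S, 2 ≤ S.card → ‖b S‖ ≤ ε) (hε : 0 ≤ ε) :
    ‖∑ S, b S - (b ∅ + ∑ i, b {i})‖ ≤ 2 ^ m * ε := by
  classical
  have h1 : (Finset.univ.filter fun S : Finset (Fin m) => ¬ 2 ≤ S.card) =
      insert ∅ (Finset.univ.image fun i : Fin m => ({i} : Finset (Fin m))) := by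
    ext S
    simp only [Finset.mem_filter, Finset.mem_univ, true_and, Finset.mem_insert, Finset.mem_image]
    constructor
    · intro hS
      rcases Nat.lt_or_ge S.card 1 with h0 | h0
      · exact Or.inl (Finset.card_eq_zero.1 (by omega))
      · obtain ⟨i, hi⟩ := Finset.card_eq_one.1 (show S.card = 1 by omega)
        exact Or.inr ⟨i, hi.symm⟩
    · rintro (rfl | ⟨i, rfl⟩) <;> simp
  have h2 : ∑ S ∈ Finset.univ.filter (fun S : Finset (Fin m) => ¬ 2 ≤ S.card), b S =
      b ∅ + ∑ i, b {i} := by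
    rw [h1, Finset.sum_insert (by simp), Finset.sum_image]
    intro i _ j _ hij
    simpa using hij
  rw [← Finset.sum_filter_add_sum_filter_not Finset.univ (fun S : Finset (Fin m) => 2 ≤ S.card) b,
    h2, add_sub_cancel_right]
  calc _ ≤ ∑ S ∈ Finset.univ.filter (fun S : Finset (Fin m) => 2 ≤ S.card), ε :=
        norm_sum_le_of_le _ fun S hS => h S (Finset.mem_filter.1 hS).2
    _ ≤ ∑ S : Finset (Fin m), ε :=
        Finset.sum_le_sum_of_subset_of_nonneg (Finset.filter_subset _ _) fun _ _ _ => hε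
    _ = 2 ^ m * ε := by simp

/-- The local factor `∑_S a(S) ∏_{i ∈ S} (-(u_i + u'_i - u_i u'_i))`. -/
noncomputable def localSum {m : ℕ} (a : Finset (Fin m) → ℝ) (u u' : Fin m → ℂ) : ℂ :=
  ∑ S, (a S : ℂ) * ∏ i ∈ S, (-(u i + u' i - u i * u' i))

/-- The model local factor at a prime `p`. -/
noncomputable def localModel (p : ℝ) (u u' : ℂ) : ℂ :=
  (1 - u / p) * (1 - u' / p) * (1 - u * u' / p)⁻¹

/-- The difference from the first-order expansion is exactly `uu'(1 - (u + u' - uu'))/p²` times `(1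
- uu'/p)⁻¹`, with norm at most `4 · 2 / p²`. -/
theorem norm_localModel_sub_le {p : ℝ} (hp : 2 ≤ p) {u u' : ℂ} (hu : ‖u‖ ≤ 1) (hu' : ‖u'‖ ≤ 1) :
    ‖localModel p u u' - 1 + (u + u' - u * u') / p‖ ≤ 8 / p ^ 2 ∧
      ‖localModel p u u' - 1‖ ≤ 7 / p := by
  have hp0 : 0 < p := by linarith
  have hpc : (p : ℂ) ≠ 0 := by exact_mod_cast hp0.ne'
  have huu : ‖u * u'‖ ≤ 1 := by
    rw [norm_mul]; exact mul_le_one₀ hu (norm_nonneg _) hu'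
  have hv : ‖u + u' - u * u'‖ ≤ 3 := by
    have h1 := norm_sub_le (u + u') (u * u')
    have h2 := norm_add_le u u'
    linarith
  have hnp : ‖(p : ℂ)‖ = p := by rw [Complex.norm_real, Real.norm_of_nonneg hp0.le]
  have hden : 1 / 2 ≤ ‖1 - u * u' / p‖ := by
    refine half_le_norm_one_sub ?_
    rw [norm_div, hnp, div_le_div_iff₀ hp0 two_pos]; linarith
  have hne : 1 - u * u' / p ≠ 0 := by
    intro h; rw [h, norm_zero] at hden; norm_num at hden
  have hne' : (p : ℂ) - u * u' ≠ 0 := by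
    intro h; apply hne; field_simp; simpa using h
  have h1 : localModel p u u' - 1 + (u + u' - u * u') / p =
      (u * u' * (1 - (u + u' - u * u'))) / p ^ 2 * (1 - u * u' / p)⁻¹ := by
    rw [localModel]
    field_simp
    ring
  have h2 : ‖localModel p u u' - 1 + (u + u' - u * u') / p‖ ≤ 8 / p ^ 2 := by
    rw [h1, norm_mul, norm_div, norm_mul, norm_inv, norm_pow, hnp]
    have h3 : ‖1 - (u + u' - u * u')‖ ≤ 4 := by
      have := norm_sub_le 1 (u + u' - u * u')
      rw [norm_one] at this
      linarith
    have h4 : ‖1 - u * u' / p‖⁻¹ ≤ 2 := by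
      rw [inv_le_comm₀ (by linarith) two_pos]; linarith
    calc _ ≤ 1 * 4 / p ^ 2 * 2 := by gcongr
      _ = 8 / p ^ 2 := by ring
  refine ⟨h2, ?_⟩
  have h5 : ‖(u + u' - u * u') / p‖ ≤ 3 / p := by
    rw [norm_div, hnp]; gcongr
  have h6 : (8 : ℝ) / p ^ 2 ≤ 4 / p := by
    rw [div_le_div_iff₀ (by positivity) hp0]; nlinarith
  calc ‖localModel p u u' - 1‖ = ‖localModel p u u' - 1 + (u + u' - u * u') / p -
        (u + u' - u * u') / p‖ := by rw [add_sub_cancel_right]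
    _ ≤ 8 / p ^ 2 + 3 / p := (norm_sub_le _ _).trans (add_le_add h2 h5)
    _ ≤ 4 / p + 3 / p := by gcongr
    _ = 7 / p := by ring

/-- The constant in the comparison of local factors. -/
def localConst (m : ℕ) : ℝ := 2 * (6 ^ m + 49 * 2 ^ m + 8 * m)

theorem two_le_localConst (m : ℕ) : 98 ≤ localConst m := by
  have h1 : (1 : ℝ) ≤ 6 ^ m := one_le_pow₀ (by norm_num)
  have h2 : (1 : ℝ) ≤ 2 ^ m := one_le_pow₀ (by norm_num)
  have h3 : (0 : ℝ) ≤ m := Nat.cast_nonneg m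
  unfold localConst; linarith

/-- The local sum and the product of models share the first-order expansion `1 - ∑ (u_i + u'_i - u_i
u'_i)/p`; only the sets of size at least `2` can contribute a term of order `1/p`. Dividing is safe
because the model product has norm at least `1/2` once `p` exceeds `localConst m`. -/
theorem exists_localSum_eq {m : ℕ} {p : ℝ} (hp : localConst m ≤ p) {a : Finset (Fin m) → ℝ}
    {u u' : Fin m → ℂ} (hu : ∀ i, ‖u i‖ ≤ 1) (hu' : ∀ i, ‖u' i‖ ≤ 1) (h0 : a ∅ = 1)
    (h1 : ∀ i, a {i} = 1 / p) (h2 : ∀ S : Finset (Fin m), 2 ≤ S.card → |a S| ≤ 1 / p) :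
    ∃ δ : ℂ, localSum a u u' = (∏ i, localModel p (u i) (u' i)) * (1 + δ) ∧
      ‖δ‖ ≤ localConst m / p ∧
      ((∀ S : Finset (Fin m), 2 ≤ S.card → |a S| ≤ 1 / p ^ 2) → ‖δ‖ ≤ localConst m / p ^ 2) := by
  have hC := two_le_localConst m
  have hp0 : 0 < p := by linarith
  have hp2 : 2 ≤ p := by linarith
  have hnp : ‖(p : ℂ)‖ = p := by rw [Complex.norm_real, Real.norm_of_nonneg hp0.le]
  set v : Fin m → ℂ := fun i => u i + u' i - u i * u' i with hv
  have hv3 : ∀ i, ‖-v i‖ ≤ 3 := by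
    intro i
    rw [norm_neg]
    have h3 := norm_sub_le (u i + u' i) (u i * u' i)
    have h4 := norm_add_le (u i) (u' i)
    have h5 : ‖u i * u' i‖ ≤ 1 := by
      rw [norm_mul]; exact mul_le_one₀ (hu i) (norm_nonneg _) (hu' i)
    have := hu i; have := hu' i
    simp only [hv]; linarith
  have hsum : ‖∑ i, v i / (p : ℂ)‖ ≤ 3 * m / p := by
    refine (norm_sum_le_of_le (f := fun i => v i / (p : ℂ)) _ (n := fun _ => 3 / p) fun i _ => ?_).trans ?_
    · rw [norm_div, hnp, ← norm_neg]; gcongr; exact hv3 i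
    · simp; apply le_of_eq; ring
  have hE : ∀ ε : ℝ, 0 ≤ ε → (∀ S : Finset (Fin m), 2 ≤ S.card → |a S| ≤ ε) →
      ‖localSum a u u' - (1 - ∑ i, v i / (p : ℂ))‖ ≤ 6 ^ m * ε := by
    intro ε hε hS
    have h3 := norm_sum_finset_sub_le (fun S => (a S : ℂ) * ∏ i ∈ S, (-v i)) (ε := ε * 3 ^ m)
      (fun S hS' => by
        rw [norm_mul, Complex.norm_real, norm_prod]
        refine mul_le_mul (hS S hS') ?_ (Finset.prod_nonneg fun _ _ => norm_nonneg _) hε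
        calc ∏ i ∈ S, ‖-v i‖ ≤ ∏ i ∈ S, (3 : ℝ) :=
              Finset.prod_le_prod (fun _ _ => norm_nonneg _) fun i _ => hv3 i
          _ = 3 ^ S.card := by simp
          _ ≤ 3 ^ m := pow_le_pow_right₀ (by norm_num) (by simpa using S.card_le_univ))
      (by positivity)
    have h4 : (a ∅ : ℂ) * ∏ i ∈ (∅ : Finset (Fin m)), (-v i) + ∑ j, (a {j} : ℂ) * ∏ i ∈ {j}, (-v i)
        = 1 - ∑ i, v i / (p : ℂ) := by
      simp only [h0, h1, Finset.prod_empty, Finset.prod_singleton, sub_eq_add_neg,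
        ← Finset.sum_neg_distrib]
      push_cast
      rw [one_mul]
      congr 1
      refine Finset.sum_congr rfl fun i _ => ?_
      ring
    rw [h4] at h3
    refine h3.trans (le_of_eq ?_)
    rw [show (6 : ℝ) = 2 * 3 by norm_num, mul_pow]; ring
  set η : Fin m → ℂ := fun i => localModel p (u i) (u' i) - 1 with hη
  have hη7 : ∀ i, ‖η i‖ ≤ 7 / p := fun i => (norm_localModel_sub_le hp2 (hu i) (hu' i)).2
  set F : ℂ := ∏ i, localModel p (u i) (u' i) with hF
  have hFexp : F = ∑ S : Finset (Fin m), ∏ i ∈ S, η i := by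
    have : F = ∏ i, (1 + η i) := Finset.prod_congr rfl fun i _ => by simp [hη]
    rw [this, Finset.prod_one_add, Finset.powerset_univ]
  have hF1 : ‖F - (1 - ∑ i, v i / (p : ℂ))‖ ≤ (49 * 2 ^ m + 8 * m) / p ^ 2 := by
    have h7p : 7 / p ≤ 1 := by rw [div_le_one hp0]; linarith
    have h3 := norm_sum_finset_sub_le (fun S => ∏ i ∈ S, η i) (ε := (7 / p) ^ 2)
      (fun S hS' => by
        rw [norm_prod]
        calc ∏ i ∈ S, ‖η i‖ ≤ ∏ i ∈ S, (7 / p) :=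
              Finset.prod_le_prod (fun _ _ => norm_nonneg _) fun i _ => hη7 i
          _ = (7 / p) ^ S.card := by rw [Finset.prod_const]
          _ ≤ (7 / p) ^ 2 := pow_le_pow_of_le_one (by positivity) h7p hS')
      (by positivity)
    rw [← hFexp] at h3
    simp only [Finset.prod_empty, Finset.prod_singleton] at h3
    have h4 : ‖∑ i, (η i + v i / p)‖ ≤ m * (8 / p ^ 2) := by
      refine (norm_sum_le_of_le (f := fun i => η i + v i / (p : ℂ)) _
        (n := fun _ => 8 / p ^ 2) fun i _ => ?_).trans (by simp)
      exact (norm_localModel_sub_le hp2 (hu i) (hu' i)).1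
    calc ‖F - (1 - ∑ i, v i / (p : ℂ))‖ = ‖(F - (1 + ∑ i, η i)) + ∑ i, (η i + v i / p)‖ := by
          rw [Finset.sum_add_distrib]; congr 1; ring
      _ ≤ 2 ^ m * (7 / p) ^ 2 + m * (8 / p ^ 2) := (norm_add_le _ _).trans (add_le_add h3 h4)
      _ = _ := by field_simp; ring
  have hsq : ∀ c : ℝ, 0 ≤ c → c / p ^ 2 ≤ c / p := by
    intro c hc
    have : p ≤ p ^ 2 := by nlinarith
    gcongr
  have h2m : (1 : ℝ) ≤ 2 ^ m := one_le_pow₀ (by norm_num)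
  have h6m : (2 : ℝ) ^ m ≤ 6 ^ m := pow_le_pow_left₀ (by norm_num) (by norm_num) m
  have hm0 : (0 : ℝ) ≤ m := Nat.cast_nonneg m
  have hFhalf : 1 / 2 ≤ ‖F‖ := by
    have h3 : ‖F - 1‖ ≤ 1 / 2 := by
      have h4 : F - 1 = (F - (1 - ∑ i, v i / (p : ℂ))) - ∑ i, v i / (p : ℂ) := by ring
      rw [h4]
      refine (norm_sub_le _ _).trans ((add_le_add (hF1.trans (hsq _ (by positivity))) hsum).trans ?_)
      rw [← add_div, div_le_div_iff₀ hp0 two_pos]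
      have : 2 * (6 ^ m + 49 * 2 ^ m + 8 * (m : ℝ)) ≤ p := hp
      -- Bernoulli gives `1 + 5m ≤ 6^m`; hence the `6^m` in `localConst` absorbs the first-order
      -- term `3m/p`.
      have h66 : (6 : ℝ) * m ≤ 2 * 6 ^ m := by
        have hm3 : (m : ℝ) * 3 ≤ 6 ^ m := by
          have := one_add_mul_le_pow (show (-2 : ℝ) ≤ 5 by norm_num) m
          norm_num at this
          linarith
        linarith
      linarith
    have := norm_sub_norm_le (1 : ℂ) (1 - F)
    rw [norm_one, norm_sub_rev 1 F, sub_sub_cancel] at this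
    linarith
  have hFne : F ≠ 0 := by
    intro h; rw [h, norm_zero] at hFhalf; norm_num at hFhalf
  refine ⟨localSum a u u' / F - 1, ?_, ?_, ?_⟩
  · rw [add_sub_cancel, mul_div_cancel₀ _ hFne]
  all_goals
    have hdiv : ‖localSum a u u' / F - 1‖ ≤ 2 * ‖localSum a u u' - F‖ := by
      rw [div_sub_one hFne, norm_div, div_le_iff₀ (by linarith)]
      nlinarith [norm_nonneg (localSum a u u' - F)]
    have hdec : localSum a u u' - F = (localSum a u u' - (1 - ∑ i, v i / (p : ℂ))) -
      (F - (1 - ∑ i, v i / (p : ℂ))) := by ring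
  · have h3 := hE (1 / p) (by positivity) h2
    have h4 : ‖localSum a u u' - F‖ ≤ 6 ^ m * (1 / p) + (49 * 2 ^ m + 8 * m) / p := by
      rw [hdec]
      exact (norm_sub_le _ _).trans (add_le_add h3 (hF1.trans (hsq _ (by positivity))))
    calc _ ≤ 2 * (6 ^ m * (1 / p) + (49 * 2 ^ m + 8 * m) / p) := by linarith
      _ = localConst m / p := by unfold localConst; ring
  · intro h2'
    have h3 := hE (1 / p ^ 2) (by positivity) h2'
    have h4 : ‖localSum a u u' - F‖ ≤ 6 ^ m * (1 / p ^ 2) + (49 * 2 ^ m + 8 * m) / p ^ 2 := by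
      rw [hdec]
      exact (norm_sub_le _ _).trans (add_le_add h3 hF1)
    calc _ ≤ 2 * (6 ^ m * (1 / p ^ 2) + (49 * 2 ^ m + 8 * m) / p ^ 2) := by linarith
      _ = localConst m / p ^ 2 := by unfold localConst; ring

end PrimeWeight

namespace PrimeWeight

open Finset

/-! ### Expansion of the squared divisor sum over sets of primes -/

/-- The weight `μ(d) χ(log d / Λ)` of the squarefree number `d = ∏_{p ∈ D} p`. -/
noncomputable def sieveCoeff (χ : ℝ → ℝ) (Λ : ℝ) (D : Finset ℕ) : ℝ :=
  (-1) ^ #D * χ ((∑ p ∈ D, Real.log p) / Λ)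

/-- The sum of the products `c(D) c(D')` over all pairs with union `G`. -/
noncomputable def sqCoeff (χ : ℝ → ℝ) (Λ : ℝ) (G : Finset ℕ) : ℝ :=
  ∑ d ∈ (G.powerset ×ˢ G.powerset).filter (fun d => d.1 ∪ d.2 = G),
    sieveCoeff χ Λ d.1 * sieveCoeff χ Λ d.2

theorem log_prod_primes {D : Finset ℕ} (hD : ∀ p ∈ D, p.Prime) :
    Real.log ((∏ p ∈ D, p : ℕ) : ℝ) = ∑ p ∈ D, Real.log p := by
  push_cast
  exact Real.log_prod fun p hp => by exact_mod_cast (hD p hp).ne_zero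

theorem moebius_prod_primes {D : Finset ℕ} (hD : ∀ p ∈ D, p.Prime) :
    ArithmeticFunction.moebius (∏ p ∈ D, p) = (-1) ^ #D := by
  rw [ArithmeticFunction.isMultiplicative_moebius.map_prod_of_prime D hD,
    Finset.prod_congr rfl fun p hp => ArithmeticFunction.moebius_apply_prime (hD p hp),
    Finset.prod_const]

theorem prod_primes_dvd_iff {D : Finset ℕ} (hD : ∀ p ∈ D, p.Prime) {n : ℕ} :
    ∏ p ∈ D, p ∣ n ↔ ∀ p ∈ D, p ∣ n :=
  ⟨fun h _ hp => (dvd_prod_of_mem _ hp).trans h,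
    fun h => Finset.prod_primes_dvd n (fun p hp => (hD p hp).prime) h⟩

/-- Only squarefree divisors survive the Möbius factor and only those at most `R` survive the
cutoff; squarefree divisors correspond to sets of primes dividing `n`. Hence `P` needs to contain
only the prime divisors up to `R`, and any larger set of primes gives the same value. -/
theorem smoothedDivisorSum_eq_sum {χ : ℝ → ℝ} (hχ : IsSmoothCutoff χ) {R : ℝ} (hR : 1 < R)
    {P : Finset ℕ} (hP : ∀ p ∈ P, p.Prime) {n : ℕ} (hn : n ≠ 0)
    (hPn : ∀ p : ℕ, p.Prime → p ∣ n → (p : ℝ) ≤ R → p ∈ P) :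
    smoothedDivisorSum χ R n =
      ∑ D ∈ (P.filter (· ∣ n)).powerset, sieveCoeff χ (Real.log R) D := by
  have hprime : ∀ D ∈ (P.filter (· ∣ n)).powerset, ∀ p ∈ D, p.Prime := fun D hD p hp =>
    hP p (mem_filter.1 (mem_powerset.1 hD hp)).1
  have hinj : Set.InjOn (fun D : Finset ℕ => ∏ p ∈ D, p) ((P.filter (· ∣ n)).powerset : Set _) := by
    intro D hD E hE h
    rw [← Nat.primeFactors_prod (hprime D hD), ← Nat.primeFactors_prod (hprime E hE)]
    exact congrArg _ h
  have hsub : (P.filter (· ∣ n)).powerset.image (fun D : Finset ℕ => ∏ p ∈ D, p) ⊆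
      n.divisors := by
    intro d hd
    obtain ⟨D, hD, rfl⟩ := mem_image.1 hd
    exact Nat.mem_divisors.2 ⟨(prod_primes_dvd_iff (hprime D hD)).2 fun p hp =>
      (mem_filter.1 (mem_powerset.1 hD hp)).2, hn⟩
  rw [smoothedDivisorSum, ← Finset.sum_subset hsub, Finset.sum_image hinj]
  · refine Finset.sum_congr rfl fun D hD => ?_
    rw [moebius_prod_primes (hprime D hD), log_prod_primes (hprime D hD), sieveCoeff]
    push_cast; rfl
  · intro d hd hd'
    by_contra hne
    apply hd'
    have hsq : Squarefree d := by
      by_contra h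
      rw [ArithmeticFunction.moebius_eq_zero_of_not_squarefree h] at hne
      simp at hne
    have hdn : d ∣ n := Nat.dvd_of_mem_divisors hd
    have hd0 : 0 < d := Nat.pos_of_mem_divisors hd
    have hdR : (d : ℝ) ≤ R := by
      by_contra h
      have hlog : Real.log R < Real.log d := Real.log_lt_log (by linarith) (not_le.1 h)
      have := hχ.eq_zero_of_one_lt ((one_lt_div (Real.log_pos hR)).2 hlog)
      rw [this, mul_zero] at hne
      exact hne rfl
    refine mem_image.2 ⟨d.primeFactors, mem_powerset.2 fun p hp => ?_,
      Nat.prod_primeFactors_of_squarefree hsq⟩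
    have hpd := Nat.dvd_of_mem_primeFactors hp
    refine mem_filter.2 ⟨hPn p (Nat.prime_of_mem_primeFactors hp) (hpd.trans hdn) ?_,
      hpd.trans hdn⟩
    exact le_trans (by exact_mod_cast Nat.le_of_dvd hd0 hpd) hdR

/-- Pairs are grouped by their union, the analogue of grouping pairs of divisors by their least
common multiple. -/
theorem sq_sum_powerset_eq (c : Finset ℕ → ℝ) (Q : Finset ℕ) :
    (∑ D ∈ Q.powerset, c D) ^ 2 = ∑ G ∈ Q.powerset,
      ∑ d ∈ (G.powerset ×ˢ G.powerset).filter (fun d => d.1 ∪ d.2 = G), c d.1 * c d.2 := by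
  rw [sq, Finset.sum_mul_sum, ← Finset.sum_product',
    ← Finset.sum_fiberwise_of_maps_to (s := Q.powerset ×ˢ Q.powerset) (t := Q.powerset)
      (g := fun d => d.1 ∪ d.2)]
  · refine Finset.sum_congr rfl fun G hG => Finset.sum_congr ?_ fun _ _ => rfl
    ext d
    simp only [mem_filter, mem_product, mem_powerset]
    constructor
    · rintro ⟨_, rfl⟩; exact ⟨⟨subset_union_left, subset_union_right⟩, rfl⟩
    · rintro ⟨⟨h1, h2⟩, h3⟩
      exact ⟨⟨h1.trans (mem_powerset.1 hG), h2.trans (mem_powerset.1 hG)⟩, h3⟩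
  · intro d hd
    have := mem_product.1 hd
    exact mem_powerset.2 (union_subset (mem_powerset.1 this.1) (mem_powerset.1 this.2))

theorem sq_smoothedDivisorSum_eq_sum {χ : ℝ → ℝ} (hχ : IsSmoothCutoff χ) {R : ℝ} (hR : 1 < R)
    {P : Finset ℕ} (hP : ∀ p ∈ P, p.Prime) {n : ℕ} (hn : n ≠ 0)
    (hPn : ∀ p : ℕ, p.Prime → p ∣ n → (p : ℝ) ≤ R → p ∈ P) :
    smoothedDivisorSum χ R n ^ 2 =
      ∑ G ∈ P.powerset, sqCoeff χ (Real.log R) G * if ∀ p ∈ G, p ∣ n then 1 else 0 := by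
  rw [smoothedDivisorSum_eq_sum hχ hR hP hn hPn, sq_sum_powerset_eq]
  simp only [mul_ite, mul_one, mul_zero]
  rw [← Finset.sum_filter]
  refine Finset.sum_congr ?_ fun G _ => rfl
  ext G
  simp only [mem_powerset, mem_filter, Finset.subset_iff]
  constructor
  · intro h; exact ⟨fun p hp => (h hp).1, fun p hp => (h hp).2⟩
  · rintro ⟨h1, h2⟩ p hp; exact ⟨h1 hp, h2 p hp⟩

theorem prod_sq_smoothedDivisorSum_eq_sum {χ : ℝ → ℝ} (hχ : IsSmoothCutoff χ) {R : ℝ}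
    (hR : 1 < R) {P : Finset ℕ} (hP : ∀ p ∈ P, p.Prime) {m : ℕ} {n : Fin m → ℕ}
    (hn : ∀ i, n i ≠ 0) (hPn : ∀ i, ∀ p : ℕ, p.Prime → p ∣ n i → (p : ℝ) ≤ R → p ∈ P) :
    ∏ i, smoothedDivisorSum χ R (n i) ^ 2 =
      ∑ G ∈ Fintype.piFinset (fun _ : Fin m => P.powerset),
        (∏ i, sqCoeff χ (Real.log R) (G i)) * if ∀ i, ∀ p ∈ G i, p ∣ n i then 1 else 0 := by
  rw [Finset.prod_congr rfl fun i _ => sq_smoothedDivisorSum_eq_sum hχ hR hP (hn i) (hPn i),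
    Finset.prod_univ_sum]
  refine Finset.sum_congr rfl fun G _ => ?_
  rw [Finset.prod_mul_distrib, Finset.prod_ite_zero]
  simp

/-- A nonzero coefficient forces the product of the primes into `[1, R]`, and distinct sets of
primes have distinct products, so at most `R` terms occur. -/
theorem sum_abs_sieveCoeff_le {χ : ℝ → ℝ} (hχ : IsSmoothCutoff χ) {C : ℝ} (hC : ∀ x, |χ x| ≤ C)
    {R : ℝ} (hR : 1 < R) {P : Finset ℕ} (hP : ∀ p ∈ P, p.Prime) :
    (∀ D ⊆ P, sieveCoeff χ (Real.log R) D ≠ 0 → ((∏ p ∈ D, p : ℕ) : ℝ) ≤ R) ∧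
    ∑ D ∈ P.powerset, |sieveCoeff χ (Real.log R) D| ≤ C * R := by
  have hC0 : 0 ≤ C := (abs_nonneg _).trans (hC 0)
  have hsmall : ∀ D ⊆ P, sieveCoeff χ (Real.log R) D ≠ 0 → ((∏ p ∈ D, p : ℕ) : ℝ) ≤ R := by
    intro D hD hne
    have hprime : ∀ p ∈ D, p.Prime := fun p hp => hP p (hD hp)
    have hpos : 0 < ∏ p ∈ D, p := Finset.prod_pos fun p hp => (hprime p hp).pos
    by_contra h
    have hlog : Real.log R < Real.log ((∏ p ∈ D, p : ℕ) : ℝ) :=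
      Real.log_lt_log (by linarith) (not_le.1 h)
    rw [log_prod_primes hprime] at hlog
    have := hχ.eq_zero_of_one_lt ((one_lt_div (Real.log_pos hR)).2 hlog)
    rw [sieveCoeff, this, mul_zero] at hne
    exact hne rfl
  refine ⟨hsmall, ?_⟩
  have hle : ∀ D, |sieveCoeff χ (Real.log R) D| ≤ C := by
    intro D
    rw [sieveCoeff, abs_mul, abs_pow, abs_neg, abs_one, one_pow, one_mul]
    exact hC _
  set T := P.powerset.filter (fun D => sieveCoeff χ (Real.log R) D ≠ 0) with hT
  have hcard : (#T : ℝ) ≤ R := by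
    have h1 : #T ≤ #(Finset.Icc 1 ⌊R⌋₊) := by
      refine Finset.card_le_card_of_injOn (fun D => ∏ p ∈ D, p) ?_ ?_
      · intro D hD
        have hD' := mem_filter.1 hD
        have hDP := mem_powerset.1 hD'.1
        refine mem_coe.2 (mem_Icc.2 ⟨?_, Nat.le_floor (hsmall D hDP hD'.2)⟩)
        exact Finset.prod_pos fun p hp => (hP p (hDP hp)).pos
      · intro D hD E hE h
        have hDP := mem_powerset.1 (mem_filter.1 hD).1
        have hEP := mem_powerset.1 (mem_filter.1 hE).1
        rw [← Nat.primeFactors_prod fun p hp => hP p (hDP hp),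
          ← Nat.primeFactors_prod fun p hp => hP p (hEP hp)]
        exact congrArg _ h
    rw [Nat.card_Icc, Nat.add_sub_cancel] at h1
    exact le_trans (by exact_mod_cast h1) (Nat.floor_le (by linarith))
  calc ∑ D ∈ P.powerset, |sieveCoeff χ (Real.log R) D|
      = ∑ D ∈ T, |sieveCoeff χ (Real.log R) D| := by
        rw [hT, Finset.sum_filter]
        refine Finset.sum_congr rfl fun D _ => ?_
        split_ifs with h
        · rfl
        · rw [not_not.1 h, abs_zero]
    _ ≤ ∑ D ∈ T, C := Finset.sum_le_sum fun D _ => hle D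
    _ = C * #T := by rw [Finset.sum_const, nsmul_eq_mul, mul_comm]
    _ ≤ C * R := by gcongr

theorem sum_abs_sqCoeff_le {χ : ℝ → ℝ} (hχ : IsSmoothCutoff χ) {C : ℝ} (hC : ∀ x, |χ x| ≤ C)
    {R : ℝ} (hR : 1 < R) {P : Finset ℕ} (hP : ∀ p ∈ P, p.Prime) :
    (∀ G ⊆ P, sqCoeff χ (Real.log R) G ≠ 0 → ((∏ p ∈ G, p : ℕ) : ℝ) ≤ R ^ 2) ∧
    ∑ G ∈ P.powerset, |sqCoeff χ (Real.log R) G| ≤ (C * R) ^ 2 := by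
  obtain ⟨h1, h2⟩ := sum_abs_sieveCoeff_le hχ hC hR hP
  constructor
  · intro G hG hne
    obtain ⟨d, hd, hd'⟩ := Finset.exists_ne_zero_of_sum_ne_zero hne
    simp only [mem_filter, mem_product, mem_powerset] at hd
    have h3 := h1 d.1 (hd.1.1.trans hG) (left_ne_zero_of_mul hd')
    have h4 := h1 d.2 (hd.1.2.trans hG) (right_ne_zero_of_mul hd')
    have hprime : ∀ p ∈ G, p.Prime := fun p hp => hP p (hG hp)
    have h5 : ∏ p ∈ G, p ≤ (∏ p ∈ d.1, p) * ∏ p ∈ d.2, p := by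
      rw [← hd.2, ← Finset.prod_union_inter]
      refine Nat.le_mul_of_pos_right _ (Finset.prod_pos fun p hp => ?_)
      exact (hprime p (hd.1.1 (mem_inter.1 hp).1)).pos
    calc ((∏ p ∈ G, p : ℕ) : ℝ) ≤ ((∏ p ∈ d.1, p : ℕ) : ℝ) * ((∏ p ∈ d.2, p : ℕ) : ℝ) := by
          exact_mod_cast h5
      _ ≤ R * R := by gcongr
      _ = R ^ 2 := by ring
  · have h0 : 0 ≤ ∑ D ∈ P.powerset, |sieveCoeff χ (Real.log R) D| :=
      Finset.sum_nonneg fun _ _ => abs_nonneg _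
    refine le_trans ?_ (pow_le_pow_left₀ h0 h2 2)
    rw [sq_sum_powerset_eq]
    refine Finset.sum_le_sum fun G _ => (Finset.abs_sum_le_sum_abs _ _).trans ?_
    exact Finset.sum_le_sum fun d _ => (abs_mul _ _).le

/-! ### Two product formulas -/

/-- Summed over all subsets of `G`, both sides become `∏ (1 + f)(1 + g)`. Strong induction on `G`
then isolates the top term, a form of Möbius inversion. -/
theorem sum_union_eq_prod (f g : ℕ → ℂ) (G : Finset ℕ) :
    ∑ d ∈ (G.powerset ×ˢ G.powerset).filter (fun d => d.1 ∪ d.2 = G),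
      (∏ p ∈ d.1, f p) * ∏ p ∈ d.2, g p = ∏ p ∈ G, (f p + g p + f p * g p) := by
  set S : Finset ℕ → ℂ := fun G => ∑ d ∈ (G.powerset ×ˢ G.powerset).filter
    (fun d => d.1 ∪ d.2 = G), (∏ p ∈ d.1, f p) * ∏ p ∈ d.2, g p with hS
  have hsum : ∀ G : Finset ℕ, ∑ H ∈ G.powerset, S H =
      ∑ H ∈ G.powerset, ∏ p ∈ H, (f p + g p + f p * g p) := by
    intro G
    rw [← Finset.prod_one_add]
    have h1 : ∏ p ∈ G, (1 + (f p + g p + f p * g p)) = (∏ p ∈ G, (1 + f p)) * ∏ p ∈ G, (1 + g p) := by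
      rw [← Finset.prod_mul_distrib]
      exact Finset.prod_congr rfl fun p _ => by ring
    rw [h1, Finset.prod_one_add, Finset.prod_one_add, Finset.sum_mul_sum, ← Finset.sum_product',
      ← Finset.sum_fiberwise_of_maps_to (s := G.powerset ×ˢ G.powerset) (t := G.powerset)
        (g := fun d => d.1 ∪ d.2)]
    · refine Finset.sum_congr rfl fun H hH => Finset.sum_congr ?_ fun _ _ => rfl
      ext d
      simp only [mem_filter, mem_product, mem_powerset]
      constructor
      · rintro ⟨⟨h1, h2⟩, h3⟩
        exact ⟨⟨h1.trans (mem_powerset.1 hH), h2.trans (mem_powerset.1 hH)⟩, h3⟩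
      · rintro ⟨_, rfl⟩; exact ⟨⟨subset_union_left, subset_union_right⟩, rfl⟩
    · intro d hd
      have := mem_product.1 hd
      exact mem_powerset.2 (union_subset (mem_powerset.1 this.1) (mem_powerset.1 this.2))
  change S G = _
  induction G using Finset.strongInduction with
  | H G ih =>
    have h1 := hsum G
    rw [← Finset.add_sum_erase _ _ (Finset.mem_powerset_self G),
      ← Finset.add_sum_erase _ _ (Finset.mem_powerset_self G)] at h1
    have h2 : ∑ H ∈ G.powerset.erase G, S H =
        ∑ H ∈ G.powerset.erase G, ∏ p ∈ H, (f p + g p + f p * g p) := by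
      refine Finset.sum_congr rfl fun H hH => ih H ?_
      exact Finset.mem_ssubsets.1 hH
    rw [h2] at h1
    exact add_right_cancel h1

/-- A family of subsets `G i` of `P` is the same as an assignment to each `p ∈ P` of the set of
indices `i` with `p ∈ G i`; the summand is multiplicative over `p`. -/
theorem sum_piFinset_prod_eq {m : ℕ} (P : Finset ℕ) (a : ℕ → Finset (Fin m) → ℂ)
    (f : Fin m → ℕ → ℂ) :
    ∑ G ∈ Fintype.piFinset (fun _ : Fin m => P.powerset),
      (∏ i, ∏ p ∈ G i, f i p) * ∏ p ∈ P, a p (univ.filter fun i => p ∈ G i) =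
    ∏ p ∈ P, ∑ S : Finset (Fin m), a p S * ∏ i ∈ S, f i p := by
  rw [Finset.prod_sum]
  refine Finset.sum_bij' (fun G _ => fun p _ => univ.filter fun i => p ∈ G i)
    (fun φ _ => fun i => P.filter fun p => ∃ h : p ∈ P, i ∈ φ p h) ?_ ?_ ?_ ?_ ?_
  · intro G _; simp
  · intro φ _; simp
  · intro G hG
    have hG' := Fintype.mem_piFinset.1 hG
    funext i
    ext p
    simp only [mem_filter, mem_univ, true_and, exists_prop]
    exact ⟨fun h => h.2.2, fun h => ⟨mem_powerset.1 (hG' i) h, mem_powerset.1 (hG' i) h, h⟩⟩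
  · intro φ _
    funext p hp
    ext i
    simp only [mem_filter, mem_univ, true_and]
    exact ⟨fun h => h.2.2, fun h => ⟨hp, hp, h⟩⟩
  · intro G hG
    have hG' := Fintype.mem_piFinset.1 hG
    rw [Finset.prod_attach P fun p => a p (univ.filter fun i => p ∈ G i) *
      ∏ i ∈ univ.filter (fun i => p ∈ G i), f i p, Finset.prod_mul_distrib, mul_comm]
    congr 1
    have h1 : ∀ i, ∏ p ∈ G i, f i p = ∏ p ∈ P, if p ∈ G i then f i p else 1 := by
      intro i
      rw [← Finset.prod_filter]
      refine Finset.prod_congr ?_ fun _ _ => rfl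
      ext p
      simp only [mem_filter]
      exact ⟨fun h => ⟨mem_powerset.1 (hG' i) h, h⟩, fun h => h.2⟩
    simp_rw [h1]
    rw [Finset.prod_comm]
    refine Finset.prod_congr rfl fun p _ => ?_
    rw [Finset.prod_filter]

end PrimeWeight

/-! ### Integral representation of the sieve sum. -/

namespace PrimeWeight

open MeasureTheory Complex
open scoped Real

/-- The quantity `p^{-s/Λ}` for the exponent `s = 1 - 2πiξ`. -/
noncomputable def primeTerm (Λ : ℝ) (p : ℕ) (ξ : ℝ) : ℂ := (p : ℂ) ^ (-(expo ξ / Λ))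

theorem continuous_primeTerm (Λ : ℝ) {p : ℕ} (hp : p.Prime) : Continuous (primeTerm Λ p) := by
  have he := continuous_expo
  have : (p : ℂ) ≠ 0 := by exact_mod_cast hp.ne_zero
  exact Continuous.const_cpow (by fun_prop) (Or.inl this)

theorem norm_primeTerm_le {Λ : ℝ} (hΛ : 0 < Λ) {p : ℕ} (hp : p.Prime) (ξ : ℝ) :
    ‖primeTerm Λ p ξ‖ ≤ 1 := by
  rw [primeTerm, norm_natCast_cpow_of_pos hp.pos, neg_re, re_expo_div]
  refine Real.rpow_le_one_of_one_le_of_nonpos (by exact_mod_cast hp.one_le) ?_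
  have : 0 < 1 / Λ := by positivity
  linarith

theorem prod_primeTerm {Λ : ℝ} {D : Finset ℕ} (hD : ∀ p ∈ D, p.Prime) (ξ : ℝ) :
    ∏ p ∈ D, primeTerm Λ p ξ = cexp (-(((∑ p ∈ D, Real.log p) / Λ : ℝ) : ℂ) * expo ξ) := by
  have h : ∀ p ∈ D, primeTerm Λ p ξ = cexp (-(((Real.log p) / Λ : ℝ) : ℂ) * expo ξ) := by
    intro p hp
    have : (p : ℂ) ≠ 0 := by exact_mod_cast (hD p hp).ne_zero
    rw [primeTerm, cpow_def_of_ne_zero this, ← natCast_log]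
    congr 1
    push_cast
    ring
  rw [Finset.prod_congr rfl h, ← Complex.exp_sum]
  congr 1
  rw [← Finset.sum_mul, Finset.sum_div]
  push_cast
  rw [Finset.sum_neg_distrib]

/-- The term `-(u + u' - u u')` where `u`, `u'` are the prime terms of the two exponents. -/
noncomputable def pairTerm (Λ : ℝ) (p : ℕ) (q : ℝ × ℝ) : ℂ :=
  -(primeTerm Λ p q.1 + primeTerm Λ p q.2 - primeTerm Λ p q.1 * primeTerm Λ p q.2)

theorem continuous_pairTerm (Λ : ℝ) {p : ℕ} (hp : p.Prime) : Continuous (pairTerm Λ p) := by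
  have := continuous_primeTerm Λ hp
  unfold pairTerm; fun_prop

theorem norm_pairTerm_le {Λ : ℝ} (hΛ : 0 < Λ) {p : ℕ} (hp : p.Prime) (q : ℝ × ℝ) :
    ‖pairTerm Λ p q‖ ≤ 3 := by
  have h1 := norm_primeTerm_le hΛ hp q.1
  have h2 := norm_primeTerm_le hΛ hp q.2
  have h3 : ‖primeTerm Λ p q.1 * primeTerm Λ p q.2‖ ≤ 1 := by
    rw [norm_mul]; exact mul_le_one₀ h1 (norm_nonneg _) h2
  rw [pairTerm, norm_neg]
  have h4 := norm_sub_le (primeTerm Λ p q.1 + primeTerm Λ p q.2)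
    (primeTerm Λ p q.1 * primeTerm Λ p q.2)
  have h5 := norm_add_le (primeTerm Λ p q.1) (primeTerm Λ p q.2)
  linarith

section

variable {χ : ℝ → ℝ} (hχ : IsSmoothCutoff χ)
include hχ

theorem sieveCoeff_eq_integral {Λ : ℝ} {D : Finset ℕ} (hD : ∀ p ∈ D, p.Prime) :
    (sieveCoeff χ Λ D : ℂ) = ∫ ξ, density χ ξ * ∏ p ∈ D, (-primeTerm Λ p ξ) := by
  rw [sieveCoeff]
  push_cast [-ofReal_sum]
  have := cutoff_eq_integral hχ ((∑ p ∈ D, Real.log p) / Λ)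
  push_cast [-ofReal_sum] at this
  rw [this, ← integral_const_mul]
  congr 1; ext ξ
  rw [Finset.prod_neg, prod_primeTerm hD]
  push_cast [-ofReal_sum]
  ring

theorem integrable_density_mul_prod_neg {Λ : ℝ} (hΛ : 0 < Λ) {D : Finset ℕ}
    (hD : ∀ p ∈ D, p.Prime) :
    Integrable fun ξ => density χ ξ * ∏ p ∈ D, (-primeTerm Λ p ξ) := by
  refine (integrable_density hχ).mul_bdd (c := 1)
    (continuous_finsetProd _ fun p hp => (continuous_primeTerm Λ (hD p hp)).neg).aestronglyMeasurable
    (Filter.Eventually.of_forall fun ξ => ?_)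
  rw [norm_prod]
  refine Finset.prod_le_one (fun _ _ => norm_nonneg _) fun p hp => ?_
  rw [norm_neg]; exact norm_primeTerm_le hΛ (hD p hp) ξ

/-- Insert the representation of both coefficients and apply `sum_union_eq_prod` with `f = -u`, `g =
-u'`, so that `f + g + fg = -(u + u' - uu')`. -/
theorem sqCoeff_eq_integral {Λ : ℝ} (hΛ : 0 < Λ) {G : Finset ℕ} (hG : ∀ p ∈ G, p.Prime) :
    (sqCoeff χ Λ G : ℂ) =
      ∫ q : ℝ × ℝ, density χ q.1 * density χ q.2 * ∏ p ∈ G, pairTerm Λ p q := by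
  have hterm : ∀ q : ℝ × ℝ, density χ q.1 * density χ q.2 * ∏ p ∈ G, pairTerm Λ p q =
      ∑ d ∈ (G.powerset ×ˢ G.powerset).filter (fun d => d.1 ∪ d.2 = G),
        (density χ q.1 * ∏ p ∈ d.1, (-primeTerm Λ p q.1)) *
          (density χ q.2 * ∏ p ∈ d.2, (-primeTerm Λ p q.2)) := by
    intro q
    have h1 : ∀ p, pairTerm Λ p q = -primeTerm Λ p q.1 + -primeTerm Λ p q.2 +
        -primeTerm Λ p q.1 * -primeTerm Λ p q.2 := fun p => by rw [pairTerm]; ring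
    simp_rw [h1]
    rw [← sum_union_eq_prod, Finset.mul_sum]
    exact Finset.sum_congr rfl fun d _ => by ring
  have hd : ∀ d ∈ (G.powerset ×ˢ G.powerset).filter (fun d => d.1 ∪ d.2 = G),
      (∀ p ∈ d.1, p.Prime) ∧ ∀ p ∈ d.2, p.Prime := by
    intro d hd
    have := Finset.mem_product.1 (Finset.mem_filter.1 hd).1
    exact ⟨fun p hp => hG p (Finset.mem_powerset.1 this.1 hp),
      fun p hp => hG p (Finset.mem_powerset.1 this.2 hp)⟩
  simp_rw [hterm]
  rw [integral_finsetSum _ fun d hd' => ?_]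
  · rw [sqCoeff]
    push_cast
    refine Finset.sum_congr rfl fun d hd' => ?_
    rw [sieveCoeff_eq_integral hχ (hd d hd').1, sieveCoeff_eq_integral hχ (hd d hd').2]
    exact (integral_prod_mul _ _).symm
  · exact (integrable_density_mul_prod_neg hχ hΛ (hd d hd').1).mul_prod
      (integrable_density_mul_prod_neg hχ hΛ (hd d hd').2)

theorem integrable_density_mul_prod_pairTerm {Λ : ℝ} (hΛ : 0 < Λ) {G : Finset ℕ}
    (hG : ∀ p ∈ G, p.Prime) :
    Integrable fun q : ℝ × ℝ => density χ q.1 * density χ q.2 * ∏ p ∈ G, pairTerm Λ p q := by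
  refine (integrable_density_mul_density hχ).mul_bdd (c := 3 ^ G.card)
    (continuous_finsetProd _ fun p hp => continuous_pairTerm Λ (hG p hp)).aestronglyMeasurable
    (Filter.Eventually.of_forall fun q => ?_)
  rw [norm_prod]
  refine (Finset.prod_le_prod (fun _ _ => norm_nonneg _) fun p hp =>
    norm_pairTerm_le hΛ (hG p hp) q).trans_eq (Finset.prod_const _)

end

/-- The main sum of the sieve, for given local densities `a p S`. -/
noncomputable def sieveSum (χ : ℝ → ℝ) (Λ : ℝ) (P : Finset ℕ) {m : ℕ}
    (a : ℕ → Finset (Fin m) → ℝ) : ℝ :=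
  ∑ G ∈ Fintype.piFinset (fun _ : Fin m => P.powerset),
    (∏ i, sqCoeff χ Λ (G i)) * ∏ p ∈ P, a p (Finset.univ.filter fun i => p ∈ G i)

/-- All sums are finite, so they pass through the integral. The integrand is then multiplicative
over primes, and `sum_piFinset_prod_eq` turns it into a product of local sums. -/
theorem sieveSum_eq_integral {χ : ℝ → ℝ} (hχ : IsSmoothCutoff χ) {Λ : ℝ} (hΛ : 0 < Λ)
    {P : Finset ℕ} (hP : ∀ p ∈ P, p.Prime) {m : ℕ} (a : ℕ → Finset (Fin m) → ℝ) :
    Integrable (fun q : Fin m → ℝ × ℝ => (∏ i, (density χ (q i).1 * density χ (q i).2)) *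
      ∏ p ∈ P, localSum (a p) (fun i => primeTerm Λ p (q i).1)
        (fun i => primeTerm Λ p (q i).2)) ∧
    (sieveSum χ Λ P a : ℂ) = ∫ q : Fin m → ℝ × ℝ,
      (∏ i, (density χ (q i).1 * density χ (q i).2)) *
      ∏ p ∈ P, localSum (a p) (fun i => primeTerm Λ p (q i).1)
        (fun i => primeTerm Λ p (q i).2) := by
  have hterm : ∀ q : Fin m → ℝ × ℝ, (∏ i, (density χ (q i).1 * density χ (q i).2)) *
      ∏ p ∈ P, localSum (a p) (fun i => primeTerm Λ p (q i).1)
        (fun i => primeTerm Λ p (q i).2) =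
      ∑ G ∈ Fintype.piFinset (fun _ : Fin m => P.powerset),
        (∏ i, (density χ (q i).1 * density χ (q i).2 * ∏ p ∈ G i, pairTerm Λ p (q i))) *
          ∏ p ∈ P, (a p (Finset.univ.filter fun i => p ∈ G i) : ℂ) := by
    intro q
    have h1 := sum_piFinset_prod_eq P (fun p S => (a p S : ℂ)) (fun i p => pairTerm Λ p (q i))
    have h2 : ∏ p ∈ P, localSum (a p) (fun i => primeTerm Λ p (q i).1)
        (fun i => primeTerm Λ p (q i).2) =
        ∏ p ∈ P, ∑ S : Finset (Fin m), (a p S : ℂ) * ∏ i ∈ S, pairTerm Λ p (q i) := rfl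
    rw [h2, ← h1, Finset.mul_sum]
    refine Finset.sum_congr rfl fun G _ => ?_
    rw [Finset.prod_mul_distrib (f := fun i => density χ (q i).1 * density χ (q i).2)]
    ring
  have hprime : ∀ G ∈ Fintype.piFinset (fun _ : Fin m => P.powerset), ∀ i, ∀ p ∈ G i, p.Prime :=
    fun G hG i p hp => hP p (Finset.mem_powerset.1 (Fintype.mem_piFinset.1 hG i) hp)
  have hint : ∀ G ∈ Fintype.piFinset (fun _ : Fin m => P.powerset),
      Integrable (fun q : Fin m → ℝ × ℝ =>
        (∏ i, (density χ (q i).1 * density χ (q i).2 * ∏ p ∈ G i, pairTerm Λ p (q i))) *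
          ∏ p ∈ P, (a p (Finset.univ.filter fun i => p ∈ G i) : ℂ)) := by
    intro G hG
    exact (Integrable.fintype_prod fun i =>
      integrable_density_mul_prod_pairTerm hχ hΛ (hprime G hG i)).mul_const _
  simp_rw [hterm]
  refine ⟨integrable_finsetSum _ hint, ?_⟩
  rw [integral_finsetSum _ hint, sieveSum]
  push_cast
  refine Finset.sum_congr rfl fun G hG => ?_
  rw [integral_mul_const, integral_fintype_prod_volume_eq_prod
    (fun i (q : ℝ × ℝ) => density χ q.1 * density χ q.2 * ∏ p ∈ G i, pairTerm Λ p q)]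
  congr 1
  exact Finset.prod_congr rfl fun i _ => sqCoeff_eq_integral hχ hΛ (hprime G hG i)

end PrimeWeight

/-! ### Asymptotics and upper bounds for the sieve sum. -/

namespace PrimeWeight

open MeasureTheory Filter Topology Complex
open scoped Real

theorem kernel_eq_prod_localModel (w Y : ℕ) (Λ : ℝ) (q : ℝ × ℝ) :
    kernel w Y Λ q = (totDensity w * Λ : ℝ) *
      ∏ p ∈ sievePrimes w Y, localModel p (primeTerm Λ p q.1) (primeTerm Λ p q.2) := by
  rw [kernel, eulerProd, eulerProd, eulerProd, ← Finset.prod_inv_distrib,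
    ← Finset.prod_mul_distrib, ← Finset.prod_mul_distrib]
  congr 1
  refine Finset.prod_congr rfl fun p hp => ?_
  have hp0 : (p : ℂ) ≠ 0 := by exact_mod_cast (mem_sievePrimes.1 hp).1.ne_zero
  have h1 : ∀ z : ℂ, (p : ℂ) ^ (-(1 + z)) = (p : ℂ) ^ (-z) / p := by
    intro z
    rw [show -(1 + z) = -z - 1 by ring, cpow_sub _ _ hp0, cpow_one]
  have h2 : (p : ℂ) ^ (-((expo q.1 + expo q.2) / Λ)) =
      primeTerm Λ p q.1 * primeTerm Λ p q.2 := by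
    rw [primeTerm, primeTerm, ← cpow_add _ _ hp0]
    congr 1; ring
  rw [h1, h1, h1, h2, localModel]
  push_cast
  rfl

theorem sum_inv_sq_sievePrimes_le {w : ℕ} (hw : 1 ≤ w) (Y : ℕ) :
    ∑ p ∈ sievePrimes w Y, (1 : ℝ) / (p : ℝ) ^ 2 ≤ 2 / w := by
  have hsub : sievePrimes w Y ⊆ Finset.Ioo w Y := fun p hp => by
    have := mem_sievePrimes.1 hp
    exact Finset.mem_Ioo.2 this.2
  calc ∑ p ∈ sievePrimes w Y, (1 : ℝ) / (p : ℝ) ^ 2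
      ≤ ∑ p ∈ Finset.Ioo w Y, (1 : ℝ) / (p : ℝ) ^ 2 :=
        Finset.sum_le_sum_of_subset_of_nonneg hsub fun _ _ _ => by positivity
    _ = ∑ p ∈ Finset.Ioo w Y, ((p : ℝ) ^ 2)⁻¹ := by simp_rw [one_div]
    _ ≤ 2 / (w + 1) := sum_Ioo_inv_sq_le w Y
    _ ≤ 2 / w := by
        have : (1 : ℝ) ≤ w := by exact_mod_cast hw
        gcongr; linarith

/-- Local densities, at the primes of `P`, of a system of `m` divisibility conditions. -/
structure IsLocalDensity (P : Finset ℕ) {m : ℕ} (a : ℕ → Finset (Fin m) → ℝ) : Prop where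
  empty : ∀ p ∈ P, a p ∅ = 1
  singleton : ∀ p ∈ P, ∀ i, a p {i} = 1 / p
  bound : ∀ p ∈ P, ∀ S : Finset (Fin m), 2 ≤ S.card → |a p S| ≤ 1 / p

theorem abs_pow_sub_one_le {z : ℂ} {ε : ℝ} (hε : ε ≤ 1) (hz : ‖z - 1‖ ≤ ε) (m : ℕ) :
    ‖z ^ m - 1‖ ≤ m * 2 ^ m * ε := by
  have hz2 : ‖z‖ ≤ 2 := by
    have := norm_add_le (z - 1) 1
    rw [sub_add_cancel, norm_one] at this
    linarith
  rw [← mul_geom_sum, norm_mul, mul_comm]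
  refine mul_le_mul ?_ hz (norm_nonneg _) (by positivity)
  calc ‖∑ i ∈ Finset.range m, z ^ i‖ ≤ ∑ i ∈ Finset.range m, (2 : ℝ) ^ m := by
        refine norm_sum_le_of_le _ fun i hi => ?_
        rw [norm_pow]
        exact (pow_le_pow_left₀ (norm_nonneg _) hz2 i).trans
          (pow_le_pow_right₀ (by norm_num) (Finset.mem_range.1 hi).le)
    _ = m * 2 ^ m := by simp

/-- Asymptotic evaluation of the sieve sum when no prime is exceptional, and upper bound in terms
of the exceptional primes in general. -/
theorem exists_sieveSum_asymptotics {χ : ℝ → ℝ} (hχ : IsSmoothCutoff χ) (m : ℕ) :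
    ∃ C : ℝ, 1 ≤ C ∧ ∃ w₀ : ℕ, 1 ≤ w₀ ∧ ∀ w : ℕ, w₀ ≤ w →
      ∀ᶠ Λ : ℝ in atTop, ∀ᶠ Y : ℕ in atTop, ∀ a : ℕ → Finset (Fin m) → ℝ,
        IsLocalDensity (sievePrimes w Y) a →
        (∀ B : Finset ℕ, (∀ p ∈ sievePrimes w Y, p ∉ B → ∀ S : Finset (Fin m), 2 ≤ S.card →
            |a p S| ≤ 1 / (p : ℝ) ^ 2) →
          |(totDensity w * Λ) ^ m * sieveSum χ Λ (sievePrimes w Y) a| ≤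
            C * ∏ p ∈ (sievePrimes w Y).filter (· ∈ B), (1 + C / p)) ∧
        ((∀ p ∈ sievePrimes w Y, ∀ S : Finset (Fin m), 2 ≤ S.card →
            |a p S| ≤ 1 / (p : ℝ) ^ 2) →
          |(totDensity w * Λ) ^ m * sieveSum χ Λ (sievePrimes w Y) a - 1| ≤ C / w) := by
  obtain ⟨C₁, hC₁, hker⟩ := exists_kernel_asymptotics hχ
  set K := localConst m with hK
  have hK0 : 98 ≤ K := two_le_localConst m
  set C := C₁ ^ m * Real.exp (2 * K) * (2 * K) + m * 2 ^ m + K with hC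
  have hC₁m : 1 ≤ C₁ ^ m := one_le_pow₀ hC₁
  have hexp1 : 1 ≤ Real.exp (2 * K) := Real.one_le_exp (by linarith)
  have hCK : K ≤ C := by
    rw [hC]
    have : 0 ≤ C₁ ^ m * Real.exp (2 * K) * (2 * K) + m * 2 ^ m := by positivity
    linarith
  have hCexp : C₁ ^ m * Real.exp (2 * K) ≤ C := by
    rw [hC]
    have h1 : 0 ≤ C₁ ^ m * Real.exp (2 * K) := by positivity
    have h2 : (0 : ℝ) ≤ m * 2 ^ m := by positivity
    nlinarith
  -- Taking `w ≥ localConst m` puts every prime of the product in the range of `exists_localSum_eq`.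
  refine ⟨C, by linarith, max 1 ⌈K⌉₊, le_max_left _ _, fun w hw => ?_⟩
  have hw1 : 1 ≤ w := (le_max_left _ _).trans hw
  have hwK : K ≤ w := (Nat.le_ceil K).trans (by exact_mod_cast (le_max_right _ _).trans hw)
  have hw0 : (1 : ℝ) ≤ w := by exact_mod_cast hw1
  filter_upwards [hker w (1 / w) (by positivity), eventually_gt_atTop 0] with Λ hΛY hΛ
  -- The densities enter after `Λ` and `Y`, so the thresholds do not depend on them; this later
  -- gives uniformity in the forms, their constants and the point `x`.
  filter_upwards [hΛY] with Y hY a ha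
  obtain ⟨hY1, hY2⟩ := hY
  set P := sievePrimes w Y with hPdef
  have hP : ∀ p ∈ P, p.Prime := fun p hp => (mem_sievePrimes.1 hp).1
  have hPK : ∀ p ∈ P, K ≤ p := fun p hp => hwK.trans
    (by exact_mod_cast (mem_sievePrimes.1 hp).2.1.le)
  have hPpos : ∀ p ∈ P, (0 : ℝ) < p := fun p hp => by linarith [hPK p hp]
  set g : ℝ × ℝ → ℂ := fun q => density χ q.1 * density χ q.2 * kernel w Y Λ q with hg
  set Ψ : (Fin m → ℝ × ℝ) → ℂ := fun q => (∏ i, (density χ (q i).1 * density χ (q i).2)) *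
      ∏ p ∈ P, localSum (a p) (fun i => primeTerm Λ p (q i).1)
        (fun i => primeTerm Λ p (q i).2) with hΨ
  obtain ⟨hΨint, hΨeq⟩ := sieveSum_eq_integral hχ hΛ hP a
  have hgint : Integrable g := integrable_density_kernel hχ w Y hΛ
  have hGint : Integrable (fun q : Fin m → ℝ × ℝ => ∏ i, g (q i)) :=
    Integrable.fintype_prod fun _ => hgint
  have hGnint : Integrable (fun q : Fin m → ℝ × ℝ => ∏ i, ‖g (q i)‖) :=
    Integrable.fintype_prod fun _ => hgint.norm
  have hGn : ∫ q : Fin m → ℝ × ℝ, ∏ i, ‖g (q i)‖ ≤ C₁ ^ m := by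
    rw [integral_fintype_prod_volume_eq_pow (fun q => ‖g q‖), Fintype.card_fin]
    exact pow_le_pow_left₀ (integral_nonneg fun _ => norm_nonneg _) hY2 m
  -- the pointwise comparison of the two integrands
  have hlocal : ∀ p ∈ P, ∀ q : Fin m → ℝ × ℝ, ∃ δ : ℂ,
      localSum (a p) (fun i => primeTerm Λ p (q i).1) (fun i => primeTerm Λ p (q i).2) =
        (∏ i, localModel p (primeTerm Λ p (q i).1) (primeTerm Λ p (q i).2)) * (1 + δ) ∧
      ‖δ‖ ≤ K / p ∧ ((∀ S : Finset (Fin m), 2 ≤ S.card → |a p S| ≤ 1 / (p : ℝ) ^ 2) →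
        ‖δ‖ ≤ K / (p : ℝ) ^ 2) := fun p hp q =>
    exists_localSum_eq (hPK p hp) (fun i => norm_primeTerm_le hΛ (hP p hp) _)
      (fun i => norm_primeTerm_le hΛ (hP p hp) _) (ha.empty p hp) (ha.singleton p hp)
      (ha.bound p hp)
  choose! δ hδ1 hδ2 hδ3 using hlocal
  have hpoint : ∀ q : Fin m → ℝ × ℝ, ((totDensity w * Λ : ℝ) : ℂ) ^ m * Ψ q =
      (∏ i, g (q i)) * ∏ p ∈ P, (1 + δ p q) := by
    intro q
    simp only [hg, hΨ]
    rw [Finset.prod_congr rfl fun p hp => hδ1 p hp q]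
    have h1 : ∏ i, (density χ (q i).1 * density χ (q i).2 * kernel w Y Λ (q i)) =
        (∏ i, (density χ (q i).1 * density χ (q i).2)) * (((totDensity w * Λ : ℝ) : ℂ) ^ m *
          ∏ p ∈ P, ∏ i, localModel p (primeTerm Λ p (q i).1) (primeTerm Λ p (q i).2)) := by
      simp_rw [kernel_eq_prod_localModel]
      rw [Finset.prod_mul_distrib, Finset.prod_comm (s := P)]
      congr 1
      rw [Finset.prod_mul_distrib, Finset.prod_const, Finset.card_univ, Fintype.card_fin]
    rw [h1, Finset.prod_mul_distrib (s := P)]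
    ring
  have hcast : (((totDensity w * Λ) ^ m * sieveSum χ Λ P a : ℝ) : ℂ) =
      ∫ q, ((totDensity w * Λ : ℝ) : ℂ) ^ m * Ψ q := by
    rw [integral_const_mul, ofReal_mul, ofReal_pow, hΨeq]
  have hS2 : ∑ p ∈ P, K / (p : ℝ) ^ 2 ≤ 2 * K / w := by
    have := sum_inv_sq_sievePrimes_le hw1 Y
    calc ∑ p ∈ P, K / (p : ℝ) ^ 2 = K * ∑ p ∈ P, (1 : ℝ) / (p : ℝ) ^ 2 := by
          rw [Finset.mul_sum]; exact Finset.sum_congr rfl fun _ _ => by ring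
      _ ≤ K * (2 / w) := by gcongr
      _ = _ := by ring
  have hS2' : 2 * K / w ≤ 2 * K := div_le_self (by linarith) hw0
  constructor
  · intro B hB
    rw [← Real.norm_eq_abs, ← norm_real, hcast]
    have hbound : ∀ q, ‖((totDensity w * Λ : ℝ) : ℂ) ^ m * Ψ q‖ ≤
        (∏ i, ‖g (q i)‖) * (Real.exp (2 * K) * ∏ p ∈ P.filter (· ∈ B), (1 + C / p)) := by
      intro q
      rw [hpoint, norm_mul, norm_prod, norm_prod]
      refine mul_le_mul_of_nonneg_left ?_ (Finset.prod_nonneg fun _ _ => norm_nonneg _)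
      have h1 : ∀ p, ‖1 + δ p q‖ ≤ 1 + ‖δ p q‖ := fun p => by
        have := norm_add_le (1 : ℂ) (δ p q)
        rwa [norm_one] at this
      rw [← Finset.prod_filter_mul_prod_filter_not P (· ∈ B), mul_comm]
      refine mul_le_mul ?_ ?_ (Finset.prod_nonneg fun _ _ => norm_nonneg _) (Real.exp_pos _).le
      -- Outside `B` the corrections are `O(1/p²)` and their product is bounded; only primes of `B`
      -- cost a factor `1 + C/p`.
      · calc ∏ p ∈ P.filter (¬ · ∈ B), ‖1 + δ p q‖
            ≤ ∏ p ∈ P.filter (¬ · ∈ B), Real.exp (K / (p : ℝ) ^ 2) := by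
              refine Finset.prod_le_prod (fun _ _ => norm_nonneg _) fun p hp => ?_
              obtain ⟨hpP, hpB⟩ := Finset.mem_filter.1 hp
              refine (h1 p).trans ((add_comm _ _).trans_le (Real.add_one_le_exp _) |>.trans ?_)
              exact Real.exp_le_exp.2 (hδ3 p hpP q (hB p hpP hpB))
          _ = Real.exp (∑ p ∈ P.filter (¬ · ∈ B), K / (p : ℝ) ^ 2) := (Real.exp_sum _ _).symm
          _ ≤ Real.exp (2 * K) := by
              refine Real.exp_le_exp.2 (le_trans ?_ (hS2.trans hS2'))
              exact Finset.sum_le_sum_of_subset_of_nonneg (Finset.filter_subset _ _)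
                fun _ _ _ => by positivity
      · refine Finset.prod_le_prod (fun _ _ => norm_nonneg _) fun p hp => ?_
        have hpP := (Finset.mem_filter.1 hp).1
        have hp0 := hPpos p hpP
        refine (h1 p).trans ?_
        have := hδ2 p hpP q
        have h2 : K / p ≤ C / p := by gcongr
        linarith
    have hprod0 : 0 ≤ ∏ p ∈ P.filter (· ∈ B), (1 + C / (p : ℝ)) :=
      Finset.prod_nonneg fun p _ => by
        have : 0 ≤ C / (p : ℝ) := div_nonneg (by linarith) (Nat.cast_nonneg p)
        linarith
    calc _ ≤ ∫ q : Fin m → ℝ × ℝ,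
          (∏ i, ‖g (q i)‖) * (Real.exp (2 * K) * ∏ p ∈ P.filter (· ∈ B), (1 + C / p)) :=
          norm_integral_le_of_norm_le (hGnint.mul_const _) (Eventually.of_forall hbound)
      _ ≤ C₁ ^ m * (Real.exp (2 * K) * ∏ p ∈ P.filter (· ∈ B), (1 + C / p)) := by
          rw [integral_mul_const]; gcongr
      _ ≤ C * ∏ p ∈ P.filter (· ∈ B), (1 + C / p) := by
          rw [← mul_assoc]; gcongr
  · intro hgood
    have hGeq : ∫ q : Fin m → ℝ × ℝ, ∏ i, g (q i) = (∫ q, g q) ^ m := by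
      rw [integral_fintype_prod_volume_eq_pow, Fintype.card_fin]
    have hI : ‖(∫ q, g q) ^ m - 1‖ ≤ m * 2 ^ m * (1 / w) :=
      abs_pow_sub_one_le ((div_le_one (by linarith)).2 hw0) hY1 m
    have hbound : ∀ q, ‖((totDensity w * Λ : ℝ) : ℂ) ^ m * Ψ q - ∏ i, g (q i)‖ ≤
        (∏ i, ‖g (q i)‖) * (Real.exp (2 * K) * (2 * K) / w) := by
      intro q
      rw [hpoint, ← mul_sub_one, norm_mul, norm_prod]
      refine mul_le_mul_of_nonneg_left ?_ (Finset.prod_nonneg fun _ _ => norm_nonneg _)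
      refine (Finset.norm_prod_one_add_sub_one_le _ _).trans ?_
      have hx : ∑ p ∈ P, ‖δ p q‖ ≤ 2 * K / w :=
        (Finset.sum_le_sum fun p hp => hδ3 p hp q (hgood p hp)).trans hS2
      set x := ∑ p ∈ P, ‖δ p q‖
      have hx0 : 0 ≤ x := Finset.sum_nonneg fun _ _ => norm_nonneg _
      -- The product of the corrections differs from `1` by at most `e^x - 1`, where `x` is a tail
      -- of `∑ K/p²`, hence `O(1/w)`.
      have h3 : Real.exp x - 1 ≤ x * Real.exp x := by
        have h4 := Real.add_one_le_exp (-x)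
        have h5 : Real.exp (-x) * Real.exp x = 1 := by rw [← Real.exp_add]; simp
        nlinarith [Real.exp_pos x]
      calc Real.exp x - 1 ≤ x * Real.exp x := h3
        _ ≤ (2 * K / w) * Real.exp (2 * K) := by
            gcongr
            exact hx.trans hS2'
        _ = _ := by ring
    rw [← Real.norm_eq_abs, ← norm_real, ofReal_sub, hcast, ofReal_one]
    have hint1 : Integrable (fun q => ((totDensity w * Λ : ℝ) : ℂ) ^ m * Ψ q) :=
      hΨint.const_mul _
    have h6 : ‖(∫ q, ((totDensity w * Λ : ℝ) : ℂ) ^ m * Ψ q) - (∫ q, g q) ^ m‖ ≤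
        C₁ ^ m * (Real.exp (2 * K) * (2 * K) / w) := by
      rw [← hGeq, ← integral_sub hint1 hGint]
      refine (norm_integral_le_of_norm_le (hGnint.mul_const _)
        (Eventually.of_forall hbound)).trans ?_
      rw [integral_mul_const]
      gcongr
    calc _ = ‖((∫ q, ((totDensity w * Λ : ℝ) : ℂ) ^ m * Ψ q) - (∫ q, g q) ^ m) +
          ((∫ q, g q) ^ m - 1)‖ := by congr 1; ring
      _ ≤ C₁ ^ m * (Real.exp (2 * K) * (2 * K) / w) + m * 2 ^ m * (1 / w) :=
          (norm_add_le _ _).trans (add_le_add h6 hI)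
      _ = (C₁ ^ m * Real.exp (2 * K) * (2 * K) + m * 2 ^ m) / w := by ring
      _ ≤ C / w := by
          gcongr
          rw [hC]; linarith

end PrimeWeight

namespace PrimeWeight

open Finset

/-! ### Averages over finite groups -/

/-- A map that can realise every translation of its target carries the uniform distribution to the
uniform distribution: average over the translation `s` and exchange the means. The lift `d` need not
be additive. -/
theorem expect_comp_eq {X V : Type*} [AddCommGroup X] [Fintype X] [AddCommGroup V] [Fintype V]
    (ψ : X → V) (d : V → X) (h : ∀ x s, ψ (x + d s) = ψ x + s) (g : V → ℝ) :
    𝔼 x, g (ψ x) = 𝔼 v, g v := by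
  have h1 : ∀ s : V, 𝔼 x, g (ψ x) = 𝔼 x, g (ψ x + s) := by
    intro s
    rw [← Fintype.expect_equiv (Equiv.addRight (d s)) (fun x => g (ψ x + s)) (fun x => g (ψ x))]
    intro x
    simp [h]
  have h2 : 𝔼 _s : V, 𝔼 x, g (ψ x) = 𝔼 s : V, 𝔼 x, g (ψ x + s) :=
    Finset.expect_congr rfl fun s _ => h1 s
  rw [Finset.expect_const univ_nonempty, Finset.expect_comm] at h2
  rw [h2]
  have h3 : ∀ x : X, 𝔼 s : V, g (ψ x + s) = 𝔼 v, g v := fun x =>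
    Fintype.expect_equiv (Equiv.addLeft (ψ x)) _ _ fun _ => rfl
  rw [Finset.expect_congr rfl fun x _ => h3 x, Finset.expect_const univ_nonempty]

theorem expect_affine_form {p : ℕ} [Fact p.Prime] {t : ℕ} (c : ZMod p) (A : Fin t → ZMod p)
    {j : Fin t} (hj : A j ≠ 0) (g : ZMod p → ℝ) :
    𝔼 x : Fin t → ZMod p, g (c + ∑ k, A k * x k) = 𝔼 v, g v := by
  refine expect_comp_eq (fun x : Fin t → ZMod p => c + ∑ k, A k * x k)
    (fun s => Pi.single j ((A j)⁻¹ * s)) (fun x s => ?_) g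
  simp only [Pi.add_apply, mul_add, Finset.sum_add_distrib, Pi.single_apply, mul_ite, mul_zero,
    Finset.sum_ite_eq', Finset.mem_univ, if_true, mul_inv_cancel_left₀ hj]
  ring

/-- Cramer's rule on the coordinates `j`, `k` realises any translation of the pair of values; the
case `j = k` is excluded by the minor being nonzero. -/
theorem expect_affine_pair {p : ℕ} [Fact p.Prime] {t : ℕ} (c c' : ZMod p)
    (A A' : Fin t → ZMod p) {j k : Fin t} (hjk : A j * A' k - A k * A' j ≠ 0)
    (g : ZMod p × ZMod p → ℝ) :
    𝔼 x : Fin t → ZMod p, g (c + ∑ l, A l * x l, c' + ∑ l, A' l * x l) = 𝔼 v, g v := by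
  set D := A j * A' k - A k * A' j with hD
  refine expect_comp_eq (fun x : Fin t → ZMod p => (c + ∑ l, A l * x l, c' + ∑ l, A' l * x l))
    (fun s => Pi.single j (D⁻¹ * (A' k * s.1 - A k * s.2)) +
      Pi.single k (D⁻¹ * (A j * s.2 - A' j * s.1))) (fun x s => ?_) g
  have hs : ∀ B : Fin t → ZMod p, ∑ l, B l * (x + (Pi.single j (D⁻¹ * (A' k * s.1 - A k * s.2)) +
      Pi.single k (D⁻¹ * (A j * s.2 - A' j * s.1))) : Fin t → ZMod p) l =
      ∑ l, B l * x l + (B j * (D⁻¹ * (A' k * s.1 - A k * s.2)) +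
        B k * (D⁻¹ * (A j * s.2 - A' j * s.1))) := by
    intro B
    simp only [Pi.add_apply, mul_add, Finset.sum_add_distrib, Pi.single_apply, mul_ite, mul_zero,
      Finset.sum_ite_eq', Finset.mem_univ, if_true]
  have e1 : A j * (D⁻¹ * (A' k * s.1 - A k * s.2)) + A k * (D⁻¹ * (A j * s.2 - A' j * s.1)) =
      s.1 := by
    calc _ = D⁻¹ * D * s.1 := by rw [hD]; ring
      _ = s.1 := by rw [inv_mul_cancel₀ hjk, one_mul]
  have e2 : A' j * (D⁻¹ * (A' k * s.1 - A k * s.2)) + A' k * (D⁻¹ * (A j * s.2 - A' j * s.1)) =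
      s.2 := by
    calc _ = D⁻¹ * D * s.2 := by rw [hD]; ring
      _ = s.2 := by rw [inv_mul_cancel₀ hjk, one_mul]
  ext
  · simp only [hs, e1, Prod.fst_add]; ring
  · simp only [hs, e2, Prod.snd_add]; ring

/-! ### The Chinese remainder theorem for averages over boxes -/

/-- The box `{0, …, n - 1}^t`. -/
def box (t n : ℕ) : Finset (Fin t → ℕ) := Fintype.piFinset fun _ => range n

theorem mem_box {t n : ℕ} {y : Fin t → ℕ} : y ∈ box t n ↔ ∀ j, y j < n := by
  simp [box]

theorem box_nonempty (t : ℕ) {n : ℕ} (hn : 0 < n) : (box t n).Nonempty :=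
  ⟨fun _ => 0, mem_box.2 fun _ => hn⟩

/-- A function on `ℕ^t` that only depends on the residues modulo `n`. -/
def IsPeriodic {t : ℕ} (n : ℕ) (f : (Fin t → ℕ) → ℝ) : Prop :=
  ∀ y y' : Fin t → ℕ, (∀ j, y j ≡ y' j [MOD n]) → f y = f y'

theorem expect_box_mul {t a b : ℕ} (ha : 0 < a) (hb : 0 < b) (hab : a.Coprime b)
    {f g : (Fin t → ℕ) → ℝ} (hf : IsPeriodic a f) (hg : IsPeriodic b g) :
    𝔼 y ∈ box t (a * b), f y * g y = (𝔼 y ∈ box t a, f y) * 𝔼 y ∈ box t b, g y := by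
  rw [Finset.expect_mul_expect, ← Finset.expect_product']
  refine Finset.expect_nbij (fun y => (fun j => y j % a, fun j => y j % b)) ?_ ?_ ?_ ?_
  · intro y _
    exact mem_product.2 ⟨mem_box.2 fun j => Nat.mod_lt _ ha, mem_box.2 fun j => Nat.mod_lt _ hb⟩
  · intro y _
    rw [hf y _ fun j => (Nat.mod_modEq _ _).symm, hg y _ fun j => (Nat.mod_modEq _ _).symm]
  · intro y hy y' hy' h
    have h1 := congrArg Prod.fst h
    have h2 := congrArg Prod.snd h
    funext j
    have h3 : y j ≡ y' j [MOD a * b] :=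
      (Nat.modEq_and_modEq_iff_modEq_mul hab).1 ⟨congrFun h1 j, congrFun h2 j⟩
    exact Nat.ModEq.eq_of_lt_of_lt h3 (mem_box.1 hy j) (mem_box.1 hy' j)
  · rintro ⟨u, v⟩ huv
    have huv' := mem_product.1 (mem_coe.1 huv)
    refine ⟨fun j => Nat.chineseRemainder hab (u j) (v j), mem_coe.2 (mem_box.2 fun j =>
      Nat.chineseRemainder_lt_mul hab _ _ ha.ne' hb.ne'), ?_⟩
    have h1 := fun j => (Nat.chineseRemainder hab (u j) (v j)).2.1
    have h2 := fun j => (Nat.chineseRemainder hab (u j) (v j)).2.2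
    ext j
    · exact Nat.mod_eq_of_modEq (h1 j) (mem_box.1 huv'.1 j)
    · exact Nat.mod_eq_of_modEq (h2 j) (mem_box.1 huv'.2 j)

theorem expect_box_prod {t : ℕ} (P : Finset ℕ) (hP : ∀ p ∈ P, p.Prime)
    (f : ℕ → (Fin t → ℕ) → ℝ) (hf : ∀ p ∈ P, IsPeriodic p (f p)) :
    𝔼 y ∈ box t (∏ p ∈ P, p), ∏ p ∈ P, f p y = ∏ p ∈ P, 𝔼 y ∈ box t p, f p y := by
  induction P using Finset.induction with
  | empty => simp [Finset.expect_const (box_nonempty t one_pos)]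
  | insert q P hq ih =>
    have hP' : ∀ p ∈ P, p.Prime := fun p hp => hP p (mem_insert_of_mem hp)
    have hqp := hP q (mem_insert_self q P)
    have hcop : Nat.Coprime q (∏ p ∈ P, p) :=
      Nat.Coprime.prod_right fun p hp => (Nat.coprime_primes hqp (hP' p hp)).2 (by
        rintro rfl; exact hq hp)
    rw [Finset.prod_insert hq, Finset.prod_insert hq, ← ih hP' fun p hp =>
      hf p (mem_insert_of_mem hp), ← expect_box_mul hqp.pos
        (Finset.prod_pos fun p hp => (hP' p hp).pos) hcop (hf q (mem_insert_self q P))]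
    · exact Finset.expect_congr rfl fun y _ => Finset.prod_insert hq
    · intro y y' h
      refine Finset.prod_congr rfl fun p hp => hf p (mem_insert_of_mem hp) y y' fun j => ?_
      exact (h j).of_dvd (dvd_prod_of_mem _ hp)

theorem expect_box_eq_expect_zmod {p : ℕ} [NeZero p] {t : ℕ} (g : (Fin t → ZMod p) → ℝ) :
    𝔼 y ∈ box t p, g (fun j => (y j : ZMod p)) = 𝔼 y : Fin t → ZMod p, g y := by
  refine Finset.expect_nbij' (fun y j => (y j : ZMod p)) (fun y j => (y j).val) ?_ ?_ ?_ ?_ ?_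
  · intro y _; exact mem_univ _
  · intro y _; exact mem_box.2 fun j => ZMod.val_lt _
  · intro y hy
    funext j
    exact ZMod.val_cast_of_lt (mem_box.1 hy j)
  · intro y _
    funext j
    exact ZMod.natCast_zmod_val _
  · intro y _; rfl

/-! ### Local densities of affine forms -/

/-- The density of the residues `y` modulo `p` such that `p` divides `W (v_i + A_i · y) + b` for
all `i ∈ S`. -/
noncomputable def formDensity {m t : ℕ} (W b : ℕ) (A : Fin m → Fin t → ℤ) (v : Fin m → ℤ) (p : ℕ)
    (S : Finset (Fin m)) : ℝ :=
  𝔼 y ∈ box t p, if ∀ i ∈ S, (p : ℤ) ∣ W * (v i + ∑ j, A i j * y j) + b then 1 else 0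

theorem formDensity_empty {m t : ℕ} (W b : ℕ) (A : Fin m → Fin t → ℤ) (v : Fin m → ℤ) {p : ℕ}
    (hp : 0 < p) : formDensity W b A v p ∅ = 1 := by
  simp [formDensity, Finset.expect_const (box_nonempty t hp)]

theorem formDensity_nonneg {m t : ℕ} (W b : ℕ) (A : Fin m → Fin t → ℤ) (v : Fin m → ℤ) (p : ℕ)
    (S : Finset (Fin m)) : 0 ≤ formDensity W b A v p S :=
  Finset.expect_nonneg fun y _ => by split_ifs <;> norm_num

theorem formDensity_anti {m t : ℕ} (W b : ℕ) (A : Fin m → Fin t → ℤ) (v : Fin m → ℤ) (p : ℕ)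
    {S T : Finset (Fin m)} (h : S ⊆ T) : formDensity W b A v p T ≤ formDensity W b A v p S := by
  refine Finset.expect_le_expect fun y _ => ?_
  split_ifs with h1 h2 h2
  · exact le_rfl
  · exact absurd (fun i hi => h1 i (h hi)) h2
  · norm_num
  · exact le_rfl

theorem formDensity_eq_expect_zmod {m t : ℕ} (W b : ℕ) (A : Fin m → Fin t → ℤ) (v : Fin m → ℤ)
    (p : ℕ) [NeZero p] (S : Finset (Fin m)) :
    formDensity W b A v p S = 𝔼 y : Fin t → ZMod p,
      if ∀ i ∈ S, ((W * v i + b : ℤ) : ZMod p) + ∑ j, ((W * A i j : ℤ) : ZMod p) * y j = 0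
        then 1 else 0 := by
  rw [← expect_box_eq_expect_zmod, formDensity]
  refine Finset.expect_congr rfl fun y _ => if_congr (forall₂_congr fun i _ => ?_) rfl rfl
  rw [← ZMod.intCast_zmod_eq_zero_iff_dvd]
  refine Eq.congr ?_ rfl
  push_cast
  rw [mul_add, Finset.mul_sum]
  simp_rw [mul_assoc]
  ring

theorem formDensity_singleton {m t : ℕ} {W b : ℕ} {A : Fin m → Fin t → ℤ} {v : Fin m → ℤ}
    {p : ℕ} (hp : p.Prime) (hW : ¬ p ∣ W) {i : Fin m} {j : Fin t} (hA : ¬ (p : ℤ) ∣ A i j) :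
    formDensity W b A v p {i} = 1 / p := by
  have : Fact p.Prime := ⟨hp⟩
  rw [formDensity_eq_expect_zmod]
  simp only [mem_singleton, forall_eq]
  have hne : ((W * A i j : ℤ) : ZMod p) ≠ 0 := by
    rw [Ne, ZMod.intCast_zmod_eq_zero_iff_dvd]
    intro h
    rcases (Nat.prime_iff_prime_int.1 hp).dvd_or_dvd h with h | h
    · exact hW (by exact_mod_cast h)
    · exact hA h
  rw [expect_affine_form _ _ hne (fun z => if z = 0 then 1 else 0)]
  rw [Fintype.expect_eq_sum_div_card]
  simp

/-- Two forms with a minor invertible modulo `p` are jointly equidistributed on `(ℤ/p)²`, and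
scaling by `W` keeps the minor invertible. The remaining conditions in `S` only decrease the
density. -/
theorem formDensity_pair_le {m t : ℕ} {W b : ℕ} {A : Fin m → Fin t → ℤ} {v : Fin m → ℤ}
    {p : ℕ} (hp : p.Prime) (hW : ¬ p ∣ W) {S : Finset (Fin m)} {i i' : Fin m} (hi : i ∈ S)
    (hi' : i' ∈ S) {j k : Fin t} (hA : ¬ (p : ℤ) ∣ A i j * A i' k - A i k * A i' j) :
    formDensity W b A v p S ≤ 1 / (p : ℝ) ^ 2 := by
  have : Fact p.Prime := ⟨hp⟩
  have hsub : ({i, i'} : Finset (Fin m)) ⊆ S := by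
    intro x hx
    simp only [mem_insert, mem_singleton] at hx
    rcases hx with rfl | rfl <;> assumption
  refine (formDensity_anti W b A v p hsub).trans (le_of_eq ?_)
  rw [formDensity_eq_expect_zmod]
  simp only [mem_insert, mem_singleton, forall_eq_or_imp, forall_eq]
  have hW' : (W : ZMod p) ≠ 0 := by rwa [Ne, ZMod.natCast_eq_zero_iff]
  have hne : ((W * A i j : ℤ) : ZMod p) * ((W * A i' k : ℤ) : ZMod p) -
      ((W * A i k : ℤ) : ZMod p) * ((W * A i' j : ℤ) : ZMod p) ≠ 0 := by
    have h1 : ((A i j * A i' k - A i k * A i' j : ℤ) : ZMod p) ≠ 0 := by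
      rwa [Ne, ZMod.intCast_zmod_eq_zero_iff_dvd]
    have h2 := mul_ne_zero (mul_ne_zero hW' hW') h1
    convert h2 using 1
    push_cast; ring
  have := expect_affine_pair ((W * v i + b : ℤ) : ZMod p) ((W * v i' + b : ℤ) : ZMod p)
    (fun j => ((W * A i j : ℤ) : ZMod p)) (fun j => ((W * A i' j : ℤ) : ZMod p)) hne
    (fun z => if z.1 = 0 ∧ z.2 = 0 then 1 else 0)
  rw [this, Fintype.expect_eq_sum_div_card]
  have h0 : ∀ z : ZMod p × ZMod p, (z.1 = 0 ∧ z.2 = 0) ↔ z = 0 := fun z => by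
    rw [Prod.ext_iff]; rfl
  simp only [h0, Finset.sum_ite_eq', mem_univ, if_true, Fintype.card_prod, ZMod.card]
  push_cast
  rw [sq]

end PrimeWeight

/-! ### Transfer from means modulo `N` to local densities. -/

namespace PrimeWeight

open Finset

theorem abs_expect_sub_le {X : Type*} [Fintype X] (f g h : X → ℝ) (hfg : ∀ x, |f x - g x| ≤ h x) :
    |𝔼 x, f x - 𝔼 x, g x| ≤ 𝔼 x, h x := by
  rw [← Finset.expect_sub_distrib]
  exact (Finset.abs_expect_le _ _).trans (Finset.expect_le_expect fun x _ => hfg x)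

theorem isPeriodic_indicator {m t : ℕ} (W b : ℕ) (A : Fin m → Fin t → ℤ) (v : Fin m → ℤ) (p : ℕ)
    (S : Finset (Fin m)) : IsPeriodic p fun y : Fin t → ℕ =>
      if ∀ i ∈ S, (p : ℤ) ∣ W * (v i + ∑ j, A i j * y j) + b then (1 : ℝ) else 0 := by
  intro y y' h
  refine if_congr (forall₂_congr fun i _ => ?_) rfl rfl
  rw [← ZMod.intCast_zmod_eq_zero_iff_dvd, ← ZMod.intCast_zmod_eq_zero_iff_dvd]
  push_cast
  have : ∀ j, (y j : ZMod p) = y' j := fun j => (ZMod.natCast_eq_natCast_iff _ _ _).2 (h j)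
  simp_rw [this]

/-- The value in `ℤ/N` of the `i`-th affine form. -/
def formValue {N m t : ℕ} (A : Fin m → Fin t → ℤ) (c : Fin m → ZMod N) (x : Fin t → ZMod N)
    (i : Fin m) : ZMod N := c i + ∑ j, (A i j : ZMod N) * x j

theorem expect_box_indicator {m t : ℕ} (W b : ℕ) (A : Fin m → Fin t → ℤ) (v : Fin m → ℤ)
    {P : Finset ℕ} (hP : ∀ p ∈ P, p.Prime) (G : Fin m → Finset ℕ) (hG : ∀ i, G i ⊆ P) :
    𝔼 y ∈ box t (∏ p ∈ univ.biUnion G, p),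
      (if ∀ i, ∀ p ∈ G i, (p : ℤ) ∣ W * (v i + ∑ j, A i j * y j) + b then (1 : ℝ) else 0) =
    ∏ p ∈ P, formDensity W b A v p (univ.filter fun i => p ∈ G i) := by
  have hsub : univ.biUnion G ⊆ P := Finset.biUnion_subset.2 fun i _ => hG i
  rw [← Finset.prod_subset hsub]
  · rw [show (∏ p ∈ univ.biUnion G, formDensity W b A v p (univ.filter fun i => p ∈ G i)) = _ from
      (expect_box_prod (univ.biUnion G) (fun p hp => hP p (hsub hp)) _
        fun p _ => isPeriodic_indicator W b A v p (univ.filter fun i => p ∈ G i)).symm]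
    refine Finset.expect_congr rfl fun y _ => ?_
    rw [Finset.prod_ite_zero, Finset.prod_const_one]
    refine if_congr ?_ rfl rfl
    simp only [mem_biUnion, mem_univ, true_and, mem_filter, forall_exists_index]
    exact ⟨fun h p i _ i' hp' => h i' p hp', fun h i p hp => h p i hp i hp⟩
  · intro p hp hpn
    have : (univ.filter fun i => p ∈ G i) = ∅ := by
      refine Finset.filter_eq_empty_iff.2 fun i _ h => hpn ?_
      exact mem_biUnion.2 ⟨i, mem_univ _, h⟩
    rw [this, formDensity_empty W b A v (hP p hp).pos]

theorem card_near_boundary_le {N : ℕ} [NeZero N] (H : ℕ) :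
    #(univ.filter fun v : ZMod N => v.val < H ∨ N ≤ v.val + H) ≤ 2 * H := by
  have h1 : #(univ.filter fun v : ZMod N => v.val < H ∨ N ≤ v.val + H) ≤
      #(range H ∪ Finset.Ico (N - H) N) := by
    refine Finset.card_le_card_of_injOn ZMod.val ?_ ((ZMod.val_injective N).injOn)
    intro v hv
    have hv' := (mem_filter.1 hv).2
    have := ZMod.val_lt v
    simp only [coe_union, Set.mem_union, mem_coe, mem_range, mem_Ico]
    omega
  refine h1.trans ((card_union_le _ _).trans ?_)
  rw [card_range, Nat.card_Ico]
  omega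

/-- The mean is unchanged by a further average of `x` over translates in a box of side `M`. A form
value moves by at most `H = tLM`; if all values stay `H` away from `0` and `N`, there is no
wraparound modulo `N` and the box average equals the product of densities exactly. Each form is
equidistributed modulo `N`, so a union bound controls the remaining points. -/
theorem abs_expect_indicator_sub_le {N : ℕ} [Fact N.Prime] {m t L : ℕ} (W b : ℕ)
    {A : Fin m → Fin t → ℤ} (hAL : ∀ i j, |A i j| ≤ L) (hA : ∀ i, ∃ j, (A i j : ZMod N) ≠ 0)
    (c : Fin m → ZMod N) {P : Finset ℕ} (hP : ∀ p ∈ P, p.Prime) (G : Fin m → Finset ℕ)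
    (hG : ∀ i, G i ⊆ P) :
    |(𝔼 x : Fin t → ZMod N,
        if ∀ i, ∀ p ∈ G i, p ∣ W * (formValue A c x i).val + b then (1 : ℝ) else 0) -
      𝔼 x : Fin t → ZMod N, ∏ p ∈ P,
        formDensity W b A (fun i => (formValue A c x i).val) p (univ.filter fun i => p ∈ G i)| ≤
      2 * m * (t * L * ∏ p ∈ univ.biUnion G, p : ℕ) / N := by
  have hN : 0 < N := (Fact.out : N.Prime).pos
  set M := ∏ p ∈ univ.biUnion G, p with hM
  set H := t * L * M with hH
  have hM0 : 0 < M := Finset.prod_pos fun p hp => by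
    obtain ⟨i, _, hi⟩ := mem_biUnion.1 hp
    exact (hP p (hG i hi)).pos
  set F : (Fin t → ZMod N) → ℝ := fun x =>
    if ∀ i, ∀ p ∈ G i, p ∣ W * (formValue A c x i).val + b then 1 else 0 with hF
  have htrans : 𝔼 x, F x =
      𝔼 x, 𝔼 y ∈ box t M, F (x + fun j => (y j : ZMod N)) := by
    rw [Finset.expect_comm]
    have : ∀ y ∈ box t M, 𝔼 x, F (x + fun j => (y j : ZMod N)) = 𝔼 x, F x := fun y _ =>
      Fintype.expect_equiv (Equiv.addRight fun j => (y j : ZMod N)) _ _ fun _ => rfl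
    rw [Finset.expect_congr rfl this, Finset.expect_const (box_nonempty t hM0)]
  have hF01 : ∀ x, 0 ≤ F x ∧ F x ≤ 1 := fun x => by
    simp only [hF]; split_ifs <;> norm_num
  set bad : (Fin t → ZMod N) → Fin m → ℝ := fun x i =>
    if (formValue A c x i).val < H ∨ N ≤ (formValue A c x i).val + H then 1 else 0 with hbad
  have hbad0 : ∀ x i, 0 ≤ bad x i := fun x i => by
    simp only [hbad]; split_ifs <;> norm_num
  have hpoint : ∀ x, |(𝔼 y ∈ box t M, F (x + fun j => (y j : ZMod N))) - ∏ p ∈ P,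
        formDensity W b A (fun i => (formValue A c x i).val) p (univ.filter fun i => p ∈ G i)| ≤
      ∑ i, bad x i := by
    intro x
    by_cases hx : ∃ i, (formValue A c x i).val < H ∨ N ≤ (formValue A c x i).val + H
    · obtain ⟨i, hi⟩ := hx
      have h1 : 1 ≤ ∑ i, bad x i := by
        refine le_trans ?_ (Finset.single_le_sum (fun i _ => hbad0 x i) (mem_univ i))
        simp only [hbad, if_pos hi, le_refl]
      refine le_trans (abs_sub_le_of_nonneg_of_le ?_ ?_ ?_ ?_) h1
      · exact Finset.expect_nonneg fun y _ => (hF01 _).1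
      · exact Finset.expect_le (box_nonempty t hM0) fun y _ => (hF01 _).2
      · exact Finset.prod_nonneg fun p _ => formDensity_nonneg _ _ _ _ _ _
      · refine Finset.prod_le_one (fun p _ => formDensity_nonneg _ _ _ _ _ _) fun p hp => ?_
        rw [← formDensity_empty W b A (fun i => (formValue A c x i).val) (hP p hp).pos]
        exact formDensity_anti _ _ _ _ _ (empty_subset _)
    · push Not at hx
      rw [← expect_box_indicator W b A _ hP G hG]
      have hval : ∀ y ∈ box t M, ∀ i,
          (((formValue A c (x + fun j => (y j : ZMod N)) i).val : ℕ) : ℤ) =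
            (formValue A c x i).val + ∑ j, A i j * y j := by
        intro y hy i
        have hy' := mem_box.1 hy
        have habs : |∑ j, A i j * (y j : ℤ)| ≤ H := by
          refine (Finset.abs_sum_le_sum_abs _ _).trans ?_
          calc ∑ j, |A i j * (y j : ℤ)| ≤ ∑ _j : Fin t, (L * M : ℤ) := by
                refine Finset.sum_le_sum fun j _ => ?_
                rw [abs_mul, Nat.abs_cast]
                have := hAL i j
                have := (hy' j).le
                gcongr
            _ = H := by
                rw [Finset.sum_const, card_univ, Fintype.card_fin, hH]
                push_cast; rw [nsmul_eq_mul]; ring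
        obtain ⟨hx1, hx2⟩ := hx i
        set k : ℤ := (formValue A c x i).val + ∑ j, A i j * y j with hk
        have h1 := abs_le.1 habs
        have hk0 : 0 ≤ k := by omega
        have hkN : k < N := by omega
        have hcast : formValue A c (x + fun j => (y j : ZMod N)) i = (k : ZMod N) := by
          rw [hk]
          push_cast
          rw [ZMod.natCast_zmod_val, formValue, formValue, add_assoc, ← Finset.sum_add_distrib]
          congr 1
          exact Finset.sum_congr rfl fun j _ => by rw [Pi.add_apply, mul_add]
        rw [hcast, ZMod.val_intCast, Int.emod_eq_of_lt hk0 hkN]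
      have heq : 𝔼 y ∈ box t M, F (x + fun j => (y j : ZMod N)) = 𝔼 y ∈ box t M,
          (if ∀ i, ∀ p ∈ G i, (p : ℤ) ∣ W * ((formValue A c x i).val + ∑ j, A i j * y j) + b
            then (1 : ℝ) else 0) := by
        refine Finset.expect_congr rfl fun y hy => ?_
        refine if_congr (forall_congr' fun i => forall₂_congr fun p _ => ?_) rfl rfl
        rw [← hval y hy i]
        norm_cast
      rw [heq, sub_self, abs_zero]
      exact Finset.sum_nonneg fun i _ => hbad0 x i
  rw [htrans]
  refine (abs_expect_sub_le _ _ _ hpoint).trans ?_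
  rw [Finset.expect_sum_comm]
  have hi : ∀ i, 𝔼 x, bad x i ≤ 2 * H / N := by
    intro i
    obtain ⟨j, hj⟩ := hA i
    have := expect_affine_form (c i) (fun j => (A i j : ZMod N)) hj
      (fun v => if v.val < H ∨ N ≤ v.val + H then 1 else 0)
    have h2 : 𝔼 x, bad x i = 𝔼 v : ZMod N, if v.val < H ∨ N ≤ v.val + H then (1 : ℝ) else 0 := this
    rw [h2, Fintype.expect_eq_sum_div_card, ZMod.card, Finset.sum_boole]
    have := card_near_boundary_le (N := N) H
    gcongr
    exact_mod_cast this
  calc ∑ i, 𝔼 x, bad x i ≤ ∑ _i : Fin m, (2 * H / N : ℝ) := Finset.sum_le_sum fun i _ => hi i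
    _ = 2 * m * (H : ℕ) / N := by
        rw [Finset.sum_const, card_univ, Fintype.card_fin, nsmul_eq_mul]; ring

/-- Transfer of the mean over `(ℤ/N)^t` to the sieve sums with local densities. -/
theorem abs_expect_prod_sub_le {χ : ℝ → ℝ} (hχ : IsSmoothCutoff χ) {K : ℝ} (hK : ∀ x, |χ x| ≤ K)
    {R : ℝ} (hR : 1 < R) {N : ℕ} [Fact N.Prime] {m t L : ℕ} {W b : ℕ} (hb : 0 < b)
    {A : Fin m → Fin t → ℤ} (hAL : ∀ i j, |A i j| ≤ L) (hA : ∀ i, ∃ j, (A i j : ZMod N) ≠ 0)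
    (c : Fin m → ZMod N) {P : Finset ℕ} (hP : ∀ p ∈ P, p.Prime)
    (hPn : ∀ n p : ℕ, p.Prime → p ∣ W * n + b → (p : ℝ) ≤ R → p ∈ P) :
    |(𝔼 x : Fin t → ZMod N,
        ∏ i, smoothedDivisorSum χ R (W * (formValue A c x i).val + b) ^ 2) -
      𝔼 x : Fin t → ZMod N, sieveSum χ (Real.log R) P
        (formDensity W b A fun i => (formValue A c x i).val)| ≤
      2 * m * t * L * K ^ (2 * m) * R ^ (4 * m) / N := by
  have hN : (0 : ℝ) < N := by exact_mod_cast (Fact.out : N.Prime).pos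
  obtain ⟨hs1, hs2⟩ := sum_abs_sqCoeff_le hχ hK hR hP
  have h1 : ∀ x : Fin t → ZMod N,
      ∏ i, smoothedDivisorSum χ R (W * (formValue A c x i).val + b) ^ 2 =
      ∑ G ∈ Fintype.piFinset (fun _ : Fin m => P.powerset),
        (∏ i, sqCoeff χ (Real.log R) (G i)) *
          if ∀ i, ∀ p ∈ G i, p ∣ W * (formValue A c x i).val + b then 1 else 0 := fun x =>
    prod_sq_smoothedDivisorSum_eq_sum hχ hR hP (fun i => by omega) fun i p => hPn _ p
  simp_rw [h1, sieveSum]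
  rw [Finset.expect_sum_comm, Finset.expect_sum_comm, ← Finset.sum_sub_distrib]
  simp_rw [← Finset.mul_expect, ← mul_sub]
  refine (Finset.abs_sum_le_sum_abs _ _).trans ?_
  have hterm : ∀ G ∈ Fintype.piFinset (fun _ : Fin m => P.powerset),
      |(∏ i, sqCoeff χ (Real.log R) (G i)) * ((𝔼 x : Fin t → ZMod N,
        if ∀ i, ∀ p ∈ G i, p ∣ W * (formValue A c x i).val + b then (1 : ℝ) else 0) -
      𝔼 x : Fin t → ZMod N, ∏ p ∈ P,
        formDensity W b A (fun i => (formValue A c x i).val) p (univ.filter fun i => p ∈ G i))| ≤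
      (∏ i, |sqCoeff χ (Real.log R) (G i)|) * (2 * m * t * L * R ^ (2 * m) / N) := by
    intro G hG
    have hG' := fun i => mem_powerset.1 (Fintype.mem_piFinset.1 hG i)
    rw [abs_mul, Finset.abs_prod]
    -- Families with zero coefficient are discarded first, since their moduli need not be bounded;
    -- for the others each set of primes has product at most `R²`.
    by_cases h0 : ∏ i, |sqCoeff χ (Real.log R) (G i)| = 0
    · rw [h0, zero_mul, zero_mul]
    refine mul_le_mul_of_nonneg_left ?_ (Finset.prod_nonneg fun _ _ => abs_nonneg _)
    refine (abs_expect_indicator_sub_le W b hAL hA c hP G hG').trans ?_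
    have h2 : ((∏ p ∈ univ.biUnion G, p : ℕ) : ℝ) ≤ R ^ (2 * m) := by
      have h3 : ∏ p ∈ univ.biUnion G, p ≤ ∏ i, ∏ p ∈ G i, p := by
        have hprime : ∀ i, ∀ p ∈ G i, p.Prime := fun i p hp => hP p (hG' i hp)
        refine Nat.le_of_dvd (Finset.prod_pos fun i _ => Finset.prod_pos fun p hp =>
          (hprime i p hp).pos) ((prod_primes_dvd_iff fun p hp => ?_).2 fun p hp => ?_)
        · obtain ⟨i, _, hi⟩ := mem_biUnion.1 hp
          exact hprime i p hi
        · obtain ⟨i, _, hi⟩ := mem_biUnion.1 hp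
          exact (dvd_prod_of_mem _ hi).trans (dvd_prod_of_mem (fun i => ∏ p ∈ G i, p) (mem_univ i))
      calc ((∏ p ∈ univ.biUnion G, p : ℕ) : ℝ) ≤ ((∏ i, ∏ p ∈ G i, p : ℕ) : ℝ) := by
            exact_mod_cast h3
        _ = ∏ i, ((∏ p ∈ G i, p : ℕ) : ℝ) := by push_cast; rfl
        _ ≤ ∏ _i : Fin m, R ^ 2 := by
            refine Finset.prod_le_prod (fun _ _ => Nat.cast_nonneg _) fun i _ => hs1 _ (hG' i) ?_
            intro h4
            exact h0 (Finset.prod_eq_zero (mem_univ i) (by rw [h4, abs_zero]))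
        _ = R ^ (2 * m) := by
            rw [Finset.prod_const, card_univ, Fintype.card_fin, ← pow_mul]
    push_cast at h2 ⊢
    rw [div_le_div_iff_of_pos_right hN]
    calc (2 * m * (t * L * ∏ p ∈ univ.biUnion G, (p : ℝ)) : ℝ)
        ≤ 2 * m * (t * L * R ^ (2 * m)) := by gcongr
      _ = _ := by ring
  refine (Finset.sum_le_sum hterm).trans ?_
  rw [← Finset.sum_mul, ← Finset.prod_univ_sum (fun _ : Fin m => P.powerset)
    (fun _ G => |sqCoeff χ (Real.log R) G|), Finset.prod_const, card_univ, Fintype.card_fin]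
  calc _ ≤ ((K * R) ^ 2) ^ m * (2 * m * t * L * R ^ (2 * m) / N) := by
        have : 0 ≤ R := by linarith
        gcongr
    _ = _ := by
        rw [← pow_mul, mul_pow, show 4 * m = 2 * m + 2 * m by ring, pow_add]; ring

end PrimeWeight

namespace PrimeWeight

open Finset Filter Topology

/-! ### Means of products of the sieve weight, for a fixed modulus -/

theorem coprime_primorial_mem_sievePrimes {w Y b n p : ℕ} {R : ℝ}
    (hb : Nat.Coprime b (primorial w)) (hY : R < Y) (hp : p.Prime) (hpn : p ∣ primorial w * n + b)
    (hpR : (p : ℝ) ≤ R) : p ∈ sievePrimes w Y := by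
  refine mem_sievePrimes.2 ⟨hp, ?_, by exact_mod_cast hpR.trans_lt hY⟩
  by_contra h
  have h1 : p ∣ primorial w := hp.dvd_primorial_iff.2 (not_lt.1 h)
  have h2 : p ∣ b := (Nat.dvd_add_right (h1.mul_right n)).1 hpn
  exact hp.one_lt.ne' (Nat.dvd_one.1 (hb ▸ Nat.dvd_gcd h2 h1))

theorem not_dvd_of_abs_lt {p : ℕ} {a : ℤ} (ha : a ≠ 0) (h : |a| < p) : ¬ (p : ℤ) ∣ a :=
  fun hd => ha (Int.eq_zero_of_abs_lt_dvd hd h)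

theorem isLocalDensity_formDensity {m t L w Y b : ℕ} (hLw : L ≤ w) {A : Fin m → Fin t → ℤ}
    (hAL : ∀ i j, |A i j| ≤ L) (hA : ∀ i, A i ≠ 0) (v : Fin m → ℤ) :
    IsLocalDensity (sievePrimes w Y) (formDensity (primorial w) b A v) := by
  have hsing : ∀ p ∈ sievePrimes w Y, ∀ i, formDensity (primorial w) b A v p {i} = 1 / p := by
    intro p hp i
    obtain ⟨hpp, hwp, _⟩ := mem_sievePrimes.1 hp
    obtain ⟨j, hj⟩ := Function.ne_iff.1 (hA i)
    refine formDensity_singleton hpp (fun h => ?_) (j := j) (not_dvd_of_abs_lt hj ?_)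
    · exact absurd (hpp.dvd_primorial_iff.1 h) (not_le.2 hwp)
    · exact (hAL i j).trans_lt (by exact_mod_cast hLw.trans_lt hwp)
  refine ⟨fun p hp => formDensity_empty _ _ _ _ (mem_sievePrimes.1 hp).1.pos, hsing, ?_⟩
  intro p hp S hS
  obtain ⟨i, hi⟩ := Finset.card_pos.1 (show 0 < #S by omega)
  rw [abs_of_nonneg (formDensity_nonneg _ _ _ _ _ _), ← hsing p hp i]
  exact formDensity_anti _ _ _ _ _ (singleton_subset_iff.2 hi)

theorem exists_minor_ne_zero {t : ℕ} {a a' : Fin t → ℤ} (h : LinearIndependent ℤ ![a, a']) :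
    ∃ j k, a j * a' k - a k * a' j ≠ 0 := by
  by_contra! hall
  have ha : a ≠ 0 := by simpa using h.ne_zero 0
  obtain ⟨j, hj⟩ := Function.ne_iff.1 ha
  rw [LinearIndependent.pair_iff] at h
  have := h (a' j) (-a j) (by
    funext k
    simp only [Pi.add_apply, Pi.smul_apply, smul_eq_mul, Pi.zero_apply]
    linarith [hall j k])
  exact hj (neg_eq_zero.1 this.2)

/-- Non-collinearity over `ℤ` gives a nonzero minor of size at most `2L²`, which a prime `p > w ≥
2L²` cannot divide. -/
theorem formDensity_le_inv_sq {m t L w b p : ℕ} (hLw2 : 2 * L ^ 2 ≤ w) (hp : p.Prime)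
    (hwp : w < p) {A : Fin m → Fin t → ℤ} (hAL : ∀ i j, |A i j| ≤ L)
    (hind : ∀ i i', i ≠ i' → LinearIndependent ℤ ![A i, A i']) (v : Fin m → ℤ)
    {S : Finset (Fin m)} (hS : 2 ≤ #S) :
    |formDensity (primorial w) b A v p S| ≤ 1 / (p : ℝ) ^ 2 := by
  obtain ⟨i, hi, i', hi', hne⟩ := Finset.one_lt_card.1 (show 1 < #S by omega)
  obtain ⟨j, k, hjk⟩ := exists_minor_ne_zero (hind i i' hne)
  rw [abs_of_nonneg (formDensity_nonneg _ _ _ _ _ _)]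
  refine formDensity_pair_le hp (fun h => ?_) hi hi' (not_dvd_of_abs_lt hjk ?_)
  · exact absurd (hp.dvd_primorial_iff.1 h) (not_le.2 hwp)
  · have h1 : |A i j * A i' k - A i k * A i' j| ≤ 2 * (L : ℤ) ^ 2 := by
      refine (abs_sub _ _).trans ?_
      rw [abs_mul, abs_mul]
      have h2 : |A i j| * |A i' k| ≤ L * L :=
        mul_le_mul (hAL _ _) (hAL _ _) (abs_nonneg _) (Nat.cast_nonneg _)
      have h3 : |A i k| * |A i' j| ≤ L * L :=
        mul_le_mul (hAL _ _) (hAL _ _) (abs_nonneg _) (Nat.cast_nonneg _)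
      nlinarith
    exact h1.trans_lt (by exact_mod_cast hLw2.trans_lt hwp)

theorem expect_prod_sieveWeight {χ : ℝ → ℝ} {N m t w b : ℕ} [Fact N.Prime] {R : ℝ}
    (A : Fin m → Fin t → ℤ) (c : Fin m → ZMod N) :
    𝔼 x : Fin t → ZMod N, ∏ i, sieveWeight χ R (primorial w) b N (formValue A c x i) =
      (totDensity w * Real.log R) ^ m * 𝔼 x : Fin t → ZMod N,
        ∏ i, smoothedDivisorSum χ R (primorial w * (formValue A c x i).val + b) ^ 2 := by
  rw [Finset.mul_expect]
  refine Finset.expect_congr rfl fun x _ => ?_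
  simp only [sieveWeight]
  rw [Finset.prod_mul_distrib, Finset.prod_const, card_univ, Fintype.card_fin]
  rfl

theorem tendsto_log_rpow {α : ℝ} (hα : 0 < α) :
    Tendsto (fun N : ℕ => Real.log ((N : ℝ) ^ α)) atTop atTop :=
  Real.tendsto_log_atTop.comp ((tendsto_rpow_atTop hα).comp tendsto_natCast_atTop_atTop)

/-- The error term in the transfer to local densities is negligible. -/
theorem eventually_error_le {α : ℝ} (hα : 0 < α) (m : ℕ) (hmα : 8 * m * α ≤ 1) (B : ℝ)
    {ε : ℝ} (hε : 0 < ε) :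
    ∀ᶠ N : ℕ in atTop,
      Real.log ((N : ℝ) ^ α) ^ m * (B * ((N : ℝ) ^ α) ^ (4 * m) / N) ≤ ε := by
  have h1 : Tendsto (fun x : ℝ => |B| * α ^ m * (Real.log x ^ (m : ℝ) / x ^ (1 / 2 : ℝ))) atTop
      (𝓝 (|B| * α ^ m * 0)) :=
    ((isLittleO_log_rpow_rpow_atTop (m : ℝ) (by norm_num : (0 : ℝ) < 1 / 2)).tendsto_div_nhds_zero).const_mul _
  rw [mul_zero] at h1
  filter_upwards [(h1.comp tendsto_natCast_atTop_atTop).eventually_lt_const hε,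
    eventually_ge_atTop 1] with N hN hN1
  have hN0 : (1 : ℝ) ≤ N := by exact_mod_cast hN1
  have hNpos : (0 : ℝ) < N := by linarith
  refine le_trans ?_ hN.le
  have hlog : 0 ≤ Real.log N := Real.log_nonneg hN0
  -- This is the use of `8mα ≤ 1`: half a power of `N` is saved against the logarithms.
  have h2 : ((N : ℝ) ^ α) ^ (4 * m) ≤ (N : ℝ) ^ (1 / 2 : ℝ) := by
    rw [← Real.rpow_natCast, ← Real.rpow_mul hNpos.le]
    refine Real.rpow_le_rpow_of_exponent_le hN0 ?_
    push_cast; linarith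
  have h3 : (N : ℝ) ^ (1 / 2 : ℝ) * (N : ℝ) ^ (1 / 2 : ℝ) = N := by
    rw [← Real.rpow_add hNpos]; norm_num
  have hs : 0 < (N : ℝ) ^ (1 / 2 : ℝ) := Real.rpow_pos_of_pos hNpos _
  rw [Real.log_rpow hNpos, Function.comp_apply, Real.rpow_natCast, mul_pow]
  calc α ^ m * Real.log N ^ m * (B * ((N : ℝ) ^ α) ^ (4 * m) / N)
      ≤ α ^ m * Real.log N ^ m * (|B| * (N : ℝ) ^ (1 / 2 : ℝ) / N) := by
        gcongr
        exact le_abs_self B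
    _ = α ^ m * Real.log N ^ m * (|B| / (N : ℝ) ^ (1 / 2 : ℝ)) := by
        congr 1
        rw [div_eq_div_iff hNpos.ne' hs.ne', mul_assoc, h3]
    _ = _ := by ring

/-- Data common to the two applications: comparison of the mean with sieve sums. -/
theorem exists_transfer {χ : ℝ → ℝ} (hχ : IsSmoothCutoff χ) {α : ℝ} (hα : 0 < α) (m t L : ℕ)
    (hmα : 8 * m * α ≤ 1) :
    ∃ C : ℝ, 1 ≤ C ∧ ∃ w₀ : ℕ, 1 ≤ w₀ ∧ ∀ w : ℕ, w₀ ≤ w → ∀ᶠ N : ℕ in atTop,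
      ∀ [Fact N.Prime], ∀ b : ℕ, 0 < b → Nat.Coprime b (primorial w) →
      ∀ (A : Fin m → Fin t → ℤ) (c : Fin m → ZMod N), (∀ i j, |A i j| ≤ L) →
        (∀ i, A i ≠ 0) → ∃ Y : ℕ, ∃ S : (Fin t → ZMod N) → ℝ,
        |(𝔼 x : Fin t → ZMod N, ∏ i,
            sieveWeight χ ((N : ℝ) ^ α) (primorial w) b N (formValue A c x i)) - 𝔼 x, S x| ≤ 1 / w ∧
        ∀ x, (∀ B : Finset ℕ, (∀ p ∈ sievePrimes w Y, p ∉ B → ∀ T : Finset (Fin m), 2 ≤ #T →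
            |formDensity (primorial w) b A (fun i => (formValue A c x i).val) p T| ≤
              1 / (p : ℝ) ^ 2) →
            |S x| ≤ C * ∏ p ∈ (sievePrimes w Y).filter (· ∈ B), (1 + C / p)) ∧
          ((∀ p ∈ sievePrimes w Y, ∀ T : Finset (Fin m), 2 ≤ #T →
            |formDensity (primorial w) b A (fun i => (formValue A c x i).val) p T| ≤
              1 / (p : ℝ) ^ 2) → |S x - 1| ≤ C / w) := by
  obtain ⟨C, hC, w₀, hw₀, h⟩ := exists_sieveSum_asymptotics hχ m
  obtain ⟨K, hK1, hK⟩ := hχ.exists_bound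
  refine ⟨C, hC, max w₀ L, le_trans hw₀ (le_max_left _ _), fun w hw => ?_⟩
  have hww₀ := (le_max_left _ _).trans hw
  have hwL := (le_max_right _ _).trans hw
  have hw1 : (0 : ℝ) < w := by exact_mod_cast hw₀.trans hww₀
  filter_upwards [(tendsto_log_rpow hα).eventually (h w hww₀),
    eventually_error_le hα m hmα (2 * m * t * L * K ^ (2 * m)) (show 0 < 1 / (w : ℝ) by positivity),
    eventually_gt_atTop 1, eventually_gt_atTop L] with N hN hNerr hN1 hNL
  intro hNp b hb hbW A c hAL hA
  set R := (N : ℝ) ^ α with hR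
  have hN1' : (1 : ℝ) < N := by exact_mod_cast hN1
  have hR1 : 1 < R := Real.one_lt_rpow hN1' hα
  have hlogR : 0 < Real.log R := Real.log_pos hR1
  -- The auxiliary cutoff `Y` must be large for the asymptotics and exceed `R`, so that no prime
  -- seen by the divisor sums is lost.
  obtain ⟨Y, hY, hYR⟩ := (hN.and (eventually_gt_atTop ⌈R⌉₊)).exists
  have hYR' : R < Y := (Nat.le_ceil R).trans_lt (by exact_mod_cast hYR)
  refine ⟨Y, fun x => (totDensity w * Real.log R) ^ m * sieveSum χ (Real.log R) (sievePrimes w Y)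
    (formDensity (primorial w) b A fun i => (formValue A c x i).val), ?_, fun x => ?_⟩
  · rw [expect_prod_sieveWeight, ← Finset.mul_expect, ← mul_sub, abs_mul]
    have hAN : ∀ i, ∃ j, (A i j : ZMod N) ≠ 0 := by
      intro i
      obtain ⟨j, hj⟩ := Function.ne_iff.1 (hA i)
      refine ⟨j, ?_⟩
      rw [Ne, ZMod.intCast_zmod_eq_zero_iff_dvd]
      exact not_dvd_of_abs_lt hj ((hAL i j).trans_lt (by exact_mod_cast hNL))
    have h1 := abs_expect_prod_sub_le hχ hK hR1 hb hAL hAN c (P := sievePrimes w Y)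
      (fun p hp => (mem_sievePrimes.1 hp).1)
      (fun n p hp hpn hpR => coprime_primorial_mem_sievePrimes hbW hYR' hp hpn hpR)
    have h0 : 0 ≤ totDensity w * Real.log R := mul_nonneg (totDensity_pos w).le hlogR.le
    have h2 : |(totDensity w * Real.log R) ^ m| ≤ Real.log R ^ m := by
      rw [abs_of_nonneg (pow_nonneg h0 m)]
      refine pow_le_pow_left₀ h0 ?_ m
      exact mul_le_of_le_one_left hlogR.le (totDensity_le_one w)
    exact (mul_le_mul h2 h1 (abs_nonneg _) (by positivity)).trans hNerr
  · exact hY _ (isLocalDensity_formDensity hwL hAL hA _)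

/-- No prime above `w` is exceptional, so the main term is within `C/w` of `1` at every `x`, hence
on average; the transfer error adds `1/w`. -/
theorem exists_linearForms_bound {χ : ℝ → ℝ} (hχ : IsSmoothCutoff χ) {α : ℝ} (hα : 0 < α)
    (m t L : ℕ) (hmα : 8 * m * α ≤ 1) :
    ∃ C : ℝ, 1 ≤ C ∧ ∃ w₀ : ℕ, ∀ w : ℕ, w₀ ≤ w → ∀ᶠ N : ℕ in atTop,
      ∀ [Fact N.Prime], ∀ b : ℕ, 0 < b → Nat.Coprime b (primorial w) →
      ∀ (A : Fin m → Fin t → ℤ) (c : Fin m → ZMod N), (∀ i j, |A i j| ≤ L) →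
        (∀ i, A i ≠ 0) → (∀ i i', i ≠ i' → LinearIndependent ℤ ![A i, A i']) →
        |(𝔼 x : Fin t → ZMod N, ∏ i,
            sieveWeight χ ((N : ℝ) ^ α) (primorial w) b N (formValue A c x i)) - 1| ≤ C / w := by
  obtain ⟨C, hC, w₀, hw₀, h⟩ := exists_transfer hχ hα m t L hmα
  refine ⟨C + 1, by linarith, max w₀ (max L (2 * L ^ 2)), fun w hw => ?_⟩
  have h2 : 2 * L ^ 2 ≤ w := ((le_max_right _ _).trans (le_max_right _ _)).trans hw
  filter_upwards [h w ((le_max_left _ _).trans hw)] with N hN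
  intro hNp b hb hbW A c hAL hA hind
  obtain ⟨Y, S, hS1, hS2⟩ := hN b hb hbW A c hAL hA
  have h3 : ∀ x, |S x - 1| ≤ C / w := fun x => (hS2 x).2 fun p hp T hT =>
    formDensity_le_inv_sq h2 (mem_sievePrimes.1 hp).1 (mem_sievePrimes.1 hp).2.1 hAL hind _ hT
  have h4 : |𝔼 x, S x - 1| ≤ C / w := by
    have := abs_expect_sub_le S (fun _ => 1) (fun _ => C / w) h3
    rwa [Finset.expect_const univ_nonempty, Finset.expect_const univ_nonempty] at this
  calc _ ≤ _ := abs_sub_le _ (𝔼 x, S x) 1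
    _ ≤ 1 / w + C / w := add_le_add hS1 h4
    _ = (C + 1) / w := by ring

end PrimeWeight

/-! ### Correlations along distinct shifts. -/

namespace PrimeWeight

open Finset Filter Topology

/-- The arithmetic factor `∏_{p ∣ n} (1 + C / p)`. -/
noncomputable def primeFactorProd (C : ℝ) (n : ℕ) : ℝ := ∏ p ∈ n.primeFactors, (1 + C / p)

theorem one_le_one_add_div {C : ℝ} (hC : 0 ≤ C) (p : ℕ) : 1 ≤ 1 + C / (p : ℝ) := by
  have : 0 ≤ C / (p : ℝ) := by positivity
  linarith

theorem one_le_prod_of_one_le {ι : Type*} {s : Finset ι} {f : ι → ℝ} (hf : ∀ i, 1 ≤ f i) :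
    1 ≤ ∏ i ∈ s, f i := by
  have := Finset.prod_le_prod (s := s) (f := fun _ => (1 : ℝ)) (g := f) (fun _ _ => zero_le_one)
    fun i _ => hf i
  simpa using this

theorem one_le_primeFactorProd {C : ℝ} (hC : 0 ≤ C) (n : ℕ) : 1 ≤ primeFactorProd C n :=
  one_le_prod_of_one_le (one_le_one_add_div hC)

theorem prod_biUnion_le {ι : Type*} [DecidableEq ι] (E : Finset ι) (s : ι → Finset ℕ) {f : ℕ → ℝ}
    (hf : ∀ p, 1 ≤ f p) : ∏ p ∈ E.biUnion s, f p ≤ ∏ e ∈ E, ∏ p ∈ s e, f p := by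
  induction E using Finset.induction with
  | empty => simp
  | insert e E he ih =>
    rw [biUnion_insert, Finset.prod_insert he]
    have h1 := Finset.prod_union_inter (s₁ := s e) (s₂ := E.biUnion s) (f := f)
    have h2 : 1 ≤ ∏ p ∈ s e ∩ E.biUnion s, f p := one_le_prod_of_one_le hf
    have h3 : 1 ≤ ∏ p ∈ s e ∪ E.biUnion s, f p := one_le_prod_of_one_le hf
    have h4 : 1 ≤ ∏ p ∈ s e, f p := one_le_prod_of_one_le hf
    calc ∏ p ∈ s e ∪ E.biUnion s, f p ≤ (∏ p ∈ s e, f p) * ∏ p ∈ E.biUnion s, f p := by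
          rw [← h1]; nlinarith
      _ ≤ _ := by gcongr

/-- The product is at most the `k`-th power of the largest factor. This replaces a product over
pairs of shifts by the sum required in the correlation condition; the `1` covers empty `E`. -/
theorem prod_le_one_add_sum_pow {ι : Type*} (E : Finset ι) {g : ι → ℝ} (hg : ∀ e, 1 ≤ g e) {k : ℕ}
    (hk : #E ≤ k) : ∏ e ∈ E, g e ≤ 1 + ∑ e ∈ E, g e ^ k := by
  have h0 : ∀ e ∈ E, 0 ≤ g e ^ k := fun e _ => pow_nonneg (by linarith [hg e]) k
  rcases E.eq_empty_or_nonempty with rfl | hE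
  · simp
  obtain ⟨e, he, hmax⟩ := E.exists_max_image g hE
  calc ∏ i ∈ E, g i ≤ ∏ _i ∈ E, g e :=
        Finset.prod_le_prod (fun i _ => by linarith [hg i]) hmax
    _ = g e ^ #E := by rw [Finset.prod_const]
    _ ≤ g e ^ k := pow_le_pow_right₀ (hg e) hk
    _ ≤ ∑ i ∈ E, g i ^ k := Finset.single_le_sum h0 he
    _ ≤ _ := by linarith

/-- The difference of two representatives has only two possible absolute values given the residue of
the difference. This removes the dependence on `x` and explains the two terms of `shiftBound`. -/
theorem natAbs_val_sub_val {N : ℕ} [NeZero N] {a b : ZMod N} (hab : a ≠ b) :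
    ((a.val : ℤ) - b.val).natAbs = (a - b).val ∨
      ((a.val : ℤ) - b.val).natAbs = N - (a - b).val := by
  have hlt := ZMod.val_lt (b - a)
  rcases le_total b.val a.val with h | h
  · left
    rw [ZMod.val_sub h]; omega
  · right
    have h1 : (a - b).val = N - (b - a).val := by
      have : NeZero (b - a) := ⟨sub_ne_zero.2 hab.symm⟩
      rw [← neg_sub b a, ZMod.val_neg_of_ne_zero]
    rw [h1, Nat.sub_sub_self hlt.le, ZMod.val_sub h]
    omega

/-- The ordered pairs `i < j`. -/
def ltPairs (q : ℕ) : Finset (Fin q × Fin q) := univ.filter fun e => e.1 < e.2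

theorem card_ltPairs_le (q : ℕ) : #(ltPairs q) ≤ q ^ 2 := by
  refine (card_filter_le _ _).trans ?_
  rw [card_univ, Fintype.card_prod, Fintype.card_fin, sq]

/-- The bound for the correlations at shifts with difference `h`. -/
noncomputable def shiftBound (C : ℝ) (k N : ℕ) (h : ZMod N) : ℝ :=
  primeFactorProd C h.val ^ k + primeFactorProd C (N - h.val) ^ k

theorem shiftBound_nonneg {C : ℝ} (hC : 0 ≤ C) (k N : ℕ) (h : ZMod N) : 0 ≤ shiftBound C k N h :=
  add_nonneg (pow_nonneg (by linarith [one_le_primeFactorProd hC h.val]) k)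
    (pow_nonneg (by linarith [one_le_primeFactorProd hC (N - h.val)]) k)

/-- Subtracting two of the divisibilities leaves `p ∣ W (v_i - v_j)`. Thus the exceptional primes
for shifts are those dividing such differences. -/
theorem formDensity_const_one_eq_zero {m w b p : ℕ} (hp : p.Prime) (hwp : w < p) {v : Fin m → ℤ}
    {S : Finset (Fin m)} {i j : Fin m} (hi : i ∈ S) (hj : j ∈ S) (hij : ¬ (p : ℤ) ∣ v i - v j) :
    formDensity (primorial w) b (fun _ (_ : Fin 1) => 1) v p S = 0 := by
  refine Finset.expect_eq_zero fun y _ => if_neg fun h => ?_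
  have h1 := dvd_sub (h i hi) (h j hj)
  have h2 : (p : ℤ) ∣ (primorial w : ℤ) * (v i - v j) :=
    h1.trans (dvd_of_eq (by push_cast; ring))
  rcases (Nat.prime_iff_prime_int.1 hp).dvd_or_dvd h2 with h3 | h3
  · exact absurd (hp.dvd_primorial_iff.1 (by exact_mod_cast h3)) (not_le.2 hwp)
  · exact hij h3

theorem exists_correlation_bound {χ : ℝ → ℝ} (hχ : IsSmoothCutoff χ) {α : ℝ} (hα : 0 < α)
    (q : ℕ) (hqα : 8 * q * α ≤ 1) :
    ∃ C : ℝ, 1 ≤ C ∧ ∃ w₀ : ℕ, ∀ w : ℕ, w₀ ≤ w → ∀ᶠ N : ℕ in atTop,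
      ∀ [Fact N.Prime], ∀ b : ℕ, 0 < b → Nat.Coprime b (primorial w) →
      ∀ h : Fin q → ZMod N, Function.Injective h → ∀ k : ℕ, q ^ 2 ≤ k →
        𝔼 x : ZMod N, ∏ i, sieveWeight χ ((N : ℝ) ^ α) (primorial w) b N (x + h i) ≤
          C * (1 + ∑ e ∈ ltPairs q, shiftBound C k N (h e.1 - h e.2)) := by
  obtain ⟨C, hC, w₀, hw₀, htr⟩ := exists_transfer hχ hα q 1 1 hqα
  have hC0 : 0 ≤ C := by linarith
  refine ⟨C + 1, by linarith, w₀, fun w hw => ?_⟩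
  filter_upwards [htr w hw] with N hN
  intro hNp b hb hbW h hinj k hk
  obtain ⟨Y, S, hS1, hS2⟩ := hN b hb hbW (fun _ _ => 1) h (fun _ _ => by simp)
    (fun i => by simp [funext_iff])
  have hform : ∀ (x : Fin 1 → ZMod N) i, formValue (fun _ (_ : Fin 1) => 1) h x i = x 0 + h i := by
    intro x i
    simp [formValue, add_comm]
  have hmean : 𝔼 x : ZMod N, ∏ i, sieveWeight χ ((N : ℝ) ^ α) (primorial w) b N (x + h i) =
      𝔼 x : Fin 1 → ZMod N, ∏ i, sieveWeight χ ((N : ℝ) ^ α) (primorial w) b N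
        (formValue (fun _ (_ : Fin 1) => 1) h x i) := by
    symm
    refine Fintype.expect_equiv (Equiv.funUnique (Fin 1) (ZMod N)) _ _ fun x => ?_
    simp_rw [hform]
    rfl
  set Q : ℝ := 1 + ∑ e ∈ ltPairs q, shiftBound C k N (h e.1 - h e.2) with hQ
  have hQ1 : 1 ≤ Q := by
    have : 0 ≤ ∑ e ∈ ltPairs q, shiftBound C k N (h e.1 - h e.2) :=
      Finset.sum_nonneg fun e _ => shiftBound_nonneg hC0 _ _ _
    linarith
  have hpoint : ∀ x, |S x| ≤ C * Q := by
    intro x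
    set v : Fin q → ℤ := fun i => (formValue (fun _ (_ : Fin 1) => 1) h x i).val with hv
    set n : Fin q × Fin q → ℕ := fun e => (v e.1 - v e.2).natAbs with hn
    have hne : ∀ e ∈ ltPairs q, formValue (fun _ (_ : Fin 1) => 1) h x e.1 ≠
        formValue (fun _ (_ : Fin 1) => 1) h x e.2 := by
      intro e he
      rw [hform, hform]
      intro heq
      exact (mem_filter.1 he).2.ne (hinj (add_left_cancel heq))
    have hn0 : ∀ e ∈ ltPairs q, n e ≠ 0 := by
      intro e he h0
      have h1 : v e.1 = v e.2 := by
        have := Int.natAbs_eq_zero.1 h0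
        omega
      simp only [hv] at h1
      exact hne e he (ZMod.val_injective N (by exact_mod_cast h1))
    have h1 := (hS2 x).1 ((ltPairs q).biUnion fun e => (n e).primeFactors) (by
      intro p hp hpB T hT
      obtain ⟨hpp, hwp, _⟩ := mem_sievePrimes.1 hp
      have hex : ∃ e ∈ ltPairs q, e.1 ∈ T ∧ e.2 ∈ T := by
        obtain ⟨i, hi, j, hj, hij⟩ := Finset.one_lt_card.1 (show 1 < #T by omega)
        rcases lt_or_gt_of_ne hij with h | h
        · exact ⟨(i, j), mem_filter.2 ⟨mem_univ _, h⟩, hi, hj⟩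
        · exact ⟨(j, i), mem_filter.2 ⟨mem_univ _, h⟩, hj, hi⟩
      obtain ⟨e, he, hi, hj⟩ := hex
      rw [formDensity_const_one_eq_zero hpp hwp hi hj, abs_zero]
      · positivity
      · intro hd
        refine hpB (mem_biUnion.2 ⟨e, he, Nat.mem_primeFactors.2 ⟨hpp, ?_, hn0 e he⟩⟩)
        exact Int.natCast_dvd.1 hd)
    refine h1.trans (mul_le_mul_of_nonneg_left ?_ hC0)
    have hf : ∀ p : ℕ, 1 ≤ 1 + C / (p : ℝ) := one_le_one_add_div hC0
    calc ∏ p ∈ (sievePrimes w Y).filter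
            (· ∈ (ltPairs q).biUnion fun e => (n e).primeFactors), (1 + C / (p : ℝ))
        ≤ ∏ p ∈ (ltPairs q).biUnion fun e => (n e).primeFactors, (1 + C / (p : ℝ)) := by
          refine Finset.prod_le_prod_of_subset_of_one_le (fun p hp => (mem_filter.1 hp).2) ?_ ?_
          · intro p _; linarith [hf p]
          · intro p _ _; exact hf p
      _ ≤ ∏ e ∈ ltPairs q, primeFactorProd C (n e) := prod_biUnion_le _ _ hf
      _ ≤ 1 + ∑ e ∈ ltPairs q, primeFactorProd C (n e) ^ k :=
          prod_le_one_add_sum_pow _ (fun e => one_le_primeFactorProd hC0 _)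
            ((card_ltPairs_le q).trans hk)
      _ ≤ Q := by
          rw [hQ]
          gcongr with e he
          have h2 := natAbs_val_sub_val (hne e he)
          have h3 : formValue (fun _ (_ : Fin 1) => 1) h x e.1 -
              formValue (fun _ (_ : Fin 1) => 1) h x e.2 = h e.1 - h e.2 := by
            rw [hform, hform]; ring
          rw [h3] at h2
          have h4 : ∀ l, 0 ≤ primeFactorProd C l ^ k := fun l =>
            pow_nonneg (by linarith [one_le_primeFactorProd hC0 l]) k
          have h5 : n e = (h e.1 - h e.2).val ∨ n e = N - (h e.1 - h e.2).val := h2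
          unfold shiftBound
          rcases h5 with h5 | h5 <;> rw [h5]
          · linarith [h4 (N - (h e.1 - h e.2).val)]
          · linarith [h4 (h e.1 - h e.2).val]
  have hmono : ∀ l, primeFactorProd C l ≤ primeFactorProd (C + 1) l := fun l => by
    refine Finset.prod_le_prod (fun p _ => by linarith [one_le_one_add_div hC0 p]) fun p _ => ?_
    have : C / (p : ℝ) ≤ (C + 1) / p := by gcongr; linarith
    linarith
  have hw1 : (1 : ℝ) ≤ w := by exact_mod_cast hw₀.trans hw
  have h6 : |𝔼 x, S x| ≤ C * Q :=
    (Finset.abs_expect_le _ _).trans (Finset.expect_le univ_nonempty fun x _ => hpoint x)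
  have h7 : 1 / (w : ℝ) ≤ 1 := (div_le_one (by linarith)).2 hw1
  rw [hmean]
  have h8 := (abs_le.1 hS1).2
  have h9 := (abs_le.1 h6).2
  -- Raising the constant to `C + 1` absorbs the transfer error `1/w ≤ 1`; `shiftBound` increases
  -- with its constant.
  calc _ ≤ C * Q + 1 := by linarith
    _ ≤ (C + 1) * Q := by nlinarith
    _ ≤ _ := by
        rw [hQ]
        gcongr with e he
        unfold shiftBound
        have h10 : ∀ l, 0 ≤ primeFactorProd C l := fun l => by
          linarith [one_le_primeFactorProd hC0 l]
        gcongr <;> first | exact h10 _ | exact hmono _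

end PrimeWeight

namespace PrimeWeight

open Finset Filter Topology

/-! ### Moments of the arithmetic factors and a bound for the weight -/

/-- Fewer than `p₀ + 1` factors violate the comparison with `F'`, and each of those costs at most
`D`. -/
theorem prod_le_const_mul_prod (s : Finset ℕ) {F F' : ℕ → ℝ} {D : ℝ} (hD : 1 ≤ D) {p₀ : ℕ}
    (hF0 : ∀ p, 0 ≤ F p) (hFD : ∀ p ∈ s, F p ≤ D) (hFF' : ∀ p ∈ s, p₀ ≤ p → F p ≤ F' p)
    (hF' : ∀ p ∈ s, 1 ≤ F' p) : ∏ p ∈ s, F p ≤ D ^ p₀ * ∏ p ∈ s, F' p := by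
  calc ∏ p ∈ s, F p ≤ ∏ p ∈ s, (if p < p₀ then D else 1) * F' p := by
        refine Finset.prod_le_prod (fun p _ => hF0 p) fun p hp => ?_
        have h1 := hF' p hp
        split_ifs with h
        · have := hFD p hp; nlinarith
        · rw [one_mul]; exact hFF' p hp (not_lt.1 h)
    _ = D ^ #(s.filter (· < p₀)) * ∏ p ∈ s, F' p := by
        rw [Finset.prod_mul_distrib, ← Finset.prod_filter, Finset.prod_const]
    _ ≤ D ^ p₀ * ∏ p ∈ s, F' p := by
        have h0 : 0 ≤ ∏ p ∈ s, F' p := Finset.prod_nonneg fun p hp => by linarith [hF' p hp]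
        have hcard : #(s.filter (· < p₀)) ≤ p₀ := by
          calc _ ≤ #(range p₀) := card_le_card fun p hp => mem_range.2 (mem_filter.1 hp).2
            _ = p₀ := card_range _
        exact mul_le_mul_of_nonneg_right (pow_le_pow_right₀ hD hcard) h0

theorem one_add_pow_le {x : ℝ} (hx0 : 0 ≤ x) (hx1 : x ≤ 1) (E : ℕ) :
    (1 + x) ^ E ≤ 1 + 3 ^ E * x := by
  induction E with
  | zero => simpa using hx0
  | succ E ih =>
    have h2 : (1 : ℝ) ≤ 3 ^ E := one_le_pow₀ (by norm_num)
    have h3 : x * x ≤ x := by nlinarith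
    have h4 : x ≤ 3 ^ E * x := le_mul_of_one_le_left hx0 h2
    have h5 : 3 ^ E * (x * x) ≤ 3 ^ E * x := mul_le_mul_of_nonneg_left h3 (by linarith)
    calc (1 + x) ^ (E + 1) = (1 + x) ^ E * (1 + x) := pow_succ _ _
      _ ≤ (1 + 3 ^ E * x) * (1 + x) := by gcongr
      _ = 1 + x + 3 ^ E * x + 3 ^ E * (x * x) := by ring
      _ ≤ 1 + 3 ^ (E + 1) * x := by rw [pow_succ]; linarith

theorem prod_one_add_inv_sqrt_le {n : ℕ} (hn : n ≠ 0) :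
    ∏ p ∈ n.primeFactors, (1 + (p : ℝ) ^ (-(1 / 2) : ℝ)) ≤
      ∑ d ∈ n.divisors, (d : ℝ) ^ (-(1 / 2) : ℝ) := by
  have hprime : ∀ S ∈ n.primeFactors.powerset, ∀ p ∈ S, p.Prime := fun S hS p hp =>
    Nat.prime_of_mem_primeFactors (mem_powerset.1 hS hp)
  have hinj : Set.InjOn (fun S : Finset ℕ => ∏ p ∈ S, p) (n.primeFactors.powerset : Set _) := by
    intro S hS T hT h
    rw [← Nat.primeFactors_prod (hprime S hS), ← Nat.primeFactors_prod (hprime T hT)]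
    exact congrArg _ h
  rw [Finset.prod_one_add]
  have h1 : ∀ S ∈ n.primeFactors.powerset, ∏ p ∈ S, (p : ℝ) ^ (-(1 / 2) : ℝ) =
      ((∏ p ∈ S, p : ℕ) : ℝ) ^ (-(1 / 2) : ℝ) := by
    intro S _
    rw [Real.finsetProd_rpow _ _ fun p _ => Nat.cast_nonneg p]
    push_cast; rfl
  rw [Finset.sum_congr rfl h1, ← Finset.sum_image (f := fun d : ℕ => (d : ℝ) ^ (-(1 / 2) : ℝ)) hinj]
  refine Finset.sum_le_sum_of_subset_of_nonneg (fun d hd => ?_) fun d _ _ =>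
    Real.rpow_nonneg (Nat.cast_nonneg d) _
  obtain ⟨S, hS, rfl⟩ := mem_image.1 hd
  exact Nat.mem_divisors.2 ⟨(prod_primes_dvd_iff (hprime S hS)).2 fun p hp =>
    Nat.dvd_of_mem_primeFactors (mem_powerset.1 hS hp), hn⟩

theorem exists_primeFactorProd_pow_le {C : ℝ} (hC : 0 ≤ C) (E : ℕ) :
    ∃ D : ℝ, 1 ≤ D ∧ ∀ n : ℕ, n ≠ 0 →
      primeFactorProd C n ^ E ≤ D * ∑ d ∈ n.divisors, (d : ℝ) ^ (-(1 / 2) : ℝ) := by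
  -- Beyond `p₀` one has `C/p ≤ 1`, so the power expands linearly, and `3^E C ≤ √p`, so the result
  -- is at most `1 + p^(-1/2)`.
  set p₀ := ⌈max C ((3 ^ E * C) ^ 2)⌉₊ with hp₀
  have hD1 : 1 ≤ (1 + C) ^ E := one_le_pow₀ (by linarith)
  refine ⟨((1 + C) ^ E) ^ p₀, one_le_pow₀ hD1, fun n hn => ?_⟩
  rw [primeFactorProd, ← Finset.prod_pow]
  refine le_trans (prod_le_const_mul_prod _ (F' := fun p : ℕ => 1 + (p : ℝ) ^ (-(1 / 2) : ℝ))
    hD1 (p₀ := p₀) ?_ ?_ ?_ ?_) ?_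
  · intro p; exact pow_nonneg (by linarith [one_le_one_add_div hC p]) E
  · intro p hp
    have hp1 : (1 : ℝ) ≤ p := by exact_mod_cast (Nat.prime_of_mem_primeFactors hp).one_le
    have : C / (p : ℝ) ≤ C := div_le_self hC hp1
    have := one_le_one_add_div hC p
    gcongr
  · intro p hp hpp
    have hp0 : (0 : ℝ) < p := by exact_mod_cast (Nat.prime_of_mem_primeFactors hp).pos
    have h1 : max C ((3 ^ E * C) ^ 2) ≤ p := (Nat.le_ceil _).trans (Nat.cast_le.2 hpp)
    have h2 : C / p ≤ 1 := (div_le_one hp0).2 ((le_max_left _ _).trans h1)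
    have h3 : 3 ^ E * C ≤ Real.sqrt p := Real.le_sqrt_of_sq_le ((le_max_right _ _).trans h1)
    refine (one_add_pow_le (by positivity) h2 E).trans ?_
    have hs : 0 < Real.sqrt p := Real.sqrt_pos.2 hp0
    have h4 : (p : ℝ) ^ (-(1 / 2) : ℝ) = Real.sqrt p / p := by
      rw [Real.rpow_neg hp0.le, ← Real.sqrt_eq_rpow, eq_div_iff hp0.ne']
      nth_rewrite 2 [← Real.mul_self_sqrt hp0.le]
      field_simp
    rw [h4, ← mul_div_assoc]
    gcongr
  · intro p _
    have := Real.rpow_nonneg (Nat.cast_nonneg p) (-(1 / 2) : ℝ)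
    linarith
  · exact mul_le_mul_of_nonneg_left (prod_one_add_inv_sqrt_le hn) (by positivity)

/-- Exchanging the sums, each `d` has at most `N/d` multiples, and `∑ d^(-3/2)` converges. -/
theorem exists_sum_divisors_le :
    ∃ D : ℝ, 0 ≤ D ∧ ∀ N : ℕ,
      ∑ n ∈ Finset.Ioc 0 N, ∑ d ∈ n.divisors, (d : ℝ) ^ (-(1 / 2) : ℝ) ≤ D * N := by
  have hsum : Summable fun d : ℕ => (d : ℝ) ^ (-(3 / 2) : ℝ) :=
    Real.summable_nat_rpow.2 (by norm_num)
  have h0 : ∀ d : ℕ, 0 ≤ (d : ℝ) ^ (-(3 / 2) : ℝ) := fun d => Real.rpow_nonneg (Nat.cast_nonneg d) _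
  refine ⟨∑' d : ℕ, (d : ℝ) ^ (-(3 / 2) : ℝ), tsum_nonneg h0, fun N => ?_⟩
  have h1 : ∀ n ∈ Finset.Ioc 0 N, ∑ d ∈ n.divisors, (d : ℝ) ^ (-(1 / 2) : ℝ) =
      ∑ d ∈ Finset.Ioc 0 N, if d ∣ n then (d : ℝ) ^ (-(1 / 2) : ℝ) else 0 := by
    intro n hn
    rw [← Finset.sum_filter]
    refine Finset.sum_congr ?_ fun _ _ => rfl
    ext d
    have hn' := mem_Ioc.1 hn
    simp only [Nat.mem_divisors, mem_filter, mem_Ioc]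
    constructor
    · rintro ⟨h2, h3⟩
      exact ⟨⟨Nat.pos_of_dvd_of_pos h2 hn'.1, (Nat.le_of_dvd hn'.1 h2).trans hn'.2⟩, h2⟩
    · rintro ⟨_, h2⟩; exact ⟨h2, by omega⟩
  rw [Finset.sum_congr rfl h1, Finset.sum_comm]
  calc ∑ d ∈ Finset.Ioc 0 N, ∑ n ∈ Finset.Ioc 0 N, (if d ∣ n then (d : ℝ) ^ (-(1 / 2) : ℝ) else 0)
      ≤ ∑ d ∈ Finset.Ioc 0 N, (d : ℝ) ^ (-(3 / 2) : ℝ) * N := by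
        refine Finset.sum_le_sum fun d hd => ?_
        have hd0 : (0 : ℝ) < d := by exact_mod_cast (mem_Ioc.1 hd).1
        rw [← Finset.sum_filter, Finset.sum_const, Nat.Ioc_filter_dvd_card_eq_div, nsmul_eq_mul]
        have h3 : ((N / d : ℕ) : ℝ) ≤ N / d := Nat.cast_div_le
        have h4 : (d : ℝ) ^ (-(3 / 2) : ℝ) = (d : ℝ) ^ (-(1 / 2) : ℝ) / d := by
          rw [show (-(3 / 2) : ℝ) = -(1 / 2) - 1 by norm_num, Real.rpow_sub_one hd0.ne']
        rw [h4]
        calc _ ≤ (N / d : ℝ) * (d : ℝ) ^ (-(1 / 2) : ℝ) := by gcongr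
          _ = _ := by ring
    _ = (∑ d ∈ Finset.Ioc 0 N, (d : ℝ) ^ (-(3 / 2) : ℝ)) * N := by rw [Finset.sum_mul]
    _ ≤ _ := by
        gcongr
        exact hsum.sum_le_tsum _ fun d _ => h0 d

theorem exists_sum_primeFactorProd_pow_le {C : ℝ} (hC : 0 ≤ C) (E : ℕ) :
    ∃ D : ℝ, 0 ≤ D ∧ ∀ N : ℕ, ∑ n ∈ Finset.Ioc 0 N, primeFactorProd C n ^ E ≤ D * N := by
  obtain ⟨D₁, hD₁, h₁⟩ := exists_primeFactorProd_pow_le hC E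
  obtain ⟨D₂, hD₂, h₂⟩ := exists_sum_divisors_le
  refine ⟨D₁ * D₂, by positivity, fun N => ?_⟩
  calc _ ≤ ∑ n ∈ Finset.Ioc 0 N, D₁ * ∑ d ∈ n.divisors, (d : ℝ) ^ (-(1 / 2) : ℝ) :=
        Finset.sum_le_sum fun n hn => h₁ n (by have := (mem_Ioc.1 hn).1; omega)
    _ ≤ D₁ * (D₂ * N) := by
        rw [← Finset.mul_sum]
        exact mul_le_mul_of_nonneg_left (h₂ N) (by linarith)
    _ = _ := by ring

theorem sum_zmod_sub_val {N : ℕ} [NeZero N] (φ : ℕ → ℝ) :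
    ∑ h : ZMod N, φ (N - h.val) = ∑ n ∈ Finset.Ioc 0 N, φ n := by
  refine Finset.sum_bij' (fun h _ => N - h.val) (fun n _ => ((N - n : ℕ) : ZMod N)) ?_ ?_ ?_ ?_ ?_
  · intro h _
    have := ZMod.val_lt h
    exact mem_Ioc.2 ⟨by omega, by omega⟩
  · intro n _; exact mem_univ _
  · intro h _
    have := ZMod.val_lt h
    rw [Nat.sub_sub_self this.le, ZMod.natCast_zmod_val]
  · intro n hn
    have := mem_Ioc.1 hn
    rw [ZMod.val_cast_of_lt (by omega), Nat.sub_sub_self this.2]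
  · intro h _; rfl

/-- Negation turns `val` into `N - val` except at `0`, where `φ 0` stands in place of `φ N`. -/
theorem sum_zmod_val_le {N : ℕ} [NeZero N] {φ : ℕ → ℝ} (hφ : φ 0 ≤ φ N) :
    ∑ h : ZMod N, φ h.val ≤ ∑ n ∈ Finset.Ioc 0 N, φ n := by
  rw [← sum_zmod_sub_val, ← Equiv.sum_comp (Equiv.neg (ZMod N)) fun h => φ h.val]
  refine Finset.sum_le_sum fun h _ => ?_
  rw [Equiv.neg_apply]
  by_cases h0 : h = 0
  · subst h0; simpa using hφ
  · have : NeZero h := ⟨h0⟩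
    rw [ZMod.val_neg_of_ne_zero]

theorem exists_moment_shiftBound_le {C : ℝ} (hC : 0 ≤ C) {B : ℝ} (hB : 0 ≤ B) (k : ℕ) (p : ℝ) :
    ∃ D : ℝ, ∀ (N : ℕ) [NeZero N],
      𝔼 h : ZMod N, (B * shiftBound C k N h) ^ p ≤ D := by
  set E := ⌈p⌉₊ with hE
  obtain ⟨D, hD, hsum⟩ := exists_sum_primeFactorProd_pow_le hC (k * E)
  refine ⟨B ^ p * (2 ^ (E - 1) * (D + D)), fun N _ => ?_⟩
  have hN : (0 : ℝ) < N := by exact_mod_cast Nat.pos_of_ne_zero (NeZero.ne N)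
  have hg : ∀ n, 1 ≤ primeFactorProd C n ^ k := fun n => one_le_pow₀ (one_le_primeFactorProd hC n)
  have hpoint : ∀ h : ZMod N, (B * shiftBound C k N h) ^ p ≤ B ^ p * (2 ^ (E - 1) *
      (primeFactorProd C h.val ^ (k * E) + primeFactorProd C (N - h.val) ^ (k * E))) := by
    intro h
    have h1 := hg h.val
    have h2 := hg (N - h.val)
    have hs : 1 ≤ shiftBound C k N h := by unfold shiftBound; linarith
    rw [Real.mul_rpow hB (by linarith)]
    refine mul_le_mul_of_nonneg_left ?_ (Real.rpow_nonneg hB p)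
    calc shiftBound C k N h ^ p ≤ shiftBound C k N h ^ (E : ℝ) :=
          Real.rpow_le_rpow_of_exponent_le hs (Nat.le_ceil p)
      _ = shiftBound C k N h ^ E := Real.rpow_natCast _ _
      _ ≤ _ := by
          rw [pow_mul, pow_mul]
          exact add_pow_le (by linarith) (by linarith) E
  calc _ ≤ 𝔼 h : ZMod N, B ^ p * (2 ^ (E - 1) *
        (primeFactorProd C h.val ^ (k * E) + primeFactorProd C (N - h.val) ^ (k * E))) :=
        Finset.expect_le_expect fun h _ => hpoint h
    _ = B ^ p * (2 ^ (E - 1) * ((∑ h : ZMod N, primeFactorProd C h.val ^ (k * E) +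
          ∑ h : ZMod N, primeFactorProd C (N - h.val) ^ (k * E)) / N)) := by
        rw [← Finset.mul_expect, ← Finset.mul_expect, Fintype.expect_eq_sum_div_card, ZMod.card,
          Finset.sum_add_distrib]
    _ ≤ B ^ p * (2 ^ (E - 1) * ((D * N + D * N) / N)) := by
        have h3 : ∑ h : ZMod N, primeFactorProd C h.val ^ (k * E) ≤ D * N := by
          refine (sum_zmod_val_le (φ := fun n => primeFactorProd C n ^ (k * E)) ?_).trans (hsum N)
          -- `Nat.primeFactors 0` is empty, so the product is empty at `0`.
          have : primeFactorProd C 0 = 1 := by simp [primeFactorProd]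
          rw [this, one_pow]
          exact one_le_pow₀ (one_le_primeFactorProd hC N)
        have h4 : ∑ h : ZMod N, primeFactorProd C (N - h.val) ^ (k * E) ≤ D * N :=
          (sum_zmod_sub_val fun n => primeFactorProd C n ^ (k * E)).trans_le (hsum N)
        have h5 : 0 ≤ B ^ p := Real.rpow_nonneg hB p
        gcongr
    _ = _ := by rw [← add_mul, mul_div_cancel_right₀ _ hN.ne']

/-- A prime factor `p ≥ 4^(1/ε)` contributes `4 ≤ p^ε`; the fewer than `p₀ + 1` smaller ones go into
the constant. -/
theorem exists_four_pow_omega_le {ε : ℝ} (hε : 0 < ε) :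
    ∃ D : ℝ, 1 ≤ D ∧ ∀ n : ℕ, n ≠ 0 → (4 : ℝ) ^ #n.primeFactors ≤ D * (n : ℝ) ^ ε := by
  set p₀ := ⌈(4 : ℝ) ^ (1 / ε)⌉₊ with hp₀
  refine ⟨4 ^ p₀, one_le_pow₀ (by norm_num), fun n hn => ?_⟩
  rw [← Finset.prod_const]
  have h1 : ∀ p ∈ n.primeFactors, (1 : ℝ) ≤ p := fun p hp => by
    exact_mod_cast (Nat.prime_of_mem_primeFactors hp).one_le
  refine le_trans (prod_le_const_mul_prod _ (F' := fun p : ℕ => (p : ℝ) ^ ε) (D := 4) (by norm_num)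
    (p₀ := p₀) (fun _ => by norm_num) (fun _ _ => le_rfl) ?_ ?_) ?_
  · intro p hp hpp
    have h2 : (4 : ℝ) ^ (1 / ε) ≤ p := (Nat.le_ceil _).trans (Nat.cast_le.2 hpp)
    calc (4 : ℝ) = ((4 : ℝ) ^ (1 / ε)) ^ ε := by
          rw [← Real.rpow_mul (by norm_num), one_div_mul_cancel hε.ne', Real.rpow_one]
      _ ≤ (p : ℝ) ^ ε := by gcongr
  · intro p hp; exact Real.one_le_rpow (h1 p hp) hε.le
  · rw [Real.finsetProd_rpow _ _ fun p _ => Nat.cast_nonneg p]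
    have h3 : ∏ p ∈ n.primeFactors, (p : ℝ) ≤ n := by
      rw [← Nat.cast_prod]
      exact Nat.cast_le.2
        (Nat.le_of_dvd (Nat.pos_of_ne_zero hn) (Nat.prod_primeFactors_dvd n))
    have h4 : (0 : ℝ) ≤ ∏ p ∈ n.primeFactors, (p : ℝ) :=
      Finset.prod_nonneg fun p _ => Nat.cast_nonneg p
    gcongr

theorem sq_smoothedDivisorSum_le {χ : ℝ → ℝ} (hχ : IsSmoothCutoff χ) {K : ℝ}
    (hK : ∀ x, |χ x| ≤ K) {R : ℝ} (hR : 1 < R) {n : ℕ} (hn : n ≠ 0) :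
    smoothedDivisorSum χ R n ^ 2 ≤ K ^ 2 * 4 ^ #n.primeFactors := by
  have hK0 : 0 ≤ K := (abs_nonneg _).trans (hK 0)
  have h1 : |smoothedDivisorSum χ R n| ≤ K * 2 ^ #n.primeFactors := by
    rw [smoothedDivisorSum_eq_sum hχ hR (P := n.primeFactors)
      (fun p hp => Nat.prime_of_mem_primeFactors hp) hn
      (fun p hp hpn _ => Nat.mem_primeFactors.2 ⟨hp, hpn, hn⟩)]
    have h2 : n.primeFactors.filter (· ∣ n) = n.primeFactors :=
      Finset.filter_true_of_mem fun p hp => Nat.dvd_of_mem_primeFactors hp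
    rw [h2]
    calc _ ≤ ∑ D ∈ n.primeFactors.powerset, |sieveCoeff χ (Real.log R) D| :=
          Finset.abs_sum_le_sum_abs _ _
      _ ≤ ∑ D ∈ n.primeFactors.powerset, K := by
          refine Finset.sum_le_sum fun D _ => ?_
          rw [sieveCoeff, abs_mul, abs_pow, abs_neg, abs_one, one_pow, one_mul]
          exact hK _
      _ = K * 2 ^ #n.primeFactors := by
          rw [Finset.sum_const, card_powerset, nsmul_eq_mul, mul_comm]; push_cast; rfl
  rw [← sq_abs]
  calc _ ≤ (K * 2 ^ #n.primeFactors) ^ 2 := by gcongr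
    _ = _ := by rw [mul_pow, ← pow_mul, mul_comm _ 2, pow_mul]; norm_num

/-- Since `Wx + b ≤ N²`, the divisor bound with exponent `ε/3` costs `N^(2ε/3)`, and the logarithm
costs the remaining `N^(ε/3)`. -/
theorem exists_sieveWeight_le {χ : ℝ → ℝ} (hχ : IsSmoothCutoff χ) {α : ℝ} (hα : 0 < α) {ε : ℝ}
    (hε : 0 < ε) : ∃ D : ℝ, 1 ≤ D ∧ ∀ (N w b : ℕ), 2 ≤ N → primorial w ≤ N → 0 < b →
      b < primorial w → ∀ x : ZMod N,
        sieveWeight χ ((N : ℝ) ^ α) (primorial w) b N x ≤ D * (N : ℝ) ^ ε := by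
  obtain ⟨K, hK1, hK⟩ := hχ.exists_bound
  obtain ⟨D, hD1, hD⟩ := exists_four_pow_omega_le (show 0 < ε / 3 by positivity)
  refine ⟨max 1 (α * (3 / ε) * (K ^ 2 * D)), le_max_left _ _, fun N w b hN hWN hb hbW x => ?_⟩
  have : NeZero N := ⟨by omega⟩
  have hN1 : (1 : ℝ) < N := by exact_mod_cast hN
  have hN0 : (0 : ℝ) < N := by linarith
  have hR1 : 1 < (N : ℝ) ^ α := Real.one_lt_rpow hN1 hα
  set n := primorial w * x.val + b with hn
  have hn0 : n ≠ 0 := by omega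
  have hnN : (n : ℝ) ≤ (N : ℝ) ^ (2 : ℝ) := by
    have h1 : n ≤ N ^ 2 := by
      have h2 := ZMod.val_lt x
      calc n ≤ primorial w * (x.val + 1) := by rw [hn, mul_add, mul_one]; omega
        _ ≤ N * N := Nat.mul_le_mul hWN h2
        _ = N ^ 2 := (sq N).symm
    rw [show (2 : ℝ) = ((2 : ℕ) : ℝ) by norm_num, Real.rpow_natCast]
    exact_mod_cast h1
  have h3 := sq_smoothedDivisorSum_le hχ hK hR1 hn0
  have h4 : (n : ℝ) ^ (ε / 3) ≤ (N : ℝ) ^ (2 * (ε / 3)) := by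
    rw [Real.rpow_mul hN0.le]; gcongr
  have h5 : Real.log ((N : ℝ) ^ α) ≤ α * ((N : ℝ) ^ (ε / 3) * (3 / ε)) := by
    rw [Real.log_rpow hN0]
    gcongr
    refine (Real.log_le_rpow_div hN0.le (show 0 < ε / 3 by positivity)).trans (le_of_eq ?_)
    field_simp
  have h6 : 0 ≤ Real.log ((N : ℝ) ^ α) := (Real.log_pos hR1).le
  have h7 := totDensity_le_one w
  have h8 := (totDensity_pos w).le
  rw [sieveWeight]
  change totDensity w * _ * _ ≤ _
  calc totDensity w * Real.log ((N : ℝ) ^ α) * smoothedDivisorSum χ ((N : ℝ) ^ α) n ^ 2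
      ≤ 1 * (α * ((N : ℝ) ^ (ε / 3) * (3 / ε))) * (K ^ 2 * (D * (N : ℝ) ^ (2 * (ε / 3)))) := by
        gcongr
        refine h3.trans ?_
        gcongr
        refine (hD n hn0).trans ?_
        gcongr
    _ = α * (3 / ε) * (K ^ 2 * D) * ((N : ℝ) ^ (ε / 3) * (N : ℝ) ^ (2 * (ε / 3))) := by ring
    _ = α * (3 / ε) * (K ^ 2 * D) * (N : ℝ) ^ ε := by
        rw [← Real.rpow_add hN0]; congr 2; ring
    _ ≤ _ := by gcongr; exact le_max_right _ _

end PrimeWeight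

namespace PrimeWeight

open Finset Filter Topology

/-! ### The restriction of the weight to large primes -/

theorem sieveWeight_nonneg {χ : ℝ → ℝ} {R : ℝ} (hR : 1 ≤ R) (W b N : ℕ) (x : ZMod N) :
    0 ≤ sieveWeight χ R W b N x := by
  have := Real.log_nonneg hR
  unfold sieveWeight
  positivity

theorem smoothedDivisorSum_prime {χ : ℝ → ℝ} (hχ : IsSmoothCutoff χ) {R : ℝ} (hR : 1 < R) {p : ℕ}
    (hp : p.Prime) (hpR : R < p) : smoothedDivisorSum χ R p = χ 0 := by
  have h1 : χ (Real.log p / Real.log R) = 0 := hχ.eq_zero_of_one_lt <| by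
    rw [lt_div_iff₀ (Real.log_pos hR), one_mul]
    exact Real.log_lt_log (by linarith) hpR
  rw [smoothedDivisorSum, Nat.Prime.sum_divisors hp, h1]
  simp

open Classical in
/-- The sieve weight restricted to those `x` for which `W x + b` is a prime larger than `R`. -/
noncomputable def primePart (χ : ℝ → ℝ) (R : ℝ) (W b N : ℕ) (x : ZMod N) : ℝ :=
  if (W * x.val + b).Prime ∧ R < (W * x.val + b : ℕ) then sieveWeight χ R W b N x else 0

theorem primePart_of_not_prime {χ : ℝ → ℝ} {R : ℝ} {W b N : ℕ} {x : ZMod N}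
    (h : ¬ (W * x.val + b).Prime) : primePart χ R W b N x = 0 :=
  if_neg fun h' => h h'.1

theorem primePart_nonneg {χ : ℝ → ℝ} {R : ℝ} (hR : 1 ≤ R) (W b N : ℕ) (x : ZMod N) :
    0 ≤ primePart χ R W b N x := by
  unfold primePart
  split_ifs
  · exact sieveWeight_nonneg hR W b N x
  · exact le_rfl

theorem primePart_le {χ : ℝ → ℝ} {R : ℝ} (hR : 1 ≤ R) (W b N : ℕ) (x : ZMod N) :
    primePart χ R W b N x ≤ sieveWeight χ R W b N x := by
  unfold primePart
  split_ifs
  · exact le_rfl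
  · exact sieveWeight_nonneg hR W b N x

theorem primePart_of_prime {χ : ℝ → ℝ} (hχ : IsSmoothCutoff χ) {R : ℝ} (hR : 1 < R) {w b N : ℕ}
    {x : ZMod N} (hp : (primorial w * x.val + b).Prime)
    (hpR : R < (primorial w * x.val + b : ℕ)) :
    primePart χ R (primorial w) b N x = totDensity w * Real.log R * χ 0 ^ 2 := by
  rw [primePart, if_pos ⟨hp, hpR⟩, sieveWeight, smoothedDivisorSum_prime hχ hR hp hpR]
  rfl

theorem primePart_le_log {χ : ℝ → ℝ} (hχ : IsSmoothCutoff χ) {R : ℝ} (hR : 1 < R) {w b N : ℕ}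
    (x : ZMod N) : primePart χ R (primorial w) b N x ≤ χ 0 ^ 2 * Real.log R := by
  have h1 := (Real.log_pos hR).le
  by_cases h : (primorial w * x.val + b).Prime ∧ R < (primorial w * x.val + b : ℕ)
  · rw [primePart_of_prime hχ hR h.1 h.2]
    calc _ ≤ 1 * Real.log R * χ 0 ^ 2 := by gcongr; exact totDensity_le_one w
      _ = _ := by ring
  · rw [primePart, if_neg h]; positivity

/-- Bertrand's postulate yields an odd prime `p` with `N < p ≤ 2N`, hit at `x = p / 2 < N`. This
secures a positive mean at the finitely many `N` outside the asymptotic range. -/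
theorem expect_primePart_pos {χ : ℝ → ℝ} (hχ : IsSmoothCutoff χ) {R : ℝ} (hR : 1 < R) {N : ℕ}
    [NeZero N] (hN : 2 ≤ N) (hRN : R ≤ N) : 0 < 𝔼 x, primePart χ R (primorial 2) 1 N x := by
  obtain ⟨p, hp, hNp, hpN⟩ := Nat.exists_prime_lt_and_le_two_mul N (by omega)
  have hodd : p % 2 = 1 := (hp.eq_two_or_odd).resolve_left (by omega)
  have hval : ((p / 2 : ℕ) : ZMod N).val = p / 2 := ZMod.val_cast_of_lt (by omega)
  have h2 : primorial 2 = 2 := by decide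
  have hx : primorial 2 * ((p / 2 : ℕ) : ZMod N).val + 1 = p := by rw [hval, h2]; omega
  refine Finset.expect_pos' (fun x _ => primePart_nonneg hR.le _ _ _ x)
    ⟨((p / 2 : ℕ) : ZMod N), mem_univ _, ?_⟩
  have hRp : R < p := hRN.trans_lt (by exact_mod_cast hNp)
  rw [primePart_of_prime hχ hR (by rwa [hx]) (by rwa [hx])]
  have := totDensity_pos 2
  have := Real.log_pos hR
  have := hχ.pos_zero
  positivity

/-! ### Choice of the residue class -/

/-- Primes above `M ≥ W` lie in the `φ(W)` reduced classes, so some class holds at least the average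
number; within a class a prime is determined by its quotient by `W`. -/
theorem exists_many_primes_residue {W N M : ℕ} (hW : 2 ≤ W) (hWM : W ≤ M) :
    ∃ b, 1 ≤ b ∧ b < W ∧ b.Coprime W ∧
      (#((Finset.Ioo M (W * N)).filter Nat.Prime) : ℝ) / W.totient ≤
        #((range N).filter fun x => (W * x + b).Prime ∧ M < W * x + b) := by
  set S := (Finset.Ioo M (W * N)).filter Nat.Prime with hS
  have hφ : 0 < W.totient := Nat.totient_pos.2 (by omega)
  have hmaps : ∀ p ∈ S, p % W ∈ (range W).filter W.Coprime := by
    intro p hp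
    obtain ⟨hp1, hp2⟩ := mem_filter.1 hp
    have hp3 := mem_Ioo.1 hp1
    refine mem_filter.2 ⟨mem_range.2 (Nat.mod_lt _ (by omega)), ?_⟩
    have h1 : W.Coprime p := ((Nat.Prime.coprime_iff_not_dvd hp2).2 fun h => by
      have := Nat.le_of_dvd (by omega) h
      omega).symm
    rw [Nat.Coprime, Nat.gcd_rec, Nat.gcd_comm] at h1
    exact h1
  obtain ⟨b, hb, hcard⟩ := Finset.exists_le_card_fiber_of_nsmul_le_card_of_maps_to
    (b := (#S : ℝ) / W.totient) hmaps
    ⟨1, mem_filter.2 ⟨mem_range.2 (by omega), Nat.coprime_one_right W⟩⟩ (by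
      rw [nsmul_eq_mul, ← Nat.totient_eq_card_coprime]
      exact (mul_div_cancel₀ _ (by positivity)).le)
  obtain ⟨hb1, hb2⟩ := mem_filter.1 hb
  refine ⟨b, ?_, mem_range.1 hb1, hb2.symm, hcard.trans ?_⟩
  · rcases Nat.eq_zero_or_pos b with rfl | h
    · rw [Nat.coprime_zero_right] at hb2; omega
    · exact h
  · refine Nat.cast_le.2 (Finset.card_le_card_of_injOn (fun p => p / W) ?_ ?_)
    · intro p hp
      obtain ⟨hp1, hp2⟩ := mem_filter.1 hp
      obtain ⟨hp3, hp4⟩ := mem_filter.1 hp1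
      have hp5 := mem_Ioo.1 hp3
      have h1 : W * (p / W) + b = p := by rw [← hp2]; exact Nat.div_add_mod p W
      refine mem_filter.2 ⟨mem_range.2 (Nat.div_lt_of_lt_mul hp5.2), ?_⟩
      simp only [h1]
      exact ⟨hp4, hp5.1⟩
    · intro p hp q hq h
      have hp2 := (mem_filter.1 hp).2
      have hq2 := (mem_filter.1 hq).2
      rw [← Nat.div_add_mod p W, ← Nat.div_add_mod q W, hp2, hq2]
      simp only at h
      rw [h]

/-- Chebyshev's lower bound for `π(n)`, less the integers up to `M`. The `2` bounds `log(n+1)/log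
n`, and `n` is not prime because the interval omits its endpoint. -/
theorem card_primes_Ioo_ge {n M : ℕ} (hn : 2 ≤ n) (hM : ¬ n.Prime) :
    (n : ℝ) * Real.log 2 / Real.log n - 2 - (M + 1) ≤ #((Finset.Ioo M n).filter Nat.Prime) := by
  have h1 := Chebyshev.pi_ge n
  have hn2 : (2 : ℝ) ≤ n := by exact_mod_cast hn
  have hlog : 0 < Real.log n := Real.log_pos (by linarith)
  have h2 : Nat.primeCounting n ≤ (M + 1) + #((Finset.Ioo M n).filter Nat.Prime) := by
    rw [Nat.primeCounting, Nat.primeCounting', Nat.count_eq_card_filter_range]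
    calc _ ≤ #(range (M + 1) ∪ (Finset.Ioo M n).filter Nat.Prime) := by
          refine card_le_card fun p hp => ?_
          obtain ⟨hp1, hp2⟩ := mem_filter.1 hp
          have hp3 := mem_range.1 hp1
          have hp4 : p ≠ n := fun h => hM (h ▸ hp2)
          rw [mem_union, mem_range, mem_filter, mem_Ioo]
          by_cases h : p < M + 1
          · exact Or.inl h
          · exact Or.inr ⟨⟨by omega, by omega⟩, hp2⟩
      _ ≤ _ := (card_union_le _ _).trans (by rw [card_range])
  have h3 : Real.log (n + 1) ≤ 2 * Real.log n := by
    rw [← Real.log_rpow (by linarith)]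
    refine Real.log_le_log (by linarith) ?_
    rw [Real.rpow_two]; nlinarith
  have h4 : ((Nat.primeCounting n : ℕ) : ℝ) ≤
      (M + 1) + #((Finset.Ioo M n).filter Nat.Prime) := by exact_mod_cast h2
  have h5 : (n : ℝ) * Real.log 2 / Real.log n - 2 ≤
      ((n : ℝ) * Real.log 2 - Real.log (n + 1)) / Real.log n := by
    rw [sub_div]
    have : Real.log (n + 1) / Real.log n ≤ 2 := (div_le_iff₀ hlog).2 h3
    linarith
  linarith

/-- The best class contains about `1/φ(W)` of the primes below `WN`, while the weight at a prime is
`(φ(W)/W) log R · χ(0)²`. The factors `φ(W)` cancel, leaving a bound independent of `w`. -/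
theorem exists_residue_le_expect {χ : ℝ → ℝ} (hχ : IsSmoothCutoff χ) {α : ℝ} (hα : 0 < α)
    (hα1 : α < 1) {w : ℕ} (hw : 2 ≤ w) : ∀ᶠ N : ℕ in atTop, ∃ b, 1 ≤ b ∧ b < primorial w ∧
      b.Coprime (primorial w) ∧ ∀ [Fact N.Prime],
        α * χ 0 ^ 2 / 4 ≤ 𝔼 x, primePart χ ((N : ℝ) ^ α) (primorial w) b N x := by
  set W := primorial w with hWdef
  have hW2 : 2 ≤ W := by
    have : primorial 2 ≤ primorial w := primorial_mono hw
    exact (show primorial 2 = 2 by decide) ▸ this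
  have hlim1 : Tendsto (fun N : ℕ => Real.log N * ((N : ℝ) ^ α) / N) atTop (𝓝 0) := by
    have h1 := (isLittleO_log_rpow_atTop (show 0 < 1 - α by linarith)).tendsto_div_nhds_zero.comp
      (tendsto_natCast_atTop_atTop (R := ℝ))
    refine h1.congr' ?_
    filter_upwards [eventually_gt_atTop 0] with N hN
    have hN : (0 : ℝ) < N := by exact_mod_cast hN
    simp only [Function.comp]
    rw [Real.rpow_sub hN, Real.rpow_one]
    field_simp
  have hlim2 : Tendsto (fun N : ℕ => Real.log N * (W + 5) / N) atTop (𝓝 0) := by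
    have h1 := (Real.isLittleO_log_id_atTop.tendsto_div_nhds_zero.comp
      (tendsto_natCast_atTop_atTop (R := ℝ))).mul_const ((W : ℝ) + 5)
    rw [zero_mul] at h1
    refine h1.congr fun N => ?_
    simp only [Function.comp, id]; ring
  filter_upwards [eventually_ge_atTop (max W 2),
    hlim1.eventually (gt_mem_nhds (show (0:ℝ) < 0.02 by norm_num)),
    hlim2.eventually (gt_mem_nhds (show (0:ℝ) < 0.02 by norm_num))] 
    with N hNW hN1 hN2
  have hNW' : W ≤ N := (le_max_left _ _).trans hNW
  have hN2' : 2 ≤ N := (le_max_right _ _).trans hNW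
  set R := (N : ℝ) ^ α with hR
  have hNr : (2 : ℝ) ≤ N := by exact_mod_cast hN2'
  have hR1 : 1 < R := Real.one_lt_rpow (by linarith) hα
  obtain ⟨b, hb1, hbW, hbc, hcard⟩ := exists_many_primes_residue (N := N) (M := ⌈R⌉₊ + W) hW2
    (Nat.le_add_left _ _)
  refine ⟨b, hb1, hbW, hbc, ?_⟩
  intro _
  have hS := card_primes_Ioo_ge (n := W * N) (M := ⌈R⌉₊ + W) (by nlinarith)
    (Nat.not_prime_mul (by omega) (by omega))
  set s : ℝ := (#((Finset.Ioo (⌈R⌉₊ + W) (W * N)).filter Nat.Prime) : ℝ)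
  set T := (range N).filter fun x => (W * x + b).Prime ∧ ⌈R⌉₊ + W < W * x + b with hT
  have hWr : (2 : ℝ) ≤ W := by exact_mod_cast hW2
  have hφ : (0 : ℝ) < W.totient := by exact_mod_cast Nat.totient_pos.2 (show 0 < W by omega)
  have hlogN : 0 < Real.log N := Real.log_pos (by linarith)
  have hlogR : Real.log R = α * Real.log N := Real.log_rpow (by linarith) _
  have hmain : (#T : ℝ) * (totDensity w * Real.log R * χ 0 ^ 2) ≤
      ∑ x : ZMod N, primePart χ R W b N x := by
    rw [← nsmul_eq_mul, ← Finset.sum_const]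
    have hval : ∀ x ∈ T, ((x : ℕ) : ZMod N).val = x := fun x hx =>
      ZMod.val_cast_of_lt (mem_range.1 (mem_filter.1 hx).1)
    calc _ = ∑ x ∈ T, primePart χ R W b N (x : ZMod N) := by
          refine Finset.sum_congr rfl fun x hx => ?_
          obtain ⟨-, hx1, hx2⟩ := mem_filter.1 hx
          rw [primePart_of_prime hχ hR1 (by rwa [hval x hx])]
          rw [hval x hx]
          refine (Nat.le_ceil R).trans_lt (Nat.cast_lt.2 ?_)
          exact (Nat.le_add_right _ W).trans_lt hx2
      _ = ∑ x ∈ T.image (fun x : ℕ => (x : ZMod N)), primePart χ R W b N x := by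
          rw [Finset.sum_image]
          intro x hx y hy h
          rw [← hval x hx, ← hval y hy]
          exact congrArg ZMod.val h
      _ ≤ _ := Finset.sum_le_sum_of_subset_of_nonneg (subset_univ _) fun x _ _ =>
          primePart_nonneg hR1.le _ _ _ x
  rw [Fintype.expect_eq_sum_div_card, ZMod.card, le_div_iff₀ (by linarith)]
  refine le_trans ?_ hmain
  have hdens : totDensity w = (W.totient : ℝ) / W := rfl
  have h1 : s / W * (α * Real.log N * χ 0 ^ 2) ≤
      (#T : ℝ) * (totDensity w * Real.log R * χ 0 ^ 2) := by
    rw [hlogR, hdens]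
    calc _ = s / W.totient * ((W.totient : ℝ) / W * (α * Real.log N) * χ 0 ^ 2) := by
          field_simp
      _ ≤ _ := by gcongr
  refine le_trans ?_ h1
  have h2 : Real.log ((W * N : ℕ) : ℝ) ≤ 2 * Real.log N := by
    rw [Nat.cast_mul, Real.log_mul (by linarith) (by linarith)]
    have : Real.log W ≤ Real.log N := Real.log_le_log (by linarith) (by exact_mod_cast hNW')
    linarith
  have h3 : 0 < Real.log ((W * N : ℕ) : ℝ) := by
    apply Real.log_pos; push_cast; nlinarith
  have h4 : (W * N : ℝ) * 0.69 / (2 * Real.log N) ≤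
      ((W * N : ℕ) : ℝ) * Real.log 2 / Real.log ((W * N : ℕ) : ℝ) := by
    push_cast at *
    gcongr
    have := Real.log_two_gt_d9; norm_num at *; linarith
  have h5 : (⌈R⌉₊ : ℝ) ≤ R + 1 := (Nat.ceil_lt_add_one (by linarith)).le
  have h6 : (W * N : ℝ) * 0.69 / (2 * Real.log N) - (R + W + 5) ≤ s := by
    push_cast at hS h4 ⊢; linarith
  have hN0 : (0 : ℝ) < N := by linarith
  have h7 : Real.log N * R ≤ 0.02 * N := by rw [← div_le_iff₀ hN0]; exact hN1.le
  have h8 : Real.log N * (W + 5) ≤ 0.02 * N := by rw [← div_le_iff₀ hN0]; exact hN2.le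
  -- Chebyshev with `log(WN) ≤ 2 log N` gives `0.345 WN`; the two errors of `0.02 N` total at most
  -- `0.02 WN` because `W ≥ 2`.
  have h9 : W * N * 0.3 ≤ Real.log N * s := by
    have := mul_le_mul_of_nonneg_left h6 hlogN.le
    have h10 : Real.log N * ((W * N : ℝ) * 0.69 / (2 * Real.log N) - (R + W + 5)) =
      (W * N : ℝ) * 0.345 - (Real.log N * R + Real.log N * (W + 5)) := by
      field_simp; ring
    have : (2 : ℝ) * N ≤ W * N := by gcongr
    linarith
  calc _ = (W * N * 0.25) * (α * χ 0 ^ 2 / W) := by field_simp; ring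
    _ ≤ (Real.log N * s) * (α * χ 0 ^ 2 / W) := by
        have : (W * N * 0.25 : ℝ) ≤ W * N * 0.3 := by gcongr; norm_num
        exact mul_le_mul_of_nonneg_right (this.trans h9) (by positivity)
    _ = _ := by ring

end PrimeWeight

namespace PrimeWeight

open Finset Filter Topology

/-! ### From correlation estimates to the correlation condition -/

theorem exists_forall_le_of_eventually_le {u : ℕ → ℝ} {D : ℝ} (h : ∀ᶠ N in atTop, u N ≤ D) :
    ∃ D', ∀ N, u N ≤ D' := by
  obtain ⟨D', hD'⟩ := (isBoundedUnder_of_eventually_le h).bddAbove_range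
  exact ⟨D', fun N => hD' (Set.mem_range_self N)⟩

/-- If the correlations of `ν` at distinct shifts are eventually controlled by the arithmetic
factors, and `ν` is bounded by all small powers of `N`, then some `τ` with bounded moments controls
all correlations; for at least two shifts, the pairs `i < j` suffice. -/
theorem exists_correlation_majorant {ν : ∀ N : ℕ, ZMod N → ℝ}
    (hν : ∀ (N : ℕ) [NeZero N] (x : ZMod N), 0 ≤ ν N x) {C : ℝ} (hC : 1 ≤ C) (q₀ k : ℕ)
    (hsub : ∀ ε : ℝ, 0 < ε → ∃ D : ℝ, 1 ≤ D ∧ ∀ᶠ N : ℕ in atTop, ∀ x, ν N x ≤ D * (N : ℝ) ^ ε)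
    (hcorr : ∀ᶠ N : ℕ in atTop, ∀ [Fact N.Prime], ∀ q ≤ q₀, ∀ h : Fin q → ZMod N,
      Function.Injective h → 𝔼 x, ∏ i, ν N (x + h i) ≤
        C * (1 + ∑ e ∈ ltPairs q, shiftBound C k N (h e.1 - h e.2))) :
    ∃ τ : ∀ N : ℕ, ZMod N → ℝ,
      (∀ (N : ℕ) [Fact N.Prime] (x : ZMod N), 0 ≤ τ N x) ∧
      (∀ p : ℝ, 1 ≤ p → ∃ D : ℝ, ∀ (N : ℕ) [Fact N.Prime], (𝔼 x : ZMod N, τ N x ^ p) ≤ D) ∧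
      (∀ (N : ℕ) [Fact N.Prime], 1 ≤ q₀ → 𝔼 x, ν N x ≤ τ N 0) ∧
      (∀ (N : ℕ) [Fact N.Prime] (q : ℕ), 2 ≤ q → q ≤ q₀ → ∀ h : Fin q → ZMod N,
        (𝔼 x : ZMod N, ∏ i, ν N (x + h i)) ≤ ∑ e ∈ ltPairs q, τ N (h e.1 - h e.2)) := by
  -- The trivial bound for any correlation of at most `q₀` factors; it becomes the value of `τ` at
  -- `0`.
  set T : ℕ → ℝ := fun N => (1 + ⨆ x, ν N x) ^ q₀ with hT
  have hle : ∀ (N : ℕ) [NeZero N] (x : ZMod N), ν N x ≤ ⨆ x, ν N x := fun N _ x =>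
    le_ciSup (Set.finite_range _).bddAbove x
  have hsup : ∀ (N : ℕ) [NeZero N], 0 ≤ ⨆ x, ν N x := fun N _ => (hν N 0).trans (hle N 0)
  have hT1 : ∀ (N : ℕ) [NeZero N], 1 ≤ T N := fun N _ => one_le_pow₀ (by linarith [hsup N])
  have htriv : ∀ (N : ℕ) [NeZero N] (q : ℕ), q ≤ q₀ → ∀ h : Fin q → ZMod N,
      𝔼 x, ∏ i, ν N (x + h i) ≤ T N := by
    intro N _ q hq h
    refine Finset.expect_le univ_nonempty fun x _ => ?_
    calc _ ≤ ∏ _i : Fin q, (1 + ⨆ x, ν N x) :=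
          Finset.prod_le_prod (fun i _ => hν N _) fun i _ => by linarith [hle N (x + h i)]
      _ = (1 + ⨆ x, ν N x) ^ q := by rw [Finset.prod_const, card_univ, Fintype.card_fin]
      _ ≤ T N := pow_le_pow_right₀ (by linarith [hsup N]) hq
  obtain ⟨N₁, hN₁⟩ := eventually_atTop.1 hcorr
  obtain ⟨K, hK⟩ : ∃ K, ∀ N, (if N < N₁ then T N else 0) ≤ K :=
    exists_forall_le_of_eventually_le (D := 0) <| by
      filter_upwards [eventually_ge_atTop N₁] with N hN
      rw [if_neg (by omega)]
  -- `K` covers the finitely many `N` below the asymptotic range by the trivial bound, and `2 * C`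
  -- absorbs the summand `1` in the correlation estimate, since every `shiftBound` is at least `1`.
  set B : ℝ := max (2 * C) K with hB
  have hB0 : 0 ≤ B := le_trans (by linarith) (le_max_left _ _)
  have hC0 : 0 ≤ C := by linarith
  have hshift : ∀ (N : ℕ) (h : ZMod N), 1 ≤ shiftBound C k N h := fun N h => by
    have h1 : 1 ≤ primeFactorProd C h.val ^ k := one_le_pow₀ (one_le_primeFactorProd hC0 _)
    have h2 : 1 ≤ primeFactorProd C (N - h.val) ^ k := one_le_pow₀ (one_le_primeFactorProd hC0 _)
    unfold shiftBound; linarith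
  have hpos : ∀ (N : ℕ) (h : ZMod N), 0 ≤ B * shiftBound C k N h := fun N h =>
    mul_nonneg hB0 (by linarith [hshift N h])
  classical
  have hτ0 : ∀ (N : ℕ) [Fact N.Prime] (x : ZMod N),
      0 ≤ if x = 0 then T N else B * shiftBound C k N x := fun N _ x => by
    split_ifs
    · linarith [hT1 N]
    · exact hpos N x
  refine ⟨fun N h => if h = 0 then T N else B * shiftBound C k N h, hτ0, ?_, ?_, ?_⟩
  · intro p hp
    obtain ⟨D₁, hD₁⟩ := exists_moment_shiftBound_le hC0 hB0 k p
    -- With this exponent `T N ^ p` is `O(N^(q₀/(q₀+1)))`, so the single point `0` adds a bounded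
    -- amount to the mean.
    obtain ⟨D, hD1, hD⟩ := hsub (1 / ((q₀ + 1) * p)) (by positivity)
    obtain ⟨D₂, hD₂⟩ : ∃ D₂, ∀ N, T N ^ p / N ≤ D₂ := by
      refine exists_forall_le_of_eventually_le (D := ((2 * D) ^ q₀) ^ p) ?_
      filter_upwards [hD, eventually_ge_atTop 1] with N hN hN1
      have : NeZero N := ⟨by omega⟩
      have hN1' : (1 : ℝ) ≤ N := by exact_mod_cast hN1
      have h1 : 1 ≤ (N : ℝ) ^ (1 / ((q₀ + 1) * p)) := Real.one_le_rpow hN1' (by positivity)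
      have h2 : 1 + ⨆ x, ν N x ≤ 2 * D * (N : ℝ) ^ (1 / ((q₀ + 1) * p)) := by
        have : ⨆ x, ν N x ≤ D * (N : ℝ) ^ (1 / ((q₀ + 1) * p)) := ciSup_le hN
        nlinarith
      have h3 : T N ≤ (2 * D) ^ q₀ * ((N : ℝ) ^ (1 / ((q₀ + 1) * p))) ^ q₀ := by
        rw [← mul_pow]
        exact pow_le_pow_left₀ (by linarith [hsup N]) h2 q₀
      rw [div_le_iff₀ (by linarith)]
      calc T N ^ p ≤ ((2 * D) ^ q₀ * ((N : ℝ) ^ (1 / ((q₀ + 1) * p))) ^ q₀) ^ p :=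
            Real.rpow_le_rpow (by linarith [hT1 N]) h3 (by linarith)
        _ = ((2 * D) ^ q₀) ^ p * (N : ℝ) ^ ((1 / ((q₀ + 1) * p)) * q₀ * p) := by
            rw [Real.mul_rpow (by positivity) (by positivity), ← Real.rpow_natCast _ q₀,
              ← Real.rpow_mul (by linarith), ← Real.rpow_natCast (_ ^ _) q₀,
              ← Real.rpow_mul (by linarith), ← Real.rpow_mul (by linarith), mul_assoc (1 / _)]
        _ ≤ ((2 * D) ^ q₀) ^ p * (N : ℝ) ^ (1 : ℝ) := by
            have h4 : (1 / ((q₀ + 1) * p)) * q₀ * p ≤ 1 := by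
              have : (1 / ((q₀ + 1) * p)) * q₀ * p = q₀ / (q₀ + 1) := by field_simp
              rw [this, div_le_one (by positivity)]; linarith
            gcongr
        _ = _ := by rw [Real.rpow_one]
    refine ⟨D₁ + D₂, fun N _ => ?_⟩
    have hpoint : ∀ h : ZMod N, (if h = 0 then T N else B * shiftBound C k N h) ^ p ≤
        (B * shiftBound C k N h) ^ p + if h = 0 then T N ^ p else 0 := fun h => by
      split_ifs
      · linarith [Real.rpow_nonneg (hpos N h) p]
      · linarith
    refine (Finset.expect_le_expect fun h _ => hpoint h).trans ?_
    rw [Finset.expect_add_distrib]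
    refine add_le_add (hD₁ N) (le_of_eq_of_le ?_ (hD₂ N))
    rw [Fintype.expect_eq_sum_div_card, ZMod.card, Finset.sum_ite_eq', if_pos (mem_univ _)]
  · intro N _ hq₀
    refine le_of_le_of_eq ?_ (if_pos rfl).symm
    have := htriv N 1 hq₀ fun _ => 0
    simpa using this
  · intro N _ q hq hqq h
    have hmem : ((⟨0, by omega⟩, ⟨1, by omega⟩) : Fin q × Fin q) ∈ ltPairs q :=
      mem_filter.2 ⟨mem_univ _, by simp⟩
    have hsingle : ∀ e ∈ ltPairs q,
        T N ≤ (if h e.1 - h e.2 = 0 then T N else B * shiftBound C k N (h e.1 - h e.2)) →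
        𝔼 x, ∏ i, ν N (x + h i) ≤ ∑ e ∈ ltPairs q,
          if h e.1 - h e.2 = 0 then T N else B * shiftBound C k N (h e.1 - h e.2) :=
      fun e he hTe => (htriv N q hqq h).trans (hTe.trans
        (Finset.single_le_sum (f := fun e : Fin q × Fin q =>
          if h e.1 - h e.2 = 0 then T N else B * shiftBound C k N (h e.1 - h e.2))
          (fun e _ => hτ0 N _) he))
    by_cases hinj : Function.Injective h
    · have hne : ∀ e ∈ ltPairs q, h e.1 - h e.2 ≠ 0 := fun e he h0 =>
        (mem_filter.1 he).2.ne (hinj (sub_eq_zero.1 h0))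
      by_cases hN : N < N₁
      · refine hsingle _ hmem ?_
        rw [if_neg (hne _ hmem)]
        have h1 : T N ≤ K := by simpa [hN] using hK N
        have h2 := hshift N (h ⟨0, by omega⟩ - h ⟨1, by omega⟩)
        have h3 : T N ≤ B := h1.trans (le_max_right _ _)
        nlinarith
      · refine (hN₁ N (not_lt.1 hN) q hqq h hinj).trans ?_
        have h1 : (1 : ℝ) ≤ ∑ e ∈ ltPairs q, shiftBound C k N (h e.1 - h e.2) :=
          (hshift N _).trans (Finset.single_le_sum
            (f := fun e : Fin q × Fin q => shiftBound C k N (h e.1 - h e.2))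
            (fun e _ => by linarith [hshift N (h e.1 - h e.2)]) hmem)
        calc _ ≤ 2 * C * ∑ e ∈ ltPairs q, shiftBound C k N (h e.1 - h e.2) := by nlinarith
          _ ≤ B * ∑ e ∈ ltPairs q, shiftBound C k N (h e.1 - h e.2) := by
              gcongr; exact le_max_left _ _
          _ = _ := by
              rw [Finset.mul_sum]
              exact Finset.sum_congr rfl fun e he => (if_neg (hne e he)).symm
    · obtain ⟨i, j, hij, hne⟩ := Function.not_injective_iff.1 hinj
      rcases lt_or_gt_of_ne hne with hlt | hlt
      · refine hsingle (i, j) (mem_filter.2 ⟨mem_univ _, hlt⟩) ?_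
        simp [hij]
      · refine hsingle (j, i) (mem_filter.2 ⟨mem_univ _, hlt⟩) ?_
        simp [hij]

theorem sum_ltPairs_le {q : ℕ} {g : Fin q → Fin q → ℝ} (hg : ∀ i j, 0 ≤ g i j) :
    ∑ e ∈ ltPairs q, g e.1 e.2 ≤ ∑ i, ∑ j ∈ Finset.Ici i, g i j := by
  rw [ltPairs, Finset.sum_filter, Fintype.sum_prod_type]
  refine Finset.sum_le_sum fun i _ => ?_
  rw [← Finset.sum_filter]
  exact Finset.sum_le_sum_of_subset_of_nonneg
    (fun j hj => mem_Ici.2 (mem_filter.1 hj).2.le) fun j _ _ => hg i j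

theorem correlationCondition_of_correlation_bound {ν : ∀ N : ℕ, ZMod N → ℝ}
    (hν : ∀ (N : ℕ) [NeZero N] (x : ZMod N), 0 ≤ ν N x) {C : ℝ} (hC : 1 ≤ C) (q₀ k : ℕ)
    (hsub : ∀ ε : ℝ, 0 < ε → ∃ D : ℝ, 1 ≤ D ∧ ∀ᶠ N : ℕ in atTop, ∀ x, ν N x ≤ D * (N : ℝ) ^ ε)
    (hcorr : ∀ᶠ N : ℕ in atTop, ∀ [Fact N.Prime], ∀ q ≤ q₀, ∀ h : Fin q → ZMod N,
      Function.Injective h → 𝔼 x, ∏ i, ν N (x + h i) ≤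
        C * (1 + ∑ e ∈ ltPairs q, shiftBound C k N (h e.1 - h e.2))) :
    CorrelationCondition q₀ ν := by
  obtain ⟨τ, hτ, hmom, hone, hpairs⟩ := exists_correlation_majorant hν hC q₀ k hsub hcorr
  refine ⟨τ, hτ, hmom, fun N _ q hq1 hq h => ?_⟩
  -- For one shift the only pair is diagonal, so `τ 0` must bound the mean of `ν`; for two or more
  -- the strict pairs suffice and the diagonal is discarded.
  rcases hq1.eq_or_lt with rfl | hq2
  · have h1 : 𝔼 x, ν N (x + h 0) = 𝔼 x, ν N x :=
      Fintype.expect_equiv (Equiv.addRight (h 0)) _ _ fun x => rfl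
    have h2 := hone N hq
    rw [← h1] at h2
    simpa [Finset.sum_eq_single_of_mem (0 : Fin 1)] using h2
  · exact (hpairs N q hq2 hq h).trans (sum_ltPairs_le fun i j => hτ N (h i - h j))

/-! ### Choice of the parameters -/

/-- Take `w N` to be the largest admissible `k ≤ N` whose threshold has been passed. No rate is
needed, so thresholds depending arbitrarily on `w` are allowed. -/
theorem exists_tendsto_eventually_diagonal {P : ℕ → ℕ → Prop}
    (h : ∀ᶠ w in atTop, ∀ᶠ N in atTop, P w N) :
    ∃ w : ℕ → ℕ, Tendsto w atTop atTop ∧ ∀ᶠ N in atTop, P (w N) N := by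
  classical
  obtain ⟨w₀, hw₀⟩ := eventually_atTop.1 h
  choose! N₀ hN₀ using fun w hw => eventually_atTop.1 (hw₀ w hw)
  refine ⟨fun N => Nat.findGreatest (fun k => w₀ ≤ k ∧ N₀ k ≤ N) N, ?_, ?_⟩
  · refine tendsto_atTop.2 fun K => ?_
    filter_upwards [eventually_ge_atTop (max (max K w₀) (N₀ (max K w₀)))] with N hN
    exact (le_max_left K w₀).trans (Nat.le_findGreatest ((le_max_left _ _).trans hN)
      ⟨le_max_right _ _, (le_max_right _ _).trans hN⟩)
  · filter_upwards [eventually_ge_atTop (max w₀ (N₀ w₀))] with N hN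
    obtain ⟨h1, h2⟩ := Nat.findGreatest_spec (P := fun k => w₀ ≤ k ∧ N₀ k ≤ N)
      ((le_max_left _ _).trans hN) ⟨le_rfl, (le_max_right _ _).trans hN⟩
    exact hN₀ _ h1 N h2

/-- The properties of the parameters `w`, `b` at `N` from which the theorem is derived. -/
structure IsGoodParameter (χ : ℝ → ℝ) (α C : ℝ) (m₀ t L q₀ N w b : ℕ) : Prop where
  one_le : 1 ≤ b
  lt_primorial : b < primorial w
  coprime : b.Coprime (primorial w)
  primorial_le : primorial w ≤ N
  le_log_log : (w : ℝ) ≤ Real.log (Real.log N)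
  linearForms : ∀ [Fact N.Prime], ∀ m ≤ m₀, ∀ (A : Fin m → Fin t → ℤ) (c : Fin m → ZMod N),
    (∀ i j, |A i j| ≤ L) → (∀ i, A i ≠ 0) →
    (∀ i i', i ≠ i' → LinearIndependent ℤ ![A i, A i']) →
    |(𝔼 x : Fin t → ZMod N, ∏ i,
      sieveWeight χ ((N : ℝ) ^ α) (primorial w) b N (formValue A c x i)) - 1| ≤ C / w
  correlation : ∀ [Fact N.Prime], ∀ q ≤ q₀, ∀ h : Fin q → ZMod N, Function.Injective h →
    𝔼 x : ZMod N, ∏ i, sieveWeight χ ((N : ℝ) ^ α) (primorial w) b N (x + h i) ≤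
      C * (1 + ∑ e ∈ ltPairs q, shiftBound C (q₀ ^ 2) N (h e.1 - h e.2))
  le_expect : ∀ [Fact N.Prime], α * χ 0 ^ 2 / 4 ≤
    𝔼 x, primePart χ ((N : ℝ) ^ α) (primorial w) b N x

theorem shiftBound_mono {C C' : ℝ} (hC : 0 ≤ C) (h : C ≤ C') (k N : ℕ) (x : ZMod N) :
    shiftBound C k N x ≤ shiftBound C' k N x := by
  have hmono : ∀ l, primeFactorProd C l ≤ primeFactorProd C' l := fun l => by
    refine Finset.prod_le_prod (fun p _ => by linarith [one_le_one_add_div hC p]) fun p _ => ?_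
    gcongr
  have h0 : ∀ l, 0 ≤ primeFactorProd C l := fun l => by linarith [one_le_primeFactorProd hC l]
  exact add_le_add (pow_le_pow_left₀ (h0 _) (hmono _) k) (pow_le_pow_left₀ (h0 _) (hmono _) k)

/-- Requiring each estimate for all large `C` yields one constant for the finitely many `m ≤ m₀` and
`q ≤ q₀`. With `w` fixed, `primorial w ≤ N` and `w ≤ log log N` are further conditions met by large
`N`. -/
theorem eventually_isGoodParameter {χ : ℝ → ℝ} (hχ : IsSmoothCutoff χ) {α : ℝ} (hα : 0 < α)
    (hα1 : α < 1) (m₀ t L q₀ : ℕ) (hm : 8 * m₀ * α ≤ 1) (hq : 8 * q₀ * α ≤ 1) :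
    ∃ C : ℝ, 1 ≤ C ∧ ∀ᶠ w in atTop, ∀ᶠ N in atTop,
      ∃ b, IsGoodParameter χ α C m₀ t L q₀ N w b := by
  have hforms : ∀ᶠ C : ℝ in atTop, ∀ m ∈ range (m₀ + 1), ∀ᶠ w : ℕ in atTop, ∀ᶠ N : ℕ in atTop,
      ∀ [Fact N.Prime], ∀ b : ℕ, 0 < b → Nat.Coprime b (primorial w) →
      ∀ (A : Fin m → Fin t → ℤ) (c : Fin m → ZMod N), (∀ i j, |A i j| ≤ L) →
        (∀ i, A i ≠ 0) → (∀ i i', i ≠ i' → LinearIndependent ℤ ![A i, A i']) →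
        |(𝔼 x : Fin t → ZMod N, ∏ i,
            sieveWeight χ ((N : ℝ) ^ α) (primorial w) b N (formValue A c x i)) - 1| ≤ C / w := by
    rw [eventually_all_finset]
    intro m hmm
    have hm' : (m : ℝ) ≤ m₀ := by exact_mod_cast Nat.lt_succ_iff.1 (mem_range.1 hmm)
    obtain ⟨C₀, hC₀, w₀, h⟩ := exists_linearForms_bound hχ hα m t L
      (le_trans (by gcongr) hm)
    filter_upwards [eventually_ge_atTop C₀] with C hC
    filter_upwards [eventually_ge_atTop w₀] with w hw
    filter_upwards [h w hw] with N hN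
    intro _ b hb hbW A c hA1 hA2 hA3
    exact (hN b hb hbW A c hA1 hA2 hA3).trans (by gcongr)
  have hcorr : ∀ᶠ C : ℝ in atTop, ∀ q ∈ range (q₀ + 1), ∀ᶠ w : ℕ in atTop, ∀ᶠ N : ℕ in atTop,
      ∀ [Fact N.Prime], ∀ b : ℕ, 0 < b → Nat.Coprime b (primorial w) →
      ∀ h : Fin q → ZMod N, Function.Injective h →
        𝔼 x : ZMod N, ∏ i, sieveWeight χ ((N : ℝ) ^ α) (primorial w) b N (x + h i) ≤
          C * (1 + ∑ e ∈ ltPairs q, shiftBound C (q₀ ^ 2) N (h e.1 - h e.2)) := by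
    rw [eventually_all_finset]
    intro q hqq
    have hq1 : q ≤ q₀ := Nat.lt_succ_iff.1 (mem_range.1 hqq)
    have hq' : (q : ℝ) ≤ q₀ := by exact_mod_cast hq1
    obtain ⟨C₀, hC₀, w₀, h⟩ := exists_correlation_bound hχ hα q (le_trans (by gcongr) hq)
    filter_upwards [eventually_ge_atTop C₀] with C hC
    filter_upwards [eventually_ge_atTop w₀] with w hw
    filter_upwards [h w hw] with N hN
    intro _ b hb hbW h hinj
    refine (hN b hb hbW h hinj (q₀ ^ 2) (Nat.pow_le_pow_left hq1 2)).trans ?_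
    have hC0 : 0 ≤ C := by linarith
    have h0 : 0 ≤ ∑ e ∈ ltPairs q, shiftBound C₀ (q₀ ^ 2) N (h e.1 - h e.2) :=
      Finset.sum_nonneg fun e _ => shiftBound_nonneg (by linarith) _ _ _
    gcongr with e he
    exact shiftBound_mono (by linarith) hC _ _ _
  obtain ⟨C, hC1, hC2, hC3⟩ := (hforms.and (hcorr.and (eventually_ge_atTop (1 : ℝ)))).exists
  refine ⟨C, hC3, ?_⟩
  rw [← eventually_all_finset] at hC1 hC2
  filter_upwards [hC1, hC2, eventually_ge_atTop 2] with w hw1 hw2 hw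
  have hloglog : Tendsto (fun N : ℕ => Real.log (Real.log N)) atTop atTop :=
    Real.tendsto_log_atTop.comp (Real.tendsto_log_atTop.comp tendsto_natCast_atTop_atTop)
  rw [← eventually_all_finset] at hw1 hw2
  filter_upwards [hw1, hw2, exists_residue_le_expect hχ hα hα1 hw,
    eventually_ge_atTop (primorial w), hloglog.eventually_ge_atTop (w : ℝ)]
    with N hN1 hN2 ⟨b, hb1, hb2, hb3, hb4⟩ hN3 hN4
  exact ⟨b, hb1, hb2, hb3, hN3, hN4,
    fun m hm A c => hN1 m (mem_range.2 (Nat.lt_succ_of_le hm)) b hb1 hb3 A c,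
    fun q hq h => hN2 q (mem_range.2 (Nat.lt_succ_of_le hq)) b hb1 hb3 h, hb4⟩

theorem exists_parameters {χ : ℝ → ℝ} (hχ : IsSmoothCutoff χ) {α : ℝ} (hα : 0 < α)
    (hα1 : α < 1) (m₀ t L q₀ : ℕ) (hm : 8 * m₀ * α ≤ 1) (hq : 8 * q₀ * α ≤ 1) :
    ∃ C : ℝ, 1 ≤ C ∧ ∃ w b : ℕ → ℕ, Tendsto w atTop atTop ∧
      (∀ᶠ N in atTop, IsGoodParameter χ α C m₀ t L q₀ N (w N) (b N)) ∧
      (∀ N, 1 ≤ b N ∧ b N < primorial (w N) ∧ (b N).Coprime (primorial (w N))) ∧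
      ∃ δ : ℝ, 0 < δ ∧ ∀ (N : ℕ) [Fact N.Prime],
        δ ≤ 𝔼 x, primePart χ ((N : ℝ) ^ α) (primorial (w N)) (b N) N x := by
  obtain ⟨C, hC, hgood⟩ := eventually_isGoodParameter hχ hα hα1 m₀ t L q₀ hm hq
  obtain ⟨w, hw, hP⟩ := exists_tendsto_eventually_diagonal hgood
  obtain ⟨N₁, hN₁⟩ := eventually_atTop.1 hP
  choose! b hb using hN₁
  have hχ0 := hχ.pos_zero
  -- Below `N₁` the parameters are reset to `w = 2`, `b = 1`; `δ` must lie below finitely many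
  -- positive means.
  have hsmall : ∀ᶠ δ : ℝ in 𝓝[>] 0, ∀ N ∈ range N₁, ∀ [Fact N.Prime],
      δ ≤ 𝔼 x, primePart χ ((N : ℝ) ^ α) (primorial 2) 1 N x := by
    rw [eventually_all_finset]
    intro N _
    by_cases hN : N.Prime
    · have : Fact N.Prime := ⟨hN⟩
      have hN1 : (1 : ℝ) < N := by exact_mod_cast hN.one_lt
      have hpos := expect_primePart_pos hχ (Real.one_lt_rpow hN1 hα) hN.two_le
        (Real.rpow_le_self_of_one_le hN1.le hα1.le)
      filter_upwards [Ioc_mem_nhdsGT hpos] with δ hδ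
      exact hδ.2
    · exact Eventually.of_forall fun δ h => absurd h.out hN
  obtain ⟨δ, hδ, hδ0⟩ := (hsmall.and self_mem_nhdsWithin).exists
  have hlarge : ∀ N, N₁ ≤ N → IsGoodParameter χ α C m₀ t L q₀ N
      (if N < N₁ then 2 else w N) (if N < N₁ then 1 else b N) := fun N hN => by
    rw [if_neg (by omega), if_neg (by omega)]; exact hb N hN
  refine ⟨C, hC, fun N => if N < N₁ then 2 else w N, fun N => if N < N₁ then 1 else b N,
    hw.congr' ?_, eventually_atTop.2 ⟨N₁, hlarge⟩, fun N => ?_, min δ (α * χ 0 ^ 2 / 4),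
    lt_min hδ0 (by positivity), fun N _ => ?_⟩
  · filter_upwards [eventually_ge_atTop N₁] with N hN
    rw [if_neg (by omega)]
  · by_cases hN : N < N₁
    · simp only [if_pos hN]; decide
    · have := hlarge N (not_lt.1 hN)
      exact ⟨this.one_le, this.lt_primorial, this.coprime⟩
  · by_cases hN : N < N₁
    · simp only [if_pos hN]
      exact (min_le_left _ _).trans (hδ N (mem_range.2 hN))
    · exact (min_le_right _ _).trans (hlarge N (not_lt.1 hN)).le_expect

end PrimeWeight

/-! ### Assembly of the weight and the function. -/

theorem mainTheorem3 (m₀ t L q₀ : ℕ) :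
    ∃ (χ : ℝ → ℝ) (w b : ℕ → ℕ) (α δ C : ℝ) (ν f : ∀ N : ℕ, ZMod N → ℝ),
      PrimeWeight.IsSmoothCutoff χ ∧
      Filter.Tendsto w Filter.atTop Filter.atTop ∧
      (fun N : ℕ => (w N : ℝ)) =O[Filter.atTop] (fun N : ℕ => Real.log (Real.log N)) ∧
      0 < α ∧ α < 1 ∧ 0 < δ ∧
      PrimeWeight.IsPseudorandomWeight m₀ t L q₀ ν ∧
      ∀ (N : ℕ) [Fact N.Prime],
        1 ≤ b N ∧ b N < primorial (w N) ∧ Nat.Coprime (b N) (primorial (w N)) ∧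
        (∀ x : ZMod N,
          ν N x = PrimeWeight.sieveWeight χ ((N : ℝ) ^ α) (primorial (w N)) (b N) N x) ∧
        (∀ x : ZMod N, ¬ (primorial (w N) * x.val + b N).Prime → f N x = 0) ∧
        (∀ x : ZMod N, 0 ≤ f N x ∧ f N x ≤ ν N x) ∧
        δ ≤ (𝔼 x : ZMod N, f N x) ∧
        (∀ x : ZMod N, |f N x| ≤ C * Real.log N) := by
  obtain ⟨χ, hχ⟩ := PrimeWeight.exists_isSmoothCutoff
  -- This gives `8 m₀ α ≤ 1` and `8 q₀ α ≤ 1` together; the `+ 1` keeps `α < 1` when both parameters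
  -- vanish.
  set α : ℝ := 1 / (8 * (m₀ + q₀ + 1)) with hα
  have hα0 : 0 < α := by positivity
  have hαle : 8 * (m₀ + q₀ + 1) * α ≤ 1 := by rw [hα]; field_simp; exact le_rfl
  have hα1 : α < 1 := by nlinarith
  obtain ⟨C, hC, w, b, hw, hgood, hb, δ, hδ, hdens⟩ := PrimeWeight.exists_parameters hχ hα0 hα1
    m₀ t L q₀ (by nlinarith) (by nlinarith)
  have hR : ∀ (N : ℕ) [NeZero N], 1 ≤ (N : ℝ) ^ α := fun N _ =>
    Real.one_le_rpow (by exact_mod_cast NeZero.one_le) hα0.le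
  have hnonneg : ∀ (N : ℕ) [NeZero N] (x : ZMod N), 0 ≤
      PrimeWeight.sieveWeight χ ((N : ℝ) ^ α) (primorial (w N)) (b N) N x := fun N _ x =>
    PrimeWeight.sieveWeight_nonneg (hR N) _ _ _ x
  -- The last constant comes from `log R = α log N` and the value `χ(0)` of the divisor sum at
  -- primes exceeding `R`.
  refine ⟨χ, w, b, α, δ, χ 0 ^ 2 * α,
    fun N x => PrimeWeight.sieveWeight χ ((N : ℝ) ^ α) (primorial (w N)) (b N) N x,
    fun N x => PrimeWeight.primePart χ ((N : ℝ) ^ α) (primorial (w N)) (b N) N x,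
    hχ, hw, ?_, hα0, hα1, hδ, ⟨fun N _ x => hnonneg N x, ?_, ?_⟩, fun N _ =>
      ⟨(hb N).1, (hb N).2.1, (hb N).2.2, fun x => rfl,
        fun x hx => PrimeWeight.primePart_of_not_prime hx,
        fun x => ⟨PrimeWeight.primePart_nonneg (hR N) _ _ _ x,
          PrimeWeight.primePart_le (hR N) _ _ _ x⟩, hdens N, fun x => ?_⟩⟩
  · refine Asymptotics.IsBigO.of_bound 1 ?_
    filter_upwards [hgood] with N hN
    rw [one_mul, Real.norm_natCast]
    exact hN.le_log_log.trans (le_abs_self _)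
  · intro ε hε
    obtain ⟨N₀, hN₀⟩ := Filter.eventually_atTop.1
      (hgood.and (hw.eventually_ge_atTop (⌈C / ε⌉₊ + 1)))
    refine ⟨N₀, fun N _ hN m hm A c hA1 hA2 hA3 => ?_⟩
    obtain ⟨h1, h2⟩ := hN₀ N hN
    refine (h1.linearForms m hm A (fun i => (c i : ZMod N)) hA1 hA2 hA3).trans ?_
    have h3 : C / ε ≤ w N := (Nat.le_ceil _).trans (Nat.cast_le.2 (by omega))
    have h4 : (0 : ℝ) < w N := by exact_mod_cast (show 0 < w N by omega)
    rw [div_le_iff₀ h4, mul_comm]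
    exact (div_le_iff₀ hε).1 h3
  · refine PrimeWeight.correlationCondition_of_correlation_bound hnonneg hC q₀ (q₀ ^ 2) ?_ ?_
    · intro ε hε
      obtain ⟨D, hD1, hD⟩ := PrimeWeight.exists_sieveWeight_le hχ hα0 hε
      refine ⟨D, hD1, ?_⟩
      filter_upwards [hgood, Filter.eventually_ge_atTop 2] with N hN hN2
      exact hD N (w N) (b N) hN2 hN.primorial_le hN.one_le hN.lt_primorial
    · filter_upwards [hgood] with N hN
      intro _ q hq h hinj
      exact hN.correlation q hq h hinj
  · have hN : (1 : ℝ) < N := by exact_mod_cast (Fact.out : N.Prime).one_lt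
    rw [abs_of_nonneg (PrimeWeight.primePart_nonneg (hR N) _ _ _ x), mul_assoc,
      ← Real.log_rpow (by linarith)]
    exact PrimeWeight.primePart_le_log hχ (Real.one_lt_rpow hN hα0) x
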